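/- **Setting.** Let $\bar f(l,m)=f(l+1,m)$ and $\hat f(l,m)=f(l,m+1)$ for $f:\mathbb Z^2\to\mathbb C$. A *$2\times 2$ Lax pair with separable terms* is a pair of matrices $$L=\begin{pmatrix}aA&bB\\ cC&dD\end{pmatrix},\qquad M=\begin{pmatrix}\alpha\Lambda&\beta\Xi\\ \gamma\Gamma&\delta\Delta\end{pmatrix},$$ where $a,b,c,d,\alpha,\beta,\gamma,\delta$ are functions on $\mathbb Z^2$ and $A,B,C,D,\Lambda,\Xi,\Gamma,\Delta$ are analytic functions of a spectral variable $\nu$ in a nonempty connected open set $U\subseteq\mathbb C$. Any of the entries may be zero terms (i.e. their spectral factor vanishes identically); the lattice factors of the other entries have no zeros on $\mathbb Z^2$. For given spectral factors, the compatibility condition $\hat L M=\bar M L$, required at all lattice points and identically in $\nu$, is a system of equations for the lattice factors of the nonzero entries (the unknowns). Entry $(i,j)$ of the compatibility condition counts as as many lattice equations as there are linearly independent functions among the products of spectral factors $L_{ik}M_{kj}$, $M_{ik}L_{kj}$ ($k=1,2$) that occur in it. Let $E$ be the total number of equations, $N$ the number of unknowns, and $G$ the number of gauge functions, one for each index $i\in\{1,2\}$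 such that row $i$ or column $i$ of $L$ or $M$ has a nonzero entry (so $G=2$ unless nearly all terms are zero). The gauge transformations are $L\mapsto \bar g L g^{-1}$, $M\mapsto\hat g M g^{-1}$ with $g=\operatorname{diag}(g_1,g_2)$, $g_i:\mathbb Z^2\to\mathbb C\setminus\{0\}$. With $N-G$ replaced by $0$ if negative, the system is * *underdetermined* if $E<N-G$; * *overdetermined* if $E>N-G$ or if it has no solution; * *trivial* if it is linear in one of the following senses. Multiplicatively: it is equivalent to a set of equations of the form (monomial) $=$ (nonzero constant)$\,\cdot\,$(monomial), the monomials being in shifts of the lattice factors and of the determinants $\det L,\det M$ at points of $U$. Additively: in every solution the diagonal lattice factors can all be made $\equiv 1$ by a gauge transformation, and then the remaining equations for the off-diagonal lattice factors are homogeneous linear. The system *reduces* to a system of equations for new dependent variables without zeros if the following holds, possibly after interchanging the two indices of the matrices, and/or interchanging $L$ with $M$ together with $l$ with $m$: up to multiplication of each entry by a fixed nonzero constant and up to gauge transformations, the solutions of the system are exactly the lattice factors listed below with new variables that solve the new system. **Theorem.** For any $2\times2$ Lax pair with separable terms, zero terms allowed, the system given by the compatibility condition is trivial, underdetermined or overdetermined,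 or it reduces to one of the following. 1. $\mathrm{LMKdV}_2$, with any function $\lambda(l)$ without zeros: $$\frac{\hat{\bar x}}{\hat x}+\frac{\hat z}{z}=\lambda\frac{\bar z}{z}+\frac{\hat{\bar x}}{\bar x},\qquad \frac{\hat x}{x}+\lambda\frac{\hat{\bar z}}{\hat z}=\frac{\bar x}{x}+\frac{\hat{\bar z}}{\bar z},$$ with lattice factors $\begin{pmatrix}\bar x/x&1\\1&\lambda\bar z/z\end{pmatrix}$, $\begin{pmatrix}\hat x/x&1\\1&\hat z/z\end{pmatrix}$. 2. $\mathrm{LSG}_2$, with any functions $\lambda(l)$, $\mu(m)$ without zeros: $$\frac{\bar x}{\hat{\bar x}}+\lambda\mu\frac{x}{\bar z}=\frac{x}{\hat x}+\frac{\hat z}{\hat{\bar x}},\qquad \frac{z}{\hat z}+\lambda\mu\frac{\hat x}{\hat{\bar z}}=\frac{\bar z}{\hat{\bar z}}+\frac{z}{\bar x},$$ with lattice factors $\begin{pmatrix}\bar z/z&\lambda\\1&\bar x/x\end{pmatrix}$, $\begin{pmatrix}1&\hat z/x\\ \mu\hat x/z&1\end{pmatrix}$. 3. The degenerate form of $\mathrm{LMKdV}_2$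 in which $\lambda\equiv0$ (in the system and in the lattice factors). 4. The degenerate form of $\mathrm{LSG}_2$ in which $\lambda\equiv 0$ (in the system and in the lattice factors), with any $\mu(m)$ without zeros in the lattice factors. 5. The degenerate form of the lattice sine-Gordon equation (the reduction $z=1/x$ of $\mathrm{LSG}_2$) in which $\lambda\equiv\mu\equiv0$: $$\bar x\hat x-x\hat{\bar x}=1,$$ with lattice factors $\begin{pmatrix}1&0\\1/x&\bar x/x\end{pmatrix}$, $\begin{pmatrix}\hat x/x&1/x\\0&1\end{pmatrix}$. -/

import Mathlib

noncomputable section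

/-- Functions of the two discrete lattice variables `l`, `m`. -/
abbrev LatticeFn : Type := ℤ → ℤ → ℂ

/-- The shift `f ↦ f(l+1, m)`, written with a bar. -/
def barShift (f : LatticeFn) : LatticeFn := fun l m => f (l + 1) m

/-- The shift `f ↦ f(l, m+1)`, written with a hat. -/
def hatShift (f : LatticeFn) : LatticeFn := fun l m => f l (m + 1)

/-- The lattice factors (lower case letters) of the entries of the two Lax matrices. -/
structure LaxTerms where
  L : Matrix (Fin 2) (Fin 2) LatticeFn
  M : Matrix (Fin 2) (Fin 2) LatticeFn

/-- The spectral factors (upper case letters) of the entries of the two Lax matrices: analytic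
functions of the spectral variable on some domain `U` of the complex plane. An entry is a zero
term when its spectral factor vanishes identically on `U`. -/
structure LaxSpectrum where
  U : Set ℂ
  isOpen : IsOpen U
  isConnected : IsConnected U
  L : Matrix (Fin 2) (Fin 2) (ℂ → ℂ)
  M : Matrix (Fin 2) (Fin 2) (ℂ → ℂ)
  analyticL : ∀ i j, AnalyticOnNhd ℂ (L i j) U
  analyticM : ∀ i j, AnalyticOnNhd ℂ (M i j) U

namespace LaxSpectrum

variable (S : LaxSpectrum)

/-- The Lax matrix `L(l, m; ν)`, with a separable term in each entry. -/
def laxL (t : LaxTerms) (l m : ℤ) (ν : ℂ) : Matrix (Fin 2) (Fin 2) ℂ :=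
  Matrix.of fun i j => t.L i j l m * S.L i j ν

/-- The Lax matrix `M(l, m; ν)`, with a separable term in each entry. -/
def laxM (t : LaxTerms) (l m : ℤ) (ν : ℂ) : Matrix (Fin 2) (Fin 2) ℂ :=
  Matrix.of fun i j => t.M i j l m * S.M i j ν

/-- The entry `(i, j)` of `L` is not a zero term. -/
def NonzeroL (i j : Fin 2) : Prop := ∃ ν ∈ S.U, S.L i j ν ≠ 0

/-- The entry `(i, j)` of `M` is not a zero term. -/
def NonzeroM (i j : Fin 2) : Prop := ∃ ν ∈ S.U, S.M i j ν ≠ 0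

/-- The lattice factors never vanish, except that those of the zero terms are `0` (by
normalization: they do not enter the Lax matrices). -/
def Admissible (t : LaxTerms) : Prop :=
  (∀ i j l m, t.L i j l m ≠ 0 ↔ S.NonzeroL i j) ∧
  (∀ i j l m, t.M i j l m ≠ 0 ↔ S.NonzeroM i j)

/-- The system of equations for the lattice factors that arises from the compatibility
condition, which is to hold at every lattice point and identically in the spectral variable. -/
def System (t : LaxTerms) : Prop :=
  S.Admissible t ∧ ∀ l m : ℤ, ∀ ν ∈ S.U,
    S.laxL t l (m + 1) ν * S.laxM t l m ν = S.laxM t (l + 1) m ν * S.laxL t l m ν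

/-- The products of spectral factors that occur in entry `(i, j)` of the compatibility
condition, as functions on the spectral domain. -/
def products (i j : Fin 2) : Set (S.U → ℂ) :=
  (Set.range fun k => fun ν : S.U => S.L i k ν * S.M k j ν) ∪
  (Set.range fun k => fun ν : S.U => S.M i k ν * S.L k j ν)

/-- The number of lattice equations into which the compatibility condition splits: entry `(i, j)`
splits into as many equations as there are linearly independent spectral products in it. -/
def numEquations : ℕ :=
  ∑ i, ∑ j, Module.finrank ℂ (Submodule.span ℂ (S.products i j))

open Classical in
/-- The number of unknown lattice functions, that is, of entries that are not zero terms. -/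
def numUnknowns : ℕ :=
  (Finset.univ.filter fun p : Fin 2 × Fin 2 => S.NonzeroL p.1 p.2).card +
  (Finset.univ.filter fun p : Fin 2 × Fin 2 => S.NonzeroM p.1 p.2).card

open Classical in
/-- The number of unknowns made redundant by diagonal gauge transformations: one for each of the
two indices that labels the row or the column of an entry that is not a zero term. It is `2`
unless there are almost no terms. -/
def numGauge : ℕ :=
  (Finset.univ.filter fun i : Fin 2 =>
    ∃ j, S.NonzeroL i j ∨ S.NonzeroL j i ∨ S.NonzeroM i j ∨ S.NonzeroM j i).card

/-- Fewer equations than unknowns, after removal of the gauge freedom. -/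
def Underdetermined : Prop := S.numEquations < S.numUnknowns - S.numGauge

/-- More equations than unknowns, after removal of the gauge freedom, or no solution at all. -/
def Overdetermined : Prop :=
  S.numUnknowns - S.numGauge < S.numEquations ∨ ∀ t, ¬ S.System t

end LaxSpectrum

/-- A lattice function without zeros. -/
def Nonvanishing (f : LatticeFn) : Prop := ∀ l m, f l m ≠ 0

/-- The gauge transformation with the matrix `diag(g 0, g 1)`, depending on the lattice variables
only: `L ↦ ḡ L g⁻¹`, `M ↦ ĝ M g⁻¹`. -/
def LaxTerms.gauge (g : Fin 2 → LatticeFn) (t : LaxTerms) : LaxTerms where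
  L := Matrix.of fun i j l m => g i (l + 1) m * t.L i j l m / g j l m
  M := Matrix.of fun i j l m => g i l (m + 1) * t.M i j l m / g j l m

/-- Multiplication of each lattice factor by a constant (constants may be moved between the
lattice factor and the spectral factor of an entry). -/
def LaxTerms.rescale (κ κ' : Matrix (Fin 2) (Fin 2) ℂ) (t : LaxTerms) : LaxTerms where
  L := Matrix.of fun i j l m => κ i j * t.L i j l m
  M := Matrix.of fun i j l m => κ' i j * t.M i j l m

/-- Interchange of the two indices `0`, `1` of the Lax matrices. -/
def LaxTerms.swapIndices (t : LaxTerms) : LaxTerms where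
  L := t.L.submatrix (Equiv.swap 0 1) (Equiv.swap 0 1)
  M := t.M.submatrix (Equiv.swap 0 1) (Equiv.swap 0 1)

/-- Interchange of `L` and `M`, together with that of the lattice variables `l` and `m`. -/
def LaxTerms.exchange (t : LaxTerms) : LaxTerms where
  L := t.M.map fun f l m => f m l
  M := t.L.map fun f l m => f m l

/-! ### Trivial systems -/

/-- The quantities between which multiplicatively linear equations are considered: the lattice
factors and the determinants of the Lax matrices at the points of the spectral domain. -/
inductive LaxVar (U : Set ℂ) : Type
  | entryL (i j : Fin 2)
  | entryM (i j : Fin 2)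
  | detL (ν : U)
  | detM (ν : U)

/-- The value of such a quantity. -/
def LaxSpectrum.value (S : LaxSpectrum) (t : LaxTerms) : LaxVar S.U → LatticeFn
  | .entryL i j => t.L i j
  | .entryM i j => t.M i j
  | .detL ν => fun l m => (S.laxL t l m ν).det
  | .detM ν => fun l m => (S.laxM t l m ν).det

/-- A monomial in shifts of these quantities, evaluated at a lattice point. The exponent of the
quantity `v` shifted by `(i, j)` is `e (v, i, j)`. -/
def LaxSpectrum.monomial (S : LaxSpectrum) (t : LaxTerms) (e : LaxVar S.U × ℤ × ℤ →₀ ℕ) :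
    LatticeFn := fun l m =>
  e.prod fun v n => (S.value t v.1 (l + v.2.1) (m + v.2.2)) ^ n

/-- A multiplicatively linear equation: `lhs = coeff * rhs` with monomials on both sides and a
nonzero constant. -/
structure MulLinearEq (U : Set ℂ) where
  coeff : ℂ
  coeff_ne : coeff ≠ 0
  lhs : LaxVar U × ℤ × ℤ →₀ ℕ
  rhs : LaxVar U × ℤ × ℤ →₀ ℕ

/-- The system is equivalent to a system of multiplicatively linear equations. -/
def LaxSpectrum.MultiplicativelyLinear (S : LaxSpectrum) : Prop :=
  ∃ E : Set (MulLinearEq S.U), ∀ t, S.Admissible t →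
    (S.System t ↔ ∀ e ∈ E, ∀ l m,
      S.monomial t e.lhs l m = e.coeff * S.monomial t e.rhs l m)

/-- All diagonal lattice factors are identically `1`. -/
def LaxTerms.UnitDiagonal (t : LaxTerms) : Prop :=
  ∀ i l m, t.L i i l m = 1 ∧ t.M i i l m = 1

/-- The off-diagonal lattice factors. -/
def LaxTerms.offDiagonal (t : LaxTerms) :
    Matrix (Fin 2) (Fin 2) LatticeFn × Matrix (Fin 2) (Fin 2) LatticeFn :=
  (Matrix.of fun i j => if i = j then 0 else t.L i j,
   Matrix.of fun i j => if i = j then 0 else t.M i j)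

/-- The diagonal lattice factors can be removed by a gauge transformation, and what remains is a
homogeneous additively linear system for the off-diagonal ones. -/
def LaxSpectrum.AdditivelyLinear (S : LaxSpectrum) : Prop :=
  (∀ t, S.System t → ∃ g : Fin 2 → LatticeFn, (∀ i, Nonvanishing (g i)) ∧
    (t.gauge g).UnitDiagonal) ∧
  ∃ V : Submodule ℂ (Matrix (Fin 2) (Fin 2) LatticeFn × Matrix (Fin 2) (Fin 2) LatticeFn),
    ∀ t, S.Admissible t → t.UnitDiagonal → (S.System t ↔ t.offDiagonal ∈ V)

/-- A trivial system is a linear one, in the multiplicative or in the additive sense. -/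
def LaxSpectrum.Trivial (S : LaxSpectrum) : Prop :=
  S.MultiplicativelyLinear ∨ S.AdditivelyLinear

/-! ### The nonlinear systems and the lattice factors of their Lax pairs -/

/-- The lattice modified KdV system LMKdV₂ for `x = X 0`, `z = X 1`; its degenerate form
has `lam = 0`. -/
def LMKdV2 (lam : ℤ → ℂ) (X : Fin 2 → LatticeFn) : Prop :=
  let x := X 0
  let z := X 1
  ∀ l m : ℤ,
    x (l + 1) (m + 1) / x l (m + 1) + z l (m + 1) / z l m
      = lam l * (z (l + 1) m / z l m) + x (l + 1) (m + 1) / x (l + 1) m ∧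
    x l (m + 1) / x l m + lam l * (z (l + 1) (m + 1) / z l (m + 1))
      = x (l + 1) m / x l m + z (l + 1) (m + 1) / z (l + 1) m

/-- Lattice factors of the Lax pair of LMKdV₂. -/
def laxLMKdV2 (lam : ℤ → ℂ) (X : Fin 2 → LatticeFn) : LaxTerms where
  L := !![barShift (X 0) / X 0, 1; 1, fun l m => lam l * (X 1 (l + 1) m / X 1 l m)]
  M := !![hatShift (X 0) / X 0, 1; 1, hatShift (X 1) / X 1]

/-- The lattice sine-Gordon system LSG₂ for `x = X 0`, `z = X 1`; its degenerate form
has `lam = 0`. -/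
def LSG2 (lam mu : ℤ → ℂ) (X : Fin 2 → LatticeFn) : Prop :=
  let x := X 0
  let z := X 1
  ∀ l m : ℤ,
    x (l + 1) m / x (l + 1) (m + 1) + lam l * mu m * (x l m / z (l + 1) m)
      = x l m / x l (m + 1) + z l (m + 1) / x (l + 1) (m + 1) ∧
    z l m / z l (m + 1) + lam l * mu m * (x l (m + 1) / z (l + 1) (m + 1))
      = z (l + 1) m / z (l + 1) (m + 1) + z l m / x (l + 1) m

/-- Lattice factors of the Lax pair of LSG₂. -/
def laxLSG2 (lam mu : ℤ → ℂ) (X : Fin 2 → LatticeFn) : LaxTerms where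
  L := !![barShift (X 1) / X 1, fun l _ => lam l; 1, barShift (X 0) / X 0]
  M := !![1, hatShift (X 1) / X 0; fun l m => mu m * (X 0 l (m + 1) / X 1 l m), 1]

/-- The scalar lattice sine-Gordon equation for `x = X 0`, the reduction `z = 1 / x` of LSG₂; its
degenerate form has `lam = mu = 0`. -/
def LSG (lam mu : ℤ → ℂ) (X : Fin 1 → LatticeFn) : Prop :=
  let x := X 0
  ∀ l m : ℤ,
    x (l + 1) m * x l (m + 1) - x l m * x (l + 1) (m + 1)
      = 1 - lam l * mu m * (x l m * x (l + 1) m * x l (m + 1) * x (l + 1) (m + 1))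

/-- The scalar equation is the reduction `z = 1 / x` of the two-component system. -/
theorem lsg2_inv_iff (lam mu : ℤ → ℂ) (x : LatticeFn) (hx : Nonvanishing x) :
    LSG2 lam mu ![x, x⁻¹] ↔ LSG lam mu ![x] := by
  refine forall_congr' fun l => forall_congr' fun m => ?_
  have h1 := hx l m
  have h2 := hx (l + 1) m
  have h3 := hx l (m + 1)
  have h4 := hx (l + 1) (m + 1)
  simp only [Matrix.cons_val_zero, Matrix.cons_val_one, Pi.inv_apply]
  constructor
  · rintro ⟨h, -⟩
    field_simp at h
    linear_combination h
  · intro h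
    constructor
    · field_simp
      linear_combination h
    · field_simp
      linear_combination h

/-- Lattice factors of a Lax pair of the degenerate lattice sine-Gordon equation. -/
def laxDegenerateLSG (X : Fin 1 → LatticeFn) : LaxTerms where
  L := !![1, 0; 1 / X 0, barShift (X 0) / X 0]
  M := !![hatShift (X 0) / X 0, 1 / X 0; 0, 1]

/-! ### Reduction -/

/-- The system `T` for the lattice factors is reduced to the system `eqn` for the new dependent
variables `X` by the change of variables `lax`: up to constant factors and gauge transformations,
the solutions of `T` are exactly the lattice factors `lax X` where `X` solves `eqn`. -/
def ReducesTo {n : ℕ} (T : LaxTerms → Prop) (eqn : (Fin n → LatticeFn) → Prop)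
    (lax : (Fin n → LatticeFn) → LaxTerms) : Prop :=
  ∃ κ κ' : Matrix (Fin 2) (Fin 2) ℂ, (∀ i j, κ i j ≠ 0) ∧ (∀ i j, κ' i j ≠ 0) ∧
    (∀ X : Fin n → LatticeFn, (∀ i, Nonvanishing (X i)) →
      ∀ g : Fin 2 → LatticeFn, (∀ i, Nonvanishing (g i)) →
        (T (((lax X).rescale κ κ').gauge g) ↔ eqn X)) ∧
    (∀ t, T t → ∃ X : Fin n → LatticeFn, (∀ i, Nonvanishing (X i)) ∧
      ∃ g : Fin 2 → LatticeFn, (∀ i, Nonvanishing (g i)) ∧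
        t = ((lax X).rescale κ κ').gauge g)

/-- Reduction after interchanging, if need be, the two indices of the Lax matrices, or `L` and
`M` (and with them `l` and `m`), or both. -/
def LaxSpectrum.ReducibleTo {n : ℕ} (S : LaxSpectrum) (eqn : (Fin n → LatticeFn) → Prop)
    (lax : (Fin n → LatticeFn) → LaxTerms) : Prop :=
  ReducesTo S.System eqn lax ∨
  ReducesTo (fun t => S.System t.swapIndices) eqn lax ∨
  ReducesTo (fun t => S.System t.exchange) eqn lax ∨
  ReducesTo (fun t => S.System t.exchange.swapIndices) eqn lax

end

/-!
Write `a, b, c, d` and `α, β, γ, δ` for the lattice factors and `A, B, C, D` and `Λ, Ξ, Γ, Δ` for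
the spectral factors of `L` and `M`, row by row. Each entry of `L̂ M = M̄ L` has four terms, and
the outcome depends only on which terms vanish and on the linear relations between the spectral
products in each entry. Analytic functions on a connected open set have no zero divisors, so that
common factors can be cancelled from such relations (`LaxSpectrum.proportionalOn_of_mul_left`).
The interchange of the two indices and that of `L` and `M` reduce the number of cases
(`Classified.of_swapIndices`, `Classified.of_exchange`).

A system without solutions is overdetermined. Otherwise a solution gives, at any lattice point, a
linear relation between the spectral products of an entry, with coefficients that are not zero. If
an entry has only two terms, these are therefore proportional, and the entry is a monomial
equation; with three terms, it is equivalent to monomial equations unless the three products are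
proportional (`HasMonomialForm.entry_of_two_terms`, `HasMonomialForm.entry_of_three_terms`).

* If an off-diagonal term is zero, say `B`, then the system is linear, underdetermined or a
  degenerate form of a sine-Gordon system (`classified_of_B_eq_zero`).
* If the off-diagonal terms are not zero but a diagonal one is, say `D` or `Δ`, then the system is
  linear, the degenerate form of LMKdV₂, or its numbers of equations and unknowns do not match
  (`classified_of_D_or_Δ_eq_zero`).
* Without zero terms there are eight unknowns and two gauge functions, so that seven equations are
  too many. If `D` is proportional to `A` and `Δ` to `Λ`, then up to constants the diagonal
  entries contain the products `AΛ`, `BΓ`, `CΞ`, and the off-diagonal ones `AΞ`, `BΛ` and `CΛ`,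
  `AΓ`. If the products are proportional in each entry, then there are only four equations. If
  independent products occur in the off-diagonal entries only, then the system is LSG₂; if they
  occur in the diagonal ones only, it is LMKdV₂; otherwise there are too many equations
  (`classified_of_diagonal_proportionalOn`).
* If `D` and `A`, or `Δ` and `Λ`, are not proportional, then each off-diagonal entry gives at
  least two equations. The system is overdetermined unless the off-diagonal entries give exactly
  two equations each and the diagonal ones a single equation each. In that case elimination leads
  to a quadratic relation between the independent functions `Λ` and `Δ`, which has to be trivial.
  It follows that the spectral factors of `M` depend on those of `L` like the adjugate matrix, and
  with the help of `det L` at one point of the spectral domain the diagonal entries become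
  monomial equations (`proportionalOn_of_relations`, `multiplicativelyLinear_of_adjugate`).

For the reductions, constant factors are adjusted so that the system takes one of two normal forms
(`MKdVForm`, `SineGordonForm`). The monomial equations in a normal form say that first-order
recursions in the two lattice directions are compatible. Their solutions are the gauge functions
and the new variables, in terms of which the remaining equations are the ones of the list
(`exists_multiplicative_flow`, `exists_lattice_flow`).
-/

/-! ### Proportional spectral functions -/

/-- `f` is a nonzero constant multiple of `g` on `U`. -/
def ProportionalOn (U : Set ℂ) (f g : ℂ → ℂ) : Prop :=
  ∃ k : ℂ, k ≠ 0 ∧ ∀ ν ∈ U, f ν = k * g ν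

namespace ProportionalOn

variable {U : Set ℂ} {f g h : ℂ → ℂ}

theorem refl (U : Set ℂ) (f : ℂ → ℂ) : ProportionalOn U f f :=
  ⟨1, one_ne_zero, fun _ _ => (one_mul _).symm⟩

theorem symm (hfg : ProportionalOn U f g) : ProportionalOn U g f := by
  obtain ⟨k, hk, e⟩ := hfg
  refine ⟨k⁻¹, inv_ne_zero hk, fun ν hν => ?_⟩
  rw [e ν hν, inv_mul_cancel_left₀ hk]

theorem trans (hfg : ProportionalOn U f g) (hgh : ProportionalOn U g h) :
    ProportionalOn U f h := by
  obtain ⟨k, hk, e⟩ := hfg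
  obtain ⟨k', hk', e'⟩ := hgh
  exact ⟨k * k', mul_ne_zero hk hk', fun ν hν => by rw [e ν hν, e' ν hν, mul_assoc]⟩

theorem mul {f' g' : ℂ → ℂ} (hfg : ProportionalOn U f g) (hfg' : ProportionalOn U f' g') :
    ProportionalOn U (fun ν => f ν * f' ν) (fun ν => g ν * g' ν) := by
  obtain ⟨k, hk, e⟩ := hfg
  obtain ⟨k', hk', e'⟩ := hfg'
  exact ⟨k * k', mul_ne_zero hk hk', fun ν hν => by simp only [e ν hν, e' ν hν]; ring⟩

theorem exists_ne_zero (hfg : ProportionalOn U f g) (hf : ∃ ν ∈ U, f ν ≠ 0) :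
    ∃ ν ∈ U, g ν ≠ 0 := by
  obtain ⟨k, -, e⟩ := hfg
  obtain ⟨ν, hν, hne⟩ := hf
  exact ⟨ν, hν, fun h => hne (by rw [e ν hν, h, mul_zero])⟩

/-- A linear relation between two functions, the first of which is not zero, in which the first
has a nonzero coefficient. -/
theorem of_relation {c d : ℂ} (hf : ∃ ν ∈ U, f ν ≠ 0) (hc : c ≠ 0)
    (e : ∀ ν ∈ U, c * f ν = d * g ν) : ProportionalOn U f g := by
  have e' : ∀ ν ∈ U, f ν = c⁻¹ * d * g ν := fun ν hν => by
    rw [mul_assoc, ← e ν hν, inv_mul_cancel_left₀ hc]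
  refine ⟨c⁻¹ * d, fun h0 => ?_, e'⟩
  obtain ⟨ν, hν, hne⟩ := hf
  exact hne (by rw [e' ν hν, h0, zero_mul])

end ProportionalOn

/-- `f` and `g` are linearly independent as functions on `U`. -/
def IndependentOn (U : Set ℂ) (f g : ℂ → ℂ) : Prop :=
  ∀ c d : ℂ, (∀ ν ∈ U, c * f ν + d * g ν = 0) → c = 0 ∧ d = 0

theorem independentOn_of_not_proportionalOn {U : Set ℂ} {f g : ℂ → ℂ}
    (hf : ∃ ν ∈ U, f ν ≠ 0) (hg : ∃ ν ∈ U, g ν ≠ 0) (h : ¬ ProportionalOn U f g) :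
    IndependentOn U f g := by
  intro c d e
  have hc : c = 0 := by
    by_contra hc
    exact h (.of_relation (d := -d) hf hc fun ν hν => by linear_combination e ν hν)
  refine ⟨hc, ?_⟩
  by_contra hd
  obtain ⟨ν, hν, hne⟩ := hg
  have := e ν hν
  simp_all

theorem eqOn_zero_or_exists (U : Set ℂ) (f : ℂ → ℂ) : (∀ ν ∈ U, f ν = 0) ∨ ∃ ν ∈ U, f ν ≠ 0 := by
  by_cases h : ∃ ν ∈ U, f ν ≠ 0
  · exact .inr h
  · push Not at h
    exact .inl h

namespace LaxSpectrum

variable {S : LaxSpectrum}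

/-- Analytic functions on a connected open set have no zero divisors. -/
theorem eq_zero_of_mul_eq_zero (S : LaxSpectrum) {f g : ℂ → ℂ} (hf : AnalyticOnNhd ℂ f S.U)
    (hg : AnalyticOnNhd ℂ g S.U) (hf0 : ∃ ν ∈ S.U, f ν ≠ 0) (h : ∀ ν ∈ S.U, f ν * g ν = 0) :
    ∀ ν ∈ S.U, g ν = 0 := by
  obtain h | h :=
    AnalyticOnNhd.eq_zero_or_eq_zero_of_mul_eq_zero hf hg h S.isConnected.isPreconnected
  · obtain ⟨ν, hν, hne⟩ := hf0
    exact absurd (h ν hν) hne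
  · exact h

theorem exists_mul_ne_zero (S : LaxSpectrum) {f g : ℂ → ℂ} (hf : AnalyticOnNhd ℂ f S.U)
    (hg : AnalyticOnNhd ℂ g S.U) (hf0 : ∃ ν ∈ S.U, f ν ≠ 0) (hg0 : ∃ ν ∈ S.U, g ν ≠ 0) :
    ∃ ν ∈ S.U, f ν * g ν ≠ 0 := by
  by_contra! h
  obtain ⟨ν, hν, hne⟩ := hg0
  exact hne (S.eq_zero_of_mul_eq_zero hf hg hf0 h ν hν)

theorem exists_ne_zero_of_mul {f g : ℂ → ℂ} (h : ∃ ν ∈ S.U, f ν * g ν ≠ 0) :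
    (∃ ν ∈ S.U, f ν ≠ 0) ∧ ∃ ν ∈ S.U, g ν ≠ 0 := by
  obtain ⟨ν, hν, hne⟩ := h
  exact ⟨⟨ν, hν, left_ne_zero_of_mul hne⟩, ⟨ν, hν, right_ne_zero_of_mul hne⟩⟩

theorem proportionalOn_of_mul_left (S : LaxSpectrum) {f g h : ℂ → ℂ} (hf : AnalyticOnNhd ℂ f S.U)
    (hg : AnalyticOnNhd ℂ g S.U) (hh : AnalyticOnNhd ℂ h S.U) (hh0 : ∃ ν ∈ S.U, h ν ≠ 0)
    (e : ProportionalOn S.U (fun ν => h ν * f ν) (fun ν => h ν * g ν)) :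
    ProportionalOn S.U f g := by
  obtain ⟨k, hk, e⟩ := e
  refine ⟨k, hk, fun ν hν => sub_eq_zero.1 ?_⟩
  refine S.eq_zero_of_mul_eq_zero (g := fun ν => f ν - k * g ν) hh
    (hf.sub (analyticOnNhd_const.mul hg)) hh0 (fun ν hν => ?_) ν hν
  linear_combination e ν hν

/-! ### Counting equations and unknowns -/

theorem products_eq (i j : Fin 2) : S.products i j =
    {(fun ν : S.U => S.L i 0 ν * S.M 0 j ν), (fun ν : S.U => S.L i 1 ν * S.M 1 j ν),
      (fun ν : S.U => S.M i 0 ν * S.L 0 j ν), (fun ν : S.U => S.M i 1 ν * S.L 1 j ν)} := by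
  ext f
  simp only [products, Set.mem_union, Set.mem_range, Fin.exists_fin_two, Set.mem_insert_iff,
    Set.mem_singleton_iff, eq_comm (a := f), or_assoc]

theorem products_finite (i j : Fin 2) : (S.products i j).Finite :=
  (Set.finite_range _).union (Set.finite_range _)

theorem mul_LM_mem_products (i k j : Fin 2) :
    (fun ν : S.U => S.L i k ν * S.M k j ν) ∈ S.products i j := .inl ⟨k, rfl⟩

theorem mul_ML_mem_products (i k j : Fin 2) :
    (fun ν : S.U => S.M i k ν * S.L k j ν) ∈ S.products i j := .inr ⟨k, rfl⟩

/-- The number of lattice equations from entry `(i, j)` of the compatibility condition. -/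
noncomputable def entryRank (S : LaxSpectrum) (i j : Fin 2) : ℕ :=
  Module.finrank ℂ (Submodule.span ℂ (S.products i j))

theorem numEquations_eq (S : LaxSpectrum) : S.numEquations =
    S.entryRank 0 0 + S.entryRank 0 1 + S.entryRank 1 0 + S.entryRank 1 1 := by
  simp only [numEquations, Fin.sum_univ_two, entryRank]
  ring

theorem entryRank_le_one {i j : Fin 2} (g : ℂ → ℂ)
    (h : ∀ k, (∃ c : ℂ, ∀ ν ∈ S.U, S.L i k ν * S.M k j ν = c * g ν) ∧
      ∃ c : ℂ, ∀ ν ∈ S.U, S.M i k ν * S.L k j ν = c * g ν) : S.entryRank i j ≤ 1 := by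
  have hle : Submodule.span ℂ (S.products i j) ≤
      Submodule.span ℂ {fun ν : S.U => g ν} := by
    rw [Submodule.span_le]
    rintro f (⟨k, rfl⟩ | ⟨k, rfl⟩)
    · obtain ⟨c, hc⟩ := (h k).1
      exact Submodule.mem_span_singleton.2 ⟨c, funext fun ν => (hc ν ν.2).symm⟩
    · obtain ⟨c, hc⟩ := (h k).2
      exact Submodule.mem_span_singleton.2 ⟨c, funext fun ν => (hc ν ν.2).symm⟩
  exact (Submodule.finrank_mono hle).trans ((finrank_span_le_card _).trans (by simp))

theorem entryRank_eq_zero {i j : Fin 2}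
    (h : ∀ k, (∀ ν ∈ S.U, S.L i k ν * S.M k j ν = 0) ∧ ∀ ν ∈ S.U, S.M i k ν * S.L k j ν = 0) :
    S.entryRank i j = 0 := by
  have : Submodule.span ℂ (S.products i j) = ⊥ := by
    rw [Submodule.span_eq_bot]
    rintro f (⟨k, rfl⟩ | ⟨k, rfl⟩)
    · exact funext fun ν => (h k).1 ν ν.2
    · exact funext fun ν => (h k).2 ν ν.2
  rw [entryRank, this, finrank_bot]

theorem card_le_entryRank {i j : Fin 2} {n : ℕ} {v : Fin n → S.U → ℂ}
    (hv : LinearIndependent ℂ v) (hm : ∀ a, v a ∈ S.products i j) : n ≤ S.entryRank i j := by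
  have := FiniteDimensional.span_of_finite ℂ (S.products_finite i j)
  have hli : LinearIndependent ℂ fun a => (⟨v a, Submodule.subset_span (hm a)⟩ :
      Submodule.span ℂ (S.products i j)) :=
    LinearIndependent.of_comp (Submodule.subtype _) hv
  simpa [entryRank] using hli.fintype_card_le_finrank

theorem one_le_entryRank {i j : Fin 2} {f : ℂ → ℂ}
    (hm : (fun ν : S.U => f ν) ∈ S.products i j) (hf : ∃ ν ∈ S.U, f ν ≠ 0) :
    1 ≤ S.entryRank i j := by
  refine card_le_entryRank (v := ![fun ν : S.U => f ν]) ?_ (by simpa using hm)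
  obtain ⟨ν, hν, hne⟩ := hf
  refine LinearIndependent.of_subsingleton 0 fun h => hne ?_
  exact congrFun h ⟨ν, hν⟩

theorem two_le_entryRank {i j : Fin 2} {f g : ℂ → ℂ}
    (hf : (fun ν : S.U => f ν) ∈ S.products i j) (hg : (fun ν : S.U => g ν) ∈ S.products i j)
    (h : IndependentOn S.U f g) : 2 ≤ S.entryRank i j := by
  refine card_le_entryRank (v := ![fun ν : S.U => f ν, fun ν : S.U => g ν]) ?_
    (by simp [Fin.forall_fin_two, hf, hg])
  rw [LinearIndependent.pair_iff]
  exact fun c d e => h c d fun ν hν => congrFun e ⟨ν, hν⟩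

theorem two_le_entryRank_of_not_proportionalOn {i j : Fin 2} {f g : ℂ → ℂ}
    (hf : (fun ν : S.U => f ν) ∈ S.products i j) (hg : (fun ν : S.U => g ν) ∈ S.products i j)
    (hf0 : ∃ ν ∈ S.U, f ν ≠ 0) (hg0 : ∃ ν ∈ S.U, g ν ≠ 0) (h : ¬ ProportionalOn S.U f g) :
    2 ≤ S.entryRank i j :=
  two_le_entryRank hf hg (independentOn_of_not_proportionalOn hf0 hg0 h)

/-- If an entry splits into at most two equations, then any three of its spectral products are
linearly dependent. -/
theorem exists_relation_of_entryRank_le_two {i j : Fin 2} {f g h : ℂ → ℂ}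
    (hr : S.entryRank i j ≤ 2) (hf : (fun ν : S.U => f ν) ∈ S.products i j)
    (hg : (fun ν : S.U => g ν) ∈ S.products i j) (hh : (fun ν : S.U => h ν) ∈ S.products i j)
    (hfg : IndependentOn S.U f g) : ∃ p q : ℂ, ∀ ν ∈ S.U, h ν = p * f ν + q * g ν := by
  by_contra hne
  have : 3 ≤ S.entryRank i j := by
    refine card_le_entryRank
      (v := ![fun ν : S.U => h ν, fun ν : S.U => f ν, fun ν : S.U => g ν]) ?_
      (by simp [Fin.forall_fin_succ, hf, hg, hh])
    refine linearIndependent_finCons.2 ⟨LinearIndependent.pair_iff.2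
      fun c d e => hfg c d fun ν hν => congrFun e ⟨ν, hν⟩, fun hmem => hne ?_⟩
    rw [Matrix.range_cons, Matrix.range_cons, Matrix.range_empty, Set.union_empty,
      Set.singleton_union, Submodule.mem_span_pair] at hmem
    obtain ⟨p, q, e⟩ := hmem
    exact ⟨p, q, fun ν hν => (congrFun e ⟨ν, hν⟩).symm⟩
  lia

open Classical in
theorem numUnknowns_eq (S : LaxSpectrum) : S.numUnknowns =
    (if S.NonzeroL 0 0 then 1 else 0) + (if S.NonzeroL 0 1 then 1 else 0) +
    (if S.NonzeroL 1 0 then 1 else 0) + (if S.NonzeroL 1 1 then 1 else 0) +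
    (if S.NonzeroM 0 0 then 1 else 0) + (if S.NonzeroM 0 1 then 1 else 0) +
    (if S.NonzeroM 1 0 then 1 else 0) + (if S.NonzeroM 1 1 then 1 else 0) := by
  simp only [numUnknowns, Finset.card_filter, Fintype.sum_prod_type, Fin.sum_univ_two]
  ring

theorem numGauge_le (S : LaxSpectrum) : S.numGauge ≤ 2 := by
  classical
  exact (Finset.card_filter_le _ _).trans (by simp)

theorem numGauge_eq_two (h : ∀ i, ∃ j, S.NonzeroL i j ∨ S.NonzeroL j i ∨ S.NonzeroM i j ∨
    S.NonzeroM j i) : S.numGauge = 2 := by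
  simp [numGauge, h]

end LaxSpectrum

/-! ### Symmetries -/

namespace LaxTerms

theorem swapIndices_swapIndices (t : LaxTerms) : t.swapIndices.swapIndices = t := by
  have h : (Equiv.swap (0 : Fin 2) 1 ∘ Equiv.swap (0 : Fin 2) 1) = id := by
    funext i
    simp
  simp [swapIndices, h]

theorem exchange_exchange (t : LaxTerms) : t.exchange.exchange = t := rfl

theorem exchange_swapIndices (t : LaxTerms) :
    t.exchange.swapIndices = t.swapIndices.exchange := rfl

end LaxTerms

namespace LaxSpectrum

/-- The spectrum with the two indices of the matrices interchanged. -/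
def swapIndices (S : LaxSpectrum) : LaxSpectrum where
  U := S.U
  isOpen := S.isOpen
  isConnected := S.isConnected
  L := S.L.submatrix (Equiv.swap 0 1) (Equiv.swap 0 1)
  M := S.M.submatrix (Equiv.swap 0 1) (Equiv.swap 0 1)
  analyticL _ _ := S.analyticL _ _
  analyticM _ _ := S.analyticM _ _

/-- The spectrum with the two matrices interchanged. -/
def exchange (S : LaxSpectrum) : LaxSpectrum where
  U := S.U
  isOpen := S.isOpen
  isConnected := S.isConnected
  L := S.M
  M := S.L
  analyticL := S.analyticM
  analyticM := S.analyticL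

variable {S : LaxSpectrum}

theorem laxL_swapIndices (t : LaxTerms) (l m : ℤ) (ν : ℂ) : S.swapIndices.laxL t.swapIndices l m ν =
    (S.laxL t l m ν).submatrix (Equiv.swap 0 1) (Equiv.swap 0 1) := rfl

theorem laxM_swapIndices (t : LaxTerms) (l m : ℤ) (ν : ℂ) : S.swapIndices.laxM t.swapIndices l m ν =
    (S.laxM t l m ν).submatrix (Equiv.swap 0 1) (Equiv.swap 0 1) := rfl

theorem admissible_swapIndices (t : LaxTerms) :
    S.swapIndices.Admissible t.swapIndices ↔ S.Admissible t := by
  simp only [Admissible, Fin.forall_fin_two, NonzeroL, NonzeroM, swapIndices, LaxTerms.swapIndices,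
    Matrix.submatrix_apply, Equiv.swap_apply_left, Equiv.swap_apply_right]
  tauto

theorem system_swapIndices (t : LaxTerms) :
    S.swapIndices.System t.swapIndices ↔ S.System t := by
  refine and_congr (admissible_swapIndices t) ?_
  refine forall_congr' fun l => forall_congr' fun m => forall_congr' fun ν => ?_
  refine forall_congr' fun hν => ?_
  simp only [laxL_swapIndices, laxM_swapIndices, Matrix.submatrix_mul_equiv]
  exact (Matrix.reindex (Equiv.swap 0 1) (Equiv.swap 0 1)).injective.eq_iff
    (a := S.laxL t l (m + 1) ν * S.laxM t l m ν) (b := S.laxM t (l + 1) m ν * S.laxL t l m ν)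

theorem admissible_exchange (t : LaxTerms) :
    S.exchange.Admissible t.exchange ↔ S.Admissible t := by
  simp only [Admissible, NonzeroL, NonzeroM, exchange, LaxTerms.exchange, Matrix.map_apply]
  rw [and_comm]
  exact and_congr (forall₂_congr fun _ _ => forall_comm) (forall₂_congr fun _ _ => forall_comm)

theorem system_exchange (t : LaxTerms) : S.exchange.System t.exchange ↔ S.System t := by
  refine and_congr (admissible_exchange t) ?_
  rw [forall_comm]
  refine forall_congr' fun l => forall_congr' fun m => forall_congr' fun ν => ?_
  exact forall_congr' fun _ => eq_comm

theorem ReducibleTo.of_swapIndices {n : ℕ} {eqn : (Fin n → LatticeFn) → Prop}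
    {lax : (Fin n → LatticeFn) → LaxTerms} (h : S.swapIndices.ReducibleTo eqn lax) :
    S.ReducibleTo eqn lax := by
  have e : S.swapIndices.System = fun t => S.System t.swapIndices := by
    funext t
    rw [← system_swapIndices (S := S), LaxTerms.swapIndices_swapIndices]
  simp only [ReducibleTo, e, LaxTerms.swapIndices_swapIndices] at h ⊢
  obtain h | h | h | h := h
  exacts [.inr (.inl h), .inl h, .inr (.inr (.inr h)), .inr (.inr (.inl h))]

theorem ReducibleTo.of_exchange {n : ℕ} {eqn : (Fin n → LatticeFn) → Prop}
    {lax : (Fin n → LatticeFn) → LaxTerms} (h : S.exchange.ReducibleTo eqn lax) :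
    S.ReducibleTo eqn lax := by
  have e : S.exchange.System = fun t => S.System t.exchange := by
    funext t
    rw [← system_exchange (S := S), LaxTerms.exchange_exchange]
  simp only [ReducibleTo, e, LaxTerms.exchange_swapIndices, LaxTerms.exchange_exchange] at h ⊢
  obtain h | h | h | h := h
  exacts [.inr (.inr (.inl h)), .inr (.inr (.inr h)), .inl h, .inr (.inl h)]

theorem numEquations_swapIndices (S : LaxSpectrum) :
    S.swapIndices.numEquations = S.numEquations := by
  have e (i j) : S.swapIndices.entryRank i j =
      S.entryRank (Equiv.swap 0 1 i) (Equiv.swap 0 1 j) := by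
    refine congrArg (fun s : Set (S.U → ℂ) => Module.finrank ℂ (Submodule.span ℂ s)) ?_
    refine (products_eq (S := S.swapIndices) i j).trans ?_
    rw [products_eq]
    simp only [swapIndices, Matrix.submatrix_apply, Equiv.swap_apply_left, Equiv.swap_apply_right]
    refine Set.ext fun f : S.U → ℂ => ?_
    change f = _ ∨ f = _ ∨ f = _ ∨ f = _ ↔ f = _ ∨ f = _ ∨ f = _ ∨ f = _
    tauto
  simp only [numEquations_eq, e, Equiv.swap_apply_left, Equiv.swap_apply_right]
  ring

theorem numEquations_exchange (S : LaxSpectrum) : S.exchange.numEquations = S.numEquations := by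
  refine Finset.sum_congr rfl fun i _ => Finset.sum_congr rfl fun j _ => ?_
  exact congrArg (fun s : Set (S.U → ℂ) => Module.finrank ℂ (Submodule.span ℂ s))
    (Set.union_comm _ _)

open Classical in
theorem numUnknowns_swapIndices (S : LaxSpectrum) :
    S.swapIndices.numUnknowns = S.numUnknowns := by
  refine (numUnknowns_eq _).trans ?_
  rw [numUnknowns_eq]
  change (if S.NonzeroL 1 1 then 1 else 0) + (if S.NonzeroL 1 0 then 1 else 0) +
    (if S.NonzeroL 0 1 then 1 else 0) + (if S.NonzeroL 0 0 then 1 else 0) +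
    (if S.NonzeroM 1 1 then 1 else 0) + (if S.NonzeroM 1 0 then 1 else 0) +
    (if S.NonzeroM 0 1 then 1 else 0) + (if S.NonzeroM 0 0 then 1 else 0) = _
  ring

theorem numUnknowns_exchange (S : LaxSpectrum) :
    S.exchange.numUnknowns = S.numUnknowns := Nat.add_comm _ _

theorem numGauge_swapIndices (S : LaxSpectrum) : S.swapIndices.numGauge = S.numGauge := by
  classical
  simp only [numGauge, Finset.card_filter, Fin.sum_univ_two, Fin.exists_fin_two, NonzeroL, NonzeroM,
    swapIndices, Matrix.submatrix_apply, Equiv.swap_apply_left, Equiv.swap_apply_right]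
  rw [add_comm]
  congr 2 <;> exact propext or_comm

theorem numGauge_exchange (S : LaxSpectrum) : S.exchange.numGauge = S.numGauge := by
  classical
  simp only [numGauge, Finset.card_filter]
  refine Finset.sum_congr rfl fun i _ => if_congr (exists_congr fun j => ?_) rfl rfl
  change S.NonzeroM i j ∨ S.NonzeroM j i ∨ S.NonzeroL i j ∨ S.NonzeroL j i ↔ _
  tauto

end LaxSpectrum

/-! ### Multiplicatively linear conditions -/

namespace LaxSpectrum

variable {S : LaxSpectrum}

/-- On lattice factors without unwanted zeros, the condition `P` is equivalent to a set of
multiplicatively linear equations. -/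
def HasMonomialForm (S : LaxSpectrum) (P : LaxTerms → Prop) : Prop :=
  ∃ E : Set (MulLinearEq S.U), ∀ t, S.Admissible t →
    (P t ↔ ∀ e ∈ E, ∀ l m, S.monomial t e.lhs l m = e.coeff * S.monomial t e.rhs l m)

namespace HasMonomialForm

variable {P Q : LaxTerms → Prop}

theorem congr (hP : S.HasMonomialForm P) (h : ∀ t, S.Admissible t → (Q t ↔ P t)) :
    S.HasMonomialForm Q := by
  obtain ⟨E, hE⟩ := hP
  exact ⟨E, fun t ht => (h t ht).trans (hE t ht)⟩

theorem and (hP : S.HasMonomialForm P) (hQ : S.HasMonomialForm Q) :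
    S.HasMonomialForm fun t => P t ∧ Q t := by
  obtain ⟨E, hE⟩ := hP
  obtain ⟨F, hF⟩ := hQ
  refine ⟨E ∪ F, fun t ht => ?_⟩
  simp only [hE t ht, hF t ht, Set.mem_union, or_imp, forall_and]

theorem true : S.HasMonomialForm fun _ => True :=
  ⟨∅, fun t _ => by simp⟩

theorem of_eq (p q : LaxVar S.U × ℤ × ℤ →₀ ℕ) {k : ℂ} (hk : k ≠ 0) :
    S.HasMonomialForm fun t => ∀ l m, S.monomial t p l m = k * S.monomial t q l m :=
  ⟨{⟨k, hk, p, q⟩}, fun t _ => by simp⟩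

end HasMonomialForm

theorem monomial_add (t : LaxTerms) (p q : LaxVar S.U × ℤ × ℤ →₀ ℕ) (l m : ℤ) :
    S.monomial t (p + q) l m = S.monomial t p l m * S.monomial t q l m :=
  Finsupp.prod_add_index' (fun _ => pow_zero _) fun _ _ _ => pow_add _ _ _

theorem monomial_single (t : LaxTerms) (v : LaxVar S.U × ℤ × ℤ) (l m : ℤ) :
    S.monomial t (Finsupp.single v 1) l m = S.value t v.1 (l + v.2.1) (m + v.2.2) := by
  refine (Finsupp.prod_single_index (h := fun (v : LaxVar S.U × ℤ × ℤ) (n : ℕ) =>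
    (S.value t v.1 (l + v.2.1) (m + v.2.2)) ^ n) (pow_zero _)).trans (pow_one _)

/-- The exponent of a product of two shifted quantities. -/
noncomputable def pairExp {U : Set ℂ} (v w : LaxVar U × ℤ × ℤ) : LaxVar U × ℤ × ℤ →₀ ℕ :=
  Finsupp.single v 1 + Finsupp.single w 1

theorem monomial_pairExp (t : LaxTerms) (v w : LaxVar S.U × ℤ × ℤ) (l m : ℤ) :
    S.monomial t (pairExp v w) l m = S.value t v.1 (l + v.2.1) (m + v.2.2) *
      S.value t w.1 (l + w.2.1) (m + w.2.2) := by
  rw [pairExp, monomial_add, monomial_single, monomial_single]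

/-- A relation between two terms `monomial * spectral factor`, in which neither monomial vanishes
unless its spectral factor does, is multiplicatively linear as soon as it holds somewhere: the two
spectral factors are then proportional. -/
theorem HasMonomialForm.of_two_terms (p q : LaxVar S.U × ℤ × ℤ →₀ ℕ) {f g : ℂ → ℂ} {ε x y : ℂ}
    (hε : ε ≠ 0) (hx : (∃ ν ∈ S.U, f ν ≠ 0) → x ≠ 0) (hy : (∃ ν ∈ S.U, g ν ≠ 0) → y ≠ 0)
    (h : ∀ ν ∈ S.U, x * f ν + ε * (y * g ν) = 0) :
    S.HasMonomialForm fun t => ∀ l m, ∀ ν ∈ S.U,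
      S.monomial t p l m * f ν + ε * (S.monomial t q l m * g ν) = 0 := by
  obtain hf | hf := eqOn_zero_or_exists S.U f
  · have hg : ∀ ν ∈ S.U, g ν = 0 := by
      by_contra! hne
      obtain ⟨ν, hν, hgν⟩ := hne
      have := h ν hν
      simp [hf ν hν, hε, hgν, hy ⟨ν, hν, hgν⟩] at this
    refine HasMonomialForm.true.congr fun t _ => ?_
    simp +contextual [hf, hg]
  · obtain ⟨k, hk, e⟩ := ProportionalOn.of_relation (g := g) (d := -(ε * y)) hf (hx hf)
      fun ν hν => by linear_combination h ν hν
    refine (HasMonomialForm.of_eq p q (k := -ε / k) (div_ne_zero (neg_ne_zero.2 hε) hk)).congr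
      fun t _ => forall₂_congr fun l m => ⟨fun H => ?_, fun H ν hν => ?_⟩
    · obtain ⟨ν, hν, hfν⟩ := hf
      have h1 := H ν hν
      have hg : g ν ≠ 0 := fun h0 => hfν (by rw [e ν hν, h0, mul_zero])
      rw [e ν hν] at h1
      rw [div_mul_eq_mul_div, eq_div_iff hk]
      exact mul_right_cancel₀ hg (by linear_combination h1)
    · rw [H, e ν hν]
      field_simp
      ring

/-! ### The entries of the compatibility condition as sums of terms -/

/-- The lattice factor of a term of entry `(i, j)` of the compatibility condition: `true` stands for
the product `L̂ M`, `false` for `M̄ L`, and the second component is the index of summation. -/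
def _root_.LaxTerms.factor (t : LaxTerms) (i j : Fin 2) : Bool × Fin 2 → LatticeFn
  | (true, k) => fun l m => t.L i k l (m + 1) * t.M k j l m
  | (false, k) => fun l m => t.M i k (l + 1) m * t.L k j l m

/-- The spectral factor of a term of entry `(i, j)` of the compatibility condition. -/
def termSpec (S : LaxSpectrum) (i j : Fin 2) : Bool × Fin 2 → ℂ → ℂ
  | (true, k) => fun ν => S.L i k ν * S.M k j ν
  | (false, k) => fun ν => S.M i k ν * S.L k j ν

/-- The sign of a term when the compatibility condition is written as `L̂ M - M̄ L = 0`. -/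
def termSign (w : Bool × Fin 2) : ℂ := bif w.1 then 1 else -1

theorem termSign_ne_zero (w : Bool × Fin 2) : termSign w ≠ 0 := by
  obtain ⟨_ | _, k⟩ := w <;> simp [termSign]

/-- Entry `(i, j)` of the compatibility condition. -/
def Entry (S : LaxSpectrum) (i j : Fin 2) (t : LaxTerms) : Prop :=
  ∀ l m, ∀ ν ∈ S.U,
    ∑ w : Bool × Fin 2, termSign w * (t.factor i j w l m * S.termSpec i j w ν) = 0

theorem entry_iff (i j : Fin 2) (t : LaxTerms) : S.Entry i j t ↔ ∀ l m, ∀ ν ∈ S.U,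
    t.L i 0 l (m + 1) * t.M 0 j l m * (S.L i 0 ν * S.M 0 j ν) +
      t.L i 1 l (m + 1) * t.M 1 j l m * (S.L i 1 ν * S.M 1 j ν) =
    t.M i 0 (l + 1) m * t.L 0 j l m * (S.M i 0 ν * S.L 0 j ν) +
      t.M i 1 (l + 1) m * t.L 1 j l m * (S.M i 1 ν * S.L 1 j ν) := by
  refine forall₂_congr fun l m => forall₂_congr fun ν _ => ?_
  simp only [Fintype.sum_prod_type, Fintype.sum_bool, Fin.sum_univ_two, termSign, cond_true,
    cond_false, LaxTerms.factor, termSpec]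
  constructor <;> intro h <;> linear_combination h

theorem system_iff (t : LaxTerms) : S.System t ↔ S.Admissible t ∧
    (S.Entry 0 0 t ∧ S.Entry 0 1 t) ∧ (S.Entry 1 0 t ∧ S.Entry 1 1 t) := by
  simp only [System, entry_iff, ← Matrix.ext_iff, Fin.forall_fin_two, Matrix.mul_apply,
    Fin.sum_univ_two, laxL, laxM, Matrix.of_apply, forall_and]
  simp only [mul_mul_mul_comm]
  exact and_congr_right fun _ => and_and_and_comm

/-- The monomial that the lattice factor of a term is. -/
noncomputable def termExp (S : LaxSpectrum) (i j : Fin 2) :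
    Bool × Fin 2 → (LaxVar S.U × ℤ × ℤ →₀ ℕ)
  | (true, k) => pairExp (.entryL i k, 0, 1) (.entryM k j, 0, 0)
  | (false, k) => pairExp (.entryM i k, 1, 0) (.entryL k j, 0, 0)

theorem monomial_termExp (t : LaxTerms) (i j : Fin 2) (w : Bool × Fin 2) (l m : ℤ) :
    S.monomial t (S.termExp i j w) l m = t.factor i j w l m := by
  obtain ⟨_ | _, k⟩ := w <;> simp [termExp, monomial_pairExp, value, LaxTerms.factor]

theorem factor_ne_zero {t : LaxTerms} (ht : S.Admissible t) {i j : Fin 2} {w : Bool × Fin 2}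
    (hw : ∃ ν ∈ S.U, S.termSpec i j w ν ≠ 0) (l m : ℤ) : t.factor i j w l m ≠ 0 := by
  obtain ⟨_ | _, k⟩ := w
  · exact mul_ne_zero ((ht.2 _ _ _ _).2 (exists_ne_zero_of_mul hw).1)
      ((ht.1 _ _ _ _).2 (exists_ne_zero_of_mul hw).2)
  · exact mul_ne_zero ((ht.1 _ _ _ _).2 (exists_ne_zero_of_mul hw).1)
      ((ht.2 _ _ _ _).2 (exists_ne_zero_of_mul hw).2)

theorem termSpec_eq_zero {i j : Fin 2} {u v : Bool × Fin 2} (h : ∀ k, ∀ ν ∈ S.U,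
    ((true, k) = u ∨ (true, k) = v ∨ S.L i k ν = 0 ∨ S.M k j ν = 0) ∧
    ((false, k) = u ∨ (false, k) = v ∨ S.M i k ν = 0 ∨ S.L k j ν = 0)) :
    ∀ w, w ≠ u → w ≠ v → ∀ ν ∈ S.U, S.termSpec i j w ν = 0 := by
  rintro ⟨_ | _, k⟩ hu hv ν hν
  · exact mul_eq_zero.2 (((h k ν hν).2.resolve_left hu).resolve_left hv)
  · exact mul_eq_zero.2 (((h k ν hν).1.resolve_left hu).resolve_left hv)

/-- An entry with at most two terms is multiplicatively linear, if the system has a solution. -/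
theorem HasMonomialForm.entry_of_two_terms {i j : Fin 2} (u v : Bool × Fin 2) (huv : u ≠ v)
    (h : ∀ w, w ≠ u → w ≠ v → ∀ ν ∈ S.U, S.termSpec i j w ν = 0) {t₀ : LaxTerms}
    (ht₀ : S.Admissible t₀) (h₀ : S.Entry i j t₀) : S.HasMonomialForm (S.Entry i j) := by
  have e (t : LaxTerms) : S.Entry i j t ↔ ∀ l m, ∀ ν ∈ S.U, t.factor i j u l m *
      S.termSpec i j u ν + termSign v / termSign u *
        (t.factor i j v l m * S.termSpec i j v ν) = 0 := by
    refine forall₂_congr fun l m => forall₂_congr fun ν hν => ?_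
    rw [Fintype.sum_eq_add u v huv fun w hw => by rw [h w hw.1 hw.2 ν hν, mul_zero, mul_zero]]
    have := termSign_ne_zero u
    constructor <;> intro H
    · field_simp
      linear_combination H
    · field_simp at H
      linear_combination H
  refine (of_two_terms (S.termExp i j u) (S.termExp i j v)
    (div_ne_zero (termSign_ne_zero v) (termSign_ne_zero u))
    (fun hf => factor_ne_zero ht₀ hf 0 0) (fun hf => factor_ne_zero ht₀ hf 0 0)
    ((e t₀).1 h₀ 0 0)).congr fun t _ => ?_
  simp only [e, monomial_termExp]

/-- An entry with three terms is multiplicatively linear, if the system has a solution, unless it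
amounts to a single lattice equation. -/
theorem HasMonomialForm.entry_of_three_terms {i j : Fin 2} (u v w : Bool × Fin 2)
    (huv : u ≠ v) (huw : u ≠ w) (hvw : v ≠ w)
    (h : ∀ x, x ≠ u → x ≠ v → x ≠ w → ∀ ν ∈ S.U, S.termSpec i j x ν = 0) {t₀ : LaxTerms}
    (ht₀ : S.Admissible t₀) (h₀ : S.Entry i j t₀) : S.HasMonomialForm (S.Entry i j) ∨
      (∃ ν ∈ S.U, S.termSpec i j w ν ≠ 0) ∧
      ProportionalOn S.U (S.termSpec i j u) (S.termSpec i j w) ∧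
        ProportionalOn S.U (S.termSpec i j v) (S.termSpec i j w) := by
  obtain hu | hu := eqOn_zero_or_exists S.U (S.termSpec i j u)
  · refine .inl (entry_of_two_terms v w hvw (fun x hxv hxw => ?_) ht₀ h₀)
    by_cases hxu : x = u
    exacts [hxu ▸ hu, h x hxu hxv hxw]
  obtain hv | hv := eqOn_zero_or_exists S.U (S.termSpec i j v)
  · refine .inl (entry_of_two_terms u w huw (fun x hxu hxw => ?_) ht₀ h₀)
    by_cases hxv : x = v
    exacts [hxv ▸ hv, h x hxu hxv hxw]
  obtain hw | hw := eqOn_zero_or_exists S.U (S.termSpec i j w)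
  · refine .inl (entry_of_two_terms u v huv (fun x hxu hxv => ?_) ht₀ h₀)
    by_cases hxw : x = w
    exacts [hxw ▸ hw, h x hxu hxv hxw]
  have e (t : LaxTerms) : S.Entry i j t ↔ ∀ l m, ∀ ν ∈ S.U,
      termSign u * (t.factor i j u l m * S.termSpec i j u ν) +
        (termSign v * (t.factor i j v l m * S.termSpec i j v ν) +
          termSign w * (t.factor i j w l m * S.termSpec i j w ν)) = 0 := by
    refine forall₂_congr fun l m => forall₂_congr fun ν hν => ?_
    rw [← Finset.sum_subset (Finset.subset_univ {u, v, w}) fun x _ hx => ?_,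
      Finset.sum_insert (by simp [huv, huw]), Finset.sum_insert (by simp [hvw]),
      Finset.sum_singleton]
    simp only [Finset.mem_insert, Finset.mem_singleton, not_or] at hx
    rw [h x hx.1 hx.2.1 hx.2.2 ν hν, mul_zero, mul_zero]
  have su := termSign_ne_zero u
  have sv := termSign_ne_zero v
  have sw := termSign_ne_zero w
  have xu := factor_ne_zero ht₀ hu 0 0
  have xv := factor_ne_zero ht₀ hv 0 0
  have xw := factor_ne_zero ht₀ hw 0 0
  have r := (e t₀).1 h₀ 0 0
  by_cases hp : ProportionalOn S.U (S.termSpec i j v) (S.termSpec i j w)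
  · refine .inr ⟨hw, ?_, hp⟩
    obtain ⟨k, hk, hp⟩ := hp
    refine .of_relation (c := termSign u * t₀.factor i j u 0 0)
      (d := -(termSign v * t₀.factor i j v 0 0 * k + termSign w * t₀.factor i j w 0 0))
      hu (mul_ne_zero su xu) fun ν hν => ?_
    have := r ν hν
    rw [hp ν hν] at this
    linear_combination this
  · -- The first spectral factor is a combination of the other two, which are independent, so that
    -- the three lattice factors are in fixed ratios.
    left
    have hi := independentOn_of_not_proportionalOn hv hw hp
    set a := -(termSign v * t₀.factor i j v 0 0) / (termSign u * t₀.factor i j u 0 0) with ha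
    set b := -(termSign w * t₀.factor i j w 0 0) / (termSign u * t₀.factor i j u 0 0) with hb
    have ha0 : a ≠ 0 := div_ne_zero (neg_ne_zero.2 (mul_ne_zero sv xv)) (mul_ne_zero su xu)
    have hb0 : b ≠ 0 := div_ne_zero (neg_ne_zero.2 (mul_ne_zero sw xw)) (mul_ne_zero su xu)
    have hab : ∀ ν ∈ S.U, S.termSpec i j u ν = a * S.termSpec i j v ν + b * S.termSpec i j w ν := by
      intro ν hν
      rw [ha, hb]
      field_simp
      linear_combination r ν hν
    refine ((HasMonomialForm.of_eq (S.termExp i j v) (S.termExp i j u)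
      (k := -(termSign u * a) / termSign v)
      (div_ne_zero (neg_ne_zero.2 (mul_ne_zero su ha0)) sv)).and
      (HasMonomialForm.of_eq (S.termExp i j w) (S.termExp i j u)
      (k := -(termSign u * b) / termSign w)
      (div_ne_zero (neg_ne_zero.2 (mul_ne_zero su hb0)) sw))).congr fun t _ => ?_
    simp only [e, monomial_termExp, ← forall_and]
    refine forall₂_congr fun l m => ⟨fun H => ?_, fun ⟨H₁, H₂⟩ ν hν => ?_⟩
    · obtain ⟨H₁, H₂⟩ := hi (termSign u * t.factor i j u l m * a + termSign v * t.factor i j v l m)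
        (termSign u * t.factor i j u l m * b + termSign w * t.factor i j w l m)
        fun ν hν => by linear_combination H ν hν - termSign u * t.factor i j u l m * hab ν hν
      constructor
      · field_simp
        linear_combination H₁
      · field_simp
        linear_combination H₂
    · rw [H₁, H₂, hab ν hν]
      field_simp
      ring

/-! ### Invariance of triviality -/

/-- Multiplicative linearity is carried over along a change `τ` of the lattice factors which
permutes the quantities in the monomials. -/
theorem MultiplicativelyLinear.of_map {S' : LaxSpectrum} (τ : LaxTerms → LaxTerms)
    (ρ : LaxVar S'.U × ℤ × ℤ → LaxVar S.U × ℤ × ℤ) (π : ℤ × ℤ → ℤ × ℤ) (hπ : π.Surjective)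
    (ha : ∀ t, S'.Admissible (τ t) ↔ S.Admissible t) (hs : ∀ t, S'.System (τ t) ↔ S.System t)
    (hv : ∀ t v l m, S'.value (τ t) v.1 (l + v.2.1) (m + v.2.2) =
      S.value t (ρ v).1 ((π (l, m)).1 + (ρ v).2.1) ((π (l, m)).2 + (ρ v).2.2))
    (h : S'.MultiplicativelyLinear) : S.MultiplicativelyLinear := by
  obtain ⟨E, hE⟩ := h
  have key (t) (e : LaxVar S'.U × ℤ × ℤ →₀ ℕ) (l m : ℤ) : S'.monomial (τ t) e l m =
      S.monomial t (e.mapDomain ρ) (π (l, m)).1 (π (l, m)).2 := by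
    rw [monomial, monomial, Finsupp.prod_mapDomain_index (fun _ => pow_zero _)
      fun _ _ _ => pow_add _ _ _]
    exact Finsupp.prod_congr fun v _ => by rw [hv]
  refine ⟨(fun e => ⟨e.coeff, e.coeff_ne, e.lhs.mapDomain ρ, e.rhs.mapDomain ρ⟩) '' E,
    fun t ht => ?_⟩
  rw [← hs, hE _ ((ha t).2 ht), Set.forall_mem_image]
  refine forall₂_congr fun e _ => ?_
  simp only [key]
  constructor
  · intro H l m
    obtain ⟨⟨l', m'⟩, hlm⟩ := hπ (l, m)
    simpa only [hlm] using H l' m'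
  · exact fun H l m => H _ _

theorem Trivial.of_swapIndices (h : S.swapIndices.Trivial) : S.Trivial := by
  obtain h | ⟨h, V, hV⟩ := h
  · refine .inl (h.of_map (S := S) (S' := S.swapIndices) LaxTerms.swapIndices
      (fun v => (match v.1 with
      | .entryL i j => .entryL (Equiv.swap 0 1 i) (Equiv.swap 0 1 j)
      | .entryM i j => .entryM (Equiv.swap 0 1 i) (Equiv.swap 0 1 j)
      | .detL ν => .detL ν
      | .detM ν => .detM ν, v.2)) id Function.surjective_id admissible_swapIndices
      system_swapIndices ?_)
    rintro t ⟨_ | _ | _ | _, p⟩ l m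
    · rfl
    · rfl
    · simp only [value, laxL_swapIndices, id]
      exact Matrix.det_submatrix_equiv_self _ _
    · simp only [value, laxM_swapIndices, id]
      exact Matrix.det_submatrix_equiv_self _ _
  · refine .inr ⟨fun t ht => ?_, V.comap (LinearMap.prodMap
      (Matrix.reindexLinearEquiv ℂ LatticeFn (Equiv.swap 0 1) (Equiv.swap 0 1)).toLinearMap
      (Matrix.reindexLinearEquiv ℂ LatticeFn (Equiv.swap 0 1) (Equiv.swap 0 1)).toLinearMap),
      fun t ha hu => ?_⟩
    · obtain ⟨g, hg, hu⟩ := h _ ((system_swapIndices t).2 ht)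
      refine ⟨g ∘ Equiv.swap 0 1, fun i => hg _, fun i l m => ?_⟩
      have := hu (Equiv.swap 0 1 i) l m
      simpa [LaxTerms.gauge, LaxTerms.swapIndices] using this
    · rw [← system_swapIndices, hV _ ((admissible_swapIndices t).2 ha) fun i l m => hu _ l m,
        Submodule.mem_comap]
      have : t.swapIndices.offDiagonal = LinearMap.prodMap
          (Matrix.reindexLinearEquiv ℂ LatticeFn (Equiv.swap 0 1) (Equiv.swap 0 1)).toLinearMap
          (Matrix.reindexLinearEquiv ℂ LatticeFn (Equiv.swap 0 1) (Equiv.swap 0 1)).toLinearMap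
          t.offDiagonal := by
        ext i j : 3 <;>
          simp [LaxTerms.offDiagonal, LaxTerms.swapIndices, Equiv.symm_swap]
      rw [this]

theorem Trivial.of_exchange (h : S.exchange.Trivial) : S.Trivial := by
  obtain h | ⟨h, V, hV⟩ := h
  · refine .inl (h.of_map (S := S) (S' := S.exchange) LaxTerms.exchange (fun v => (match v.1 with
      | .entryL i j => .entryM i j
      | .entryM i j => .entryL i j
      | .detL ν => .detM ν
      | .detM ν => .detL ν, v.2.swap)) Prod.swap Prod.swap_surjective admissible_exchange
      system_exchange ?_)
    rintro t ⟨_ | _ | _ | _, p⟩ l m <;> rfl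
  · let flip : LatticeFn →ₗ[ℂ] LatticeFn :=
      { toFun := fun f l m => f m l, map_add' := fun _ _ => rfl, map_smul' := fun _ _ => rfl }
    refine .inr ⟨fun t ht => ?_, V.comap (LinearMap.prod
      (flip.mapMatrix ∘ₗ LinearMap.snd ℂ _ _) (flip.mapMatrix ∘ₗ LinearMap.fst ℂ _ _)),
      fun t ha hu => ?_⟩
    · obtain ⟨g, hg, hu⟩ := h _ ((system_exchange t).2 ht)
      exact ⟨fun i l m => g i m l, fun i l m => hg i m l, fun i l m => (hu i m l).symm⟩
    · rw [← system_exchange, hV _ ((admissible_exchange t).2 ha) fun i l m => (hu i m l).symm,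
        Submodule.mem_comap]
      have : t.exchange.offDiagonal = LinearMap.prod
          (flip.mapMatrix ∘ₗ LinearMap.snd ℂ _ _) (flip.mapMatrix ∘ₗ LinearMap.fst ℂ _ _)
          t.offDiagonal := by
        ext i j : 3 <;> by_cases hij : i = j <;>
          simp [LaxTerms.offDiagonal, LaxTerms.exchange, flip, hij] <;> rfl
      rw [this]

end LaxSpectrum

/-! ### Compatible recursions on the lattice -/

theorem exists_int_flow {X : Type*} (f : ℤ → Equiv.Perm X) (x₀ : X) :
    ∃ s : ℤ → X, s 0 = x₀ ∧ ∀ n, s (n + 1) = f n (s n) := by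
  refine ⟨fun n => Int.inductionOn' (motive := fun _ => X) n 0 x₀ (fun k _ x => f k x)
    fun k _ x => (f (k - 1)).symm x, Int.inductionOn'_self .., fun n => ?_⟩
  obtain hn | hn := le_or_gt 0 n
  · exact Int.inductionOn'_add_one (hz := hn) ..
  · have h := Int.inductionOn'_sub_one (motive := fun _ => X) (b := 0) (zero := x₀)
      (succ := fun k _ x => f k x) (pred := fun k _ x => (f (k - 1)).symm x)
      (hz := show n + 1 ≤ 0 by lia)
    simp only [add_sub_cancel_right] at h
    simp only [h, Equiv.apply_symm_apply]

/-- A pair of first-order recursions in the two lattice directions, with invertible steps, has a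
solution if the steps commute around each elementary square. -/
theorem exists_lattice_flow {X : Type*} [Nonempty X] (F G : ℤ → ℤ → Equiv.Perm X)
    (comm : ∀ l m x, F l (m + 1) (G l m x) = G (l + 1) m (F l m x)) :
    ∃ s : ℤ → ℤ → X, (∀ l m, s (l + 1) m = F l m (s l m)) ∧
      ∀ l m, s l (m + 1) = G l m (s l m) := by
  obtain ⟨x₀⟩ := ‹Nonempty X›
  obtain ⟨r, -, hr⟩ := exists_int_flow (fun l => F l 0) x₀
  choose s hs₀ hs using fun l => exists_int_flow (G l) (r l)
  refine ⟨s, fun l m => ?_, hs⟩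
  induction m using Int.induction_on with
  | zero => rw [hs₀, hs₀, hr]
  | succ m ih => rw [hs, hs, ih, comm]
  | pred m ih =>
    have h1 := hs l (-m - 1)
    have h2 := hs (l + 1) (-m - 1)
    have h3 := comm l (-m - 1) (s l (-m - 1))
    rw [sub_add_cancel] at h1 h2 h3
    rw [← h1, ← ih, h2] at h3
    exact (G (l + 1) (-m - 1)).injective h3

/-- Multiplicative recursions whose steps may permute the unknowns. -/
theorem exists_multiplicative_flow {ι : Type*} (σ τ : Equiv.Perm ι) (u v : ι → LatticeFn)
    (hu : ∀ i, Nonvanishing (u i)) (hv : ∀ i, Nonvanishing (v i)) (comm : ∀ i, σ (τ i) = τ (σ i))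
    (compat : ∀ i l m, u i l (m + 1) * v (σ i) l m = v i (l + 1) m * u (τ i) l m) :
    ∃ g : ι → LatticeFn, (∀ i, Nonvanishing (g i)) ∧
      ∀ i l m, g i (l + 1) m = u i l m * g (σ i) l m ∧ g i l (m + 1) = v i l m * g (τ i) l m := by
  let step (ρ : Equiv.Perm ι) (c : ι → ℂˣ) : Equiv.Perm (ι → ℂˣ) :=
    (Equiv.arrowCongr ρ.symm (Equiv.refl ℂˣ)).trans (Equiv.mulLeft c)
  have step_apply (ρ c x i) : step ρ c x i = c i * x (ρ i) := rfl
  obtain ⟨s, h1, h2⟩ := exists_lattice_flow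
    (fun l m => step σ fun i => Units.mk0 (u i l m) (hu i l m))
    (fun l m => step τ fun i => Units.mk0 (v i l m) (hv i l m)) fun l m x => by
      funext i
      ext
      simp only [step_apply, Units.val_mul, Units.val_mk0, comm]
      linear_combination (x (τ (σ i)) : ℂ) * compat i l m
  refine ⟨fun i l m => s l m i, fun i l m => (s l m i).ne_zero, fun i l m => ⟨?_, ?_⟩⟩
  · simp [h1, step_apply]
  · simp [h2, step_apply]

theorem exists_hatShift_eq_mul (r : LatticeFn) (hr : Nonvanishing r) :
    ∃ b : LatticeFn, Nonvanishing b ∧ ∀ l m, b l (m + 1) = r l m * b l m := by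
  choose s _ hs using fun l =>
    exists_int_flow (fun m => Equiv.mulLeft (Units.mk0 (r l m) (hr l m))) 1
  refine ⟨fun l m => s l m, fun l m => (s l m).ne_zero, fun l m => ?_⟩
  simp [hs]

/-! ### Gauge transformations and constant factors -/

namespace LaxTerms

theorem factor_gauge (t : LaxTerms) {g : Fin 2 → LatticeFn} (hg : ∀ i, Nonvanishing (g i))
    (i j : Fin 2) (w : Bool × Fin 2) (l m : ℤ) : (t.gauge g).factor i j w l m =
      g i (l + 1) (m + 1) / g j l m * t.factor i j w l m := by
  obtain ⟨_ | _, k⟩ := w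
  · have := hg k (l + 1) m
    simp only [factor, gauge, Matrix.of_apply]
    field_simp
  · have := hg k l (m + 1)
    simp only [factor, gauge, Matrix.of_apply]
    field_simp

theorem gauge_rescale (t : LaxTerms) (g : Fin 2 → LatticeFn) (κ κ' : Matrix (Fin 2) (Fin 2) ℂ) :
    (t.gauge g).rescale κ κ' = (t.rescale κ κ').gauge g := by
  simp only [gauge, rescale, LaxTerms.mk.injEq]
  constructor <;> ext i j l m <;> simp only [Matrix.of_apply] <;> ring

end LaxTerms

namespace LaxSpectrum

variable {S : LaxSpectrum}

theorem system_gauge (t : LaxTerms) {g : Fin 2 → LatticeFn} (hg : ∀ i, Nonvanishing (g i)) :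
    S.System (t.gauge g) ↔ S.System t := by
  have ha : S.Admissible (t.gauge g) ↔ S.Admissible t := by
    refine and_congr ?_ ?_ <;> refine forall₂_congr fun i j => forall₂_congr fun l m => ?_
    · simp [LaxTerms.gauge, hg i (l + 1) m, hg j l m]
    · simp [LaxTerms.gauge, hg i l (m + 1), hg j l m]
  have he (i j) : S.Entry i j (t.gauge g) ↔ S.Entry i j t := by
    refine forall₂_congr fun l m => forall₂_congr fun ν _ => ?_
    have hc : g i (l + 1) (m + 1) / g j l m ≠ 0 := div_ne_zero (hg _ _ _) (hg _ _ _)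
    have key : ∑ w, termSign w * ((t.gauge g).factor i j w l m * S.termSpec i j w ν) =
        g i (l + 1) (m + 1) / g j l m *
          ∑ w, termSign w * (t.factor i j w l m * S.termSpec i j w ν) := by
      rw [Finset.mul_sum]
      refine Finset.sum_congr rfl fun w _ => ?_
      rw [t.factor_gauge hg]
      ring
    rw [key, mul_eq_zero, or_iff_right hc]
  simp only [system_iff, ha, he]

/-- The spectrum with each spectral factor multiplied by a constant. -/
def rescale (S : LaxSpectrum) (κ κ' : Matrix (Fin 2) (Fin 2) ℂ) : LaxSpectrum where
  U := S.U
  isOpen := S.isOpen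
  isConnected := S.isConnected
  L := Matrix.of fun i j ν => κ i j * S.L i j ν
  M := Matrix.of fun i j ν => κ' i j * S.M i j ν
  analyticL i j := analyticOnNhd_const.mul (S.analyticL i j)
  analyticM i j := analyticOnNhd_const.mul (S.analyticM i j)

theorem nonzeroL_rescale {κ κ' : Matrix (Fin 2) (Fin 2) ℂ} {i j : Fin 2} (h : κ i j ≠ 0) :
    (S.rescale κ κ').NonzeroL i j ↔ S.NonzeroL i j := by
  simp [NonzeroL, rescale, h]

theorem nonzeroM_rescale {κ κ' : Matrix (Fin 2) (Fin 2) ℂ} {i j : Fin 2} (h : κ' i j ≠ 0) :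
    (S.rescale κ κ').NonzeroM i j ↔ S.NonzeroM i j := by
  simp [NonzeroM, rescale, h]

theorem system_rescale {κ κ' : Matrix (Fin 2) (Fin 2) ℂ} (h : ∀ i j, κ i j ≠ 0)
    (h' : ∀ i j, κ' i j ≠ 0) (t : LaxTerms) :
    S.System (t.rescale κ κ') ↔ (S.rescale κ κ').System t := by
  have hL (l m ν) : S.laxL (t.rescale κ κ') l m ν = (S.rescale κ κ').laxL t l m ν := by
    ext i j
    simp only [laxL, LaxTerms.rescale, rescale, Matrix.of_apply]
    ring
  have hM (l m ν) : S.laxM (t.rescale κ κ') l m ν = (S.rescale κ κ').laxM t l m ν := by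
    ext i j
    simp only [laxM, LaxTerms.rescale, rescale, Matrix.of_apply]
    ring
  simp only [System, Admissible, hL, hM, nonzeroL_rescale (h _ _), nonzeroM_rescale (h' _ _)]
  simp [LaxTerms.rescale, h, h', rescale]

/-- A reduction may be proved for spectral factors that are normalized by constants. -/
theorem reducesTo_of_rescale {n : ℕ} {eqn : (Fin n → LatticeFn) → Prop}
    {lax : (Fin n → LatticeFn) → LaxTerms} (κ κ' : Matrix (Fin 2) (Fin 2) ℂ)
    (h : ∀ i j, κ i j ≠ 0) (h' : ∀ i j, κ' i j ≠ 0)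
    (h1 : ∀ X : Fin n → LatticeFn, (∀ i, Nonvanishing (X i)) →
      ((S.rescale κ κ').System (lax X) ↔ eqn X))
    (h2 : ∀ t, (S.rescale κ κ').System t → ∃ X : Fin n → LatticeFn, (∀ i, Nonvanishing (X i)) ∧
      ∃ g : Fin 2 → LatticeFn, (∀ i, Nonvanishing (g i)) ∧ t = (lax X).gauge g) :
    ReducesTo S.System eqn lax := by
  refine ⟨κ, κ', h, h', fun X hX g hg => ?_, fun t ht => ?_⟩
  · rw [system_gauge _ hg, system_rescale h h', h1 X hX]
  · obtain ⟨s, rfl⟩ : ∃ s : LaxTerms, t = s.rescale κ κ' := by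
      refine ⟨t.rescale (κ.map (·⁻¹)) (κ'.map (·⁻¹)), ?_⟩
      cases t
      simp only [LaxTerms.rescale, LaxTerms.mk.injEq]
      constructor <;> ext i j l m <;> simp [h, h']
    obtain ⟨X, hX, g, hg, rfl⟩ := h2 s ((system_rescale h h' s).1 ht)
    exact ⟨X, hX, g, hg, LaxTerms.gauge_rescale _ _ _ _⟩

end LaxSpectrum

/-! ### Reduction to LMKdV₂ -/

/-- The lattice equations when `L` and `M` have proportional diagonal spectral factors, and the two
spectral products in each diagonal entry of the compatibility condition are independent. -/
def MKdVForm (t : LaxTerms) : Prop := ∀ l m : ℤ,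
  t.L 0 0 l (m + 1) * t.M 0 0 l m = t.M 0 0 (l + 1) m * t.L 0 0 l m ∧
  t.L 0 1 l (m + 1) * t.M 1 0 l m = t.M 0 1 (l + 1) m * t.L 1 0 l m ∧
  t.L 0 0 l (m + 1) * t.M 0 1 l m + t.L 0 1 l (m + 1) * t.M 1 1 l m =
    t.M 0 0 (l + 1) m * t.L 0 1 l m + t.M 0 1 (l + 1) m * t.L 1 1 l m ∧
  t.L 1 0 l (m + 1) * t.M 0 0 l m + t.L 1 1 l (m + 1) * t.M 1 0 l m =
    t.M 1 0 (l + 1) m * t.L 0 0 l m + t.M 1 1 (l + 1) m * t.L 1 0 l m ∧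
  t.L 1 0 l (m + 1) * t.M 0 1 l m = t.M 1 0 (l + 1) m * t.L 0 1 l m ∧
  t.L 1 1 l (m + 1) * t.M 1 1 l m = t.M 1 1 (l + 1) m * t.L 1 1 l m

namespace LaxSpectrum

variable {S : LaxSpectrum}

theorem Admissible.L_eq_zero {t : LaxTerms} (ht : S.Admissible t) {i j : Fin 2}
    (h : ∀ ν ∈ S.U, S.L i j ν = 0) (l m : ℤ) : t.L i j l m = 0 := by
  by_contra hne
  obtain ⟨ν, hν, hνne⟩ := (ht.1 i j l m).1 hne
  exact hνne (h ν hν)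

theorem Admissible.M_eq_zero {t : LaxTerms} (ht : S.Admissible t) {i j : Fin 2}
    (h : ∀ ν ∈ S.U, S.M i j ν = 0) (l m : ℤ) : t.M i j l m = 0 := by
  by_contra hne
  obtain ⟨ν, hν, hνne⟩ := (ht.2 i j l m).1 hne
  exact hνne (h ν hν)

theorem system_iff_mkdvForm (hD : (∀ ν ∈ S.U, S.L 1 1 ν = S.L 0 0 ν) ∨ ∀ ν ∈ S.U, S.L 1 1 ν = 0)
    (hΔ : ∀ ν ∈ S.U, S.M 1 1 ν = S.M 0 0 ν)
    (h01 : ∀ ν ∈ S.U, S.L 0 0 ν * S.M 0 1 ν = S.L 0 1 ν * S.M 0 0 ν)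
    (h10 : ∀ ν ∈ S.U, S.L 0 0 ν * S.M 1 0 ν = S.L 1 0 ν * S.M 0 0 ν)
    (h11 : ∀ ν ∈ S.U, S.L 1 0 ν * S.M 0 1 ν = S.L 0 1 ν * S.M 1 0 ν)
    (hB : ∃ ν ∈ S.U, S.L 0 1 ν * S.M 0 0 ν ≠ 0) (hC : ∃ ν ∈ S.U, S.L 1 0 ν * S.M 0 0 ν ≠ 0)
    (hi : IndependentOn S.U (fun ν => S.L 0 0 ν * S.M 0 0 ν) fun ν => S.L 0 1 ν * S.M 1 0 ν)
    (t : LaxTerms) : S.System t ↔ S.Admissible t ∧ MKdVForm t := by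
  rw [system_iff]
  refine and_congr_right fun ht => ?_
  simp only [entry_iff, ← forall_and]
  refine forall₂_congr fun l m => ?_
  -- The terms with the factor `D` may be written as if `D = A`: if `D = 0`, they vanish.
  have hd (l m) : ∀ ν ∈ S.U, t.L 1 1 l m * S.L 1 1 ν = t.L 1 1 l m * S.L 0 0 ν := by
    intro ν hν
    obtain h | h := hD
    · rw [h ν hν]
    · rw [ht.L_eq_zero h, zero_mul, zero_mul]
  constructor
  · intro H
    obtain ⟨e1, e2⟩ := hi
      (t.L 0 0 l (m + 1) * t.M 0 0 l m - t.M 0 0 (l + 1) m * t.L 0 0 l m)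
      (t.L 0 1 l (m + 1) * t.M 1 0 l m - t.M 0 1 (l + 1) m * t.L 1 0 l m) fun ν hν => by
        linear_combination (H ν hν).1.1 + t.M 0 1 (l + 1) m * t.L 1 0 l m * h11 ν hν
    obtain ⟨e3, e4⟩ := hi
      (t.L 1 1 l (m + 1) * t.M 1 1 l m - t.M 1 1 (l + 1) m * t.L 1 1 l m)
      (t.L 1 0 l (m + 1) * t.M 0 1 l m - t.M 1 0 (l + 1) m * t.L 0 1 l m) fun ν hν => by
        linear_combination (H ν hν).2.2 - t.L 1 0 l (m + 1) * t.M 0 1 l m * h11 ν hν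
          - t.M 1 1 l m * S.M 1 1 ν * hd l (m + 1) ν hν
          + t.M 1 1 (l + 1) m * S.M 1 1 ν * hd l m ν hν
          - (t.L 1 1 l (m + 1) * t.M 1 1 l m - t.M 1 1 (l + 1) m * t.L 1 1 l m) *
            S.L 0 0 ν * hΔ ν hν
    refine ⟨sub_eq_zero.1 e1, sub_eq_zero.1 e2, ?_, ?_, sub_eq_zero.1 e4, sub_eq_zero.1 e3⟩
    · obtain ⟨ν, hν, hne⟩ := hB
      refine mul_right_cancel₀ hne ?_
      linear_combination (H ν hν).1.2 - t.L 0 0 l (m + 1) * t.M 0 1 l m * h01 ν hν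
        - t.L 0 1 l (m + 1) * t.M 1 1 l m * S.L 0 1 ν * hΔ ν hν
        + t.M 0 1 (l + 1) m * t.L 1 1 l m * h01 ν hν + t.M 0 1 (l + 1) m * S.M 0 1 ν * hd l m ν hν
    · obtain ⟨ν, hν, hne⟩ := hC
      refine mul_right_cancel₀ hne ?_
      linear_combination (H ν hν).2.1 - t.L 1 1 l (m + 1) * t.M 1 0 l m * h10 ν hν
        - t.M 1 0 l m * S.M 1 0 ν * hd l (m + 1) ν hν
        + t.M 1 0 (l + 1) m * t.L 0 0 l m * h10 ν hν
        + t.M 1 1 (l + 1) m * t.L 1 0 l m * S.L 1 0 ν * hΔ ν hν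
  · rintro ⟨e1, e2, e3, e4, e5, e6⟩ ν hν
    refine ⟨⟨?_, ?_⟩, ?_, ?_⟩
    · linear_combination S.L 0 0 ν * S.M 0 0 ν * e1 + S.L 0 1 ν * S.M 1 0 ν * e2
        - t.M 0 1 (l + 1) m * t.L 1 0 l m * h11 ν hν
    · linear_combination S.L 0 1 ν * S.M 0 0 ν * e3 + t.L 0 0 l (m + 1) * t.M 0 1 l m * h01 ν hν
        + t.L 0 1 l (m + 1) * t.M 1 1 l m * S.L 0 1 ν * hΔ ν hν
        - t.M 0 1 (l + 1) m * t.L 1 1 l m * h01 ν hν - t.M 0 1 (l + 1) m * S.M 0 1 ν * hd l m ν hν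
    · linear_combination S.L 1 0 ν * S.M 0 0 ν * e4 + t.L 1 1 l (m + 1) * t.M 1 0 l m * h10 ν hν
        + t.M 1 0 l m * S.M 1 0 ν * hd l (m + 1) ν hν
        - t.M 1 0 (l + 1) m * t.L 0 0 l m * h10 ν hν
        - t.M 1 1 (l + 1) m * t.L 1 0 l m * S.L 1 0 ν * hΔ ν hν
    · linear_combination S.L 0 0 ν * S.M 0 0 ν * e6 + S.L 0 1 ν * S.M 1 0 ν * e5
        + t.L 1 0 l (m + 1) * t.M 0 1 l m * h11 ν hν
        + t.M 1 1 l m * S.M 1 1 ν * hd l (m + 1) ν hν - t.M 1 1 (l + 1) m * S.M 1 1 ν * hd l m ν hν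
        + (t.L 1 1 l (m + 1) * t.M 1 1 l m - t.M 1 1 (l + 1) m * t.L 1 1 l m) * S.L 0 0 ν * hΔ ν hν

end LaxSpectrum

theorem mkdvForm_lax (lam : ℤ → ℂ) {X : Fin 2 → LatticeFn} (hX : ∀ i, Nonvanishing (X i)) :
    MKdVForm (laxLMKdV2 lam X) ↔ LMKdV2 lam X := by
  refine forall₂_congr fun l m => ?_
  have x1 := hX 0 l m
  have x2 := hX 0 (l + 1) m
  have x3 := hX 0 l (m + 1)
  have z1 := hX 1 l m
  have z2 := hX 1 (l + 1) m
  have z3 := hX 1 l (m + 1)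
  simp only [laxLMKdV2, barShift, hatShift, Matrix.of_apply, Matrix.cons_val', Matrix.cons_val_zero,
    Matrix.cons_val_one, Matrix.cons_val_fin_one, Pi.div_apply, Pi.one_apply, one_mul, mul_one,
    true_and]
  constructor
  · rintro ⟨-, h1, h2, -⟩
    constructor
    · linear_combination h1
    · linear_combination h2
  · rintro ⟨h1, h2⟩
    refine ⟨?_, ?_, ?_, ?_⟩
    · field_simp
    · linear_combination h1
    · linear_combination h2
    · field_simp

/-- Every solution of the equations in `MKdVForm` is gauge equivalent to the lattice factors of the
Lax pair of LMKdV₂. The gauge makes the off-diagonal factors `1`, and the potentials of the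
diagonal ones, divided by the gauge functions, are the new variables. -/
theorem exists_eq_gauge_laxLMKdV2 {lam : ℤ → ℂ} {t : LaxTerms} (ht : MKdVForm t)
    (hL : ∀ i j, (i, j) ≠ (1, 1) → Nonvanishing (t.L i j)) (hM : ∀ i j, Nonvanishing (t.M i j))
    (hD : (Nonvanishing (t.L 1 1) ∧ ∀ l, lam l ≠ 0) ∨ t.L 1 1 = 0 ∧ lam = 0) :
    ∃ X : Fin 2 → LatticeFn, (∀ i, Nonvanishing (X i)) ∧
      ∃ g : Fin 2 → LatticeFn, (∀ i, Nonvanishing (g i)) ∧ t = (laxLMKdV2 lam X).gauge g := by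
  have ha := hL 0 0 (by simp)
  have hb := hL 0 1 (by simp)
  have hc := hL 1 0 (by simp)
  -- A substitute for the quotient of the lattice factor of `D` by `lam`, if both vanish.
  obtain ⟨d, hd, hd1, hd2⟩ : ∃ d : LatticeFn, Nonvanishing d ∧
      (∀ l m, d l (m + 1) * t.M 1 1 l m = t.M 1 1 (l + 1) m * d l m) ∧
      ∀ l m, t.L 1 1 l m = lam l * d l m := by
    obtain ⟨h, hlam⟩ | ⟨h, rfl⟩ := hD
    · refine ⟨fun l m => t.L 1 1 l m / lam l, fun l m => div_ne_zero (h l m) (hlam l),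
        fun l m => ?_, fun l m => (mul_div_cancel₀ _ (hlam l)).symm⟩
      have := hlam l
      field_simp
      exact (ht l m).2.2.2.2.2
    · obtain ⟨d, hd, e⟩ := exists_hatShift_eq_mul
        (fun l m => t.M 1 1 (l + 1) m / t.M 1 1 l m) fun l m =>
          div_ne_zero (hM _ _ _ _) (hM _ _ _ _)
      refine ⟨d, hd, fun l m => ?_, fun l m => by simp [h]⟩
      have := hM 1 1 l m
      rw [e]
      field_simp
  obtain ⟨g, hg, eg⟩ := exists_multiplicative_flow (Equiv.swap 0 1) (Equiv.swap 0 1)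
    ![t.L 0 1, t.L 1 0] ![t.M 0 1, t.M 1 0] (by simp [Fin.forall_fin_two, hb, hc])
    (by simp [Fin.forall_fin_two, hM]) (fun _ => rfl) (by
      simp only [Fin.forall_fin_two, Equiv.swap_apply_left, Equiv.swap_apply_right,
        Matrix.cons_val_zero, Matrix.cons_val_one]
      exact ⟨fun l m => (ht l m).2.1, fun l m => (ht l m).2.2.2.2.1⟩)
  obtain ⟨p, hp, ep⟩ := exists_multiplicative_flow (Equiv.refl (Fin 2)) (Equiv.refl _)
    ![t.L 0 0, d] ![t.M 0 0, t.M 1 1] (by simp [Fin.forall_fin_two, ha, hd])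
    (by simp [Fin.forall_fin_two, hM]) (fun _ => rfl) (by
      simp only [Fin.forall_fin_two, Equiv.refl_apply,
        Matrix.cons_val_zero, Matrix.cons_val_one]
      exact ⟨fun l m => (ht l m).1, hd1⟩)
  simp only [Fin.forall_fin_two, Equiv.swap_apply_left, Equiv.swap_apply_right, Equiv.refl_apply,
    Matrix.cons_val_zero, Matrix.cons_val_one] at eg ep
  refine ⟨fun i => p i / g i, fun i l m => div_ne_zero (hp i l m) (hg i l m), g, hg, ?_⟩
  obtain ⟨L, M⟩ := t
  simp only [LaxTerms.gauge, LaxTerms.mk.injEq]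
  constructor
  · ext i j l m
    have g0 := hg 0 l m
    have g1 := hg 1 l m
    have p0 := hp 0 l m
    have p1 := hp 1 l m
    have g0' := hg 0 (l + 1) m
    have g1' := hg 1 (l + 1) m
    revert i j
    simp only [Fin.forall_fin_two, laxLMKdV2, barShift, Matrix.of_apply, Matrix.cons_val',
      Matrix.cons_val_zero, Matrix.cons_val_one, Matrix.cons_val_fin_one, Pi.div_apply,
      Pi.one_apply, mul_one]
    refine ⟨⟨?_, ?_⟩, ?_, ?_⟩
    · field_simp
      exact (ep.1 l m).1.symm
    · field_simp
      exact (eg.1 l m).1.symm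
    · field_simp
      exact (eg.2 l m).1.symm
    · field_simp
      rw [(ep.2 l m).1]
      linear_combination p 1 l m * hd2 l m
  · ext i j l m
    have g0 := hg 0 l m
    have g1 := hg 1 l m
    have p0 := hp 0 l m
    have p1 := hp 1 l m
    have g0' := hg 0 l (m + 1)
    have g1' := hg 1 l (m + 1)
    revert i j
    simp only [Fin.forall_fin_two, laxLMKdV2, hatShift, Matrix.of_apply, Matrix.cons_val',
      Matrix.cons_val_zero, Matrix.cons_val_one, Matrix.cons_val_fin_one, Pi.div_apply,
      Pi.one_apply, mul_one]
    refine ⟨⟨?_, ?_⟩, ?_, ?_⟩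
    · field_simp
      exact (ep.1 l m).2.symm
    · field_simp
      exact (eg.1 l m).2.symm
    · field_simp
      exact (eg.2 l m).2.symm
    · field_simp
      exact (ep.2 l m).2.symm

/-! ### Reduction to LSG₂ and to the degenerate sine-Gordon equation -/

/-- The lattice equations when `L` and `M` have proportional diagonal spectral factors, and all
spectral products in the diagonal entries of the compatibility condition are proportional, while
those in the off-diagonal entries are not. -/
def SineGordonForm (t : LaxTerms) : Prop := ∀ l m : ℤ,
  t.L 0 0 l (m + 1) * t.M 0 0 l m + t.L 0 1 l (m + 1) * t.M 1 0 l m =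
    t.M 0 0 (l + 1) m * t.L 0 0 l m + t.M 0 1 (l + 1) m * t.L 1 0 l m ∧
  t.L 0 0 l (m + 1) * t.M 0 1 l m = t.M 0 1 (l + 1) m * t.L 1 1 l m ∧
  t.L 0 1 l (m + 1) * t.M 1 1 l m = t.M 0 0 (l + 1) m * t.L 0 1 l m ∧
  t.L 1 0 l (m + 1) * t.M 0 0 l m = t.M 1 1 (l + 1) m * t.L 1 0 l m ∧
  t.L 1 1 l (m + 1) * t.M 1 0 l m = t.M 1 0 (l + 1) m * t.L 0 0 l m ∧
  t.L 1 0 l (m + 1) * t.M 0 1 l m + t.L 1 1 l (m + 1) * t.M 1 1 l m =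
    t.M 1 0 (l + 1) m * t.L 0 1 l m + t.M 1 1 (l + 1) m * t.L 1 1 l m

namespace LaxSpectrum

variable {S : LaxSpectrum}

theorem system_iff_sineGordonForm (hD : ∀ ν ∈ S.U, S.L 1 1 ν = S.L 0 0 ν)
    (hΔ : ∀ ν ∈ S.U, S.M 1 1 ν = S.M 0 0 ν)
    (hCΞ : ∀ ν ∈ S.U, S.L 1 0 ν * S.M 0 1 ν = S.L 0 0 ν * S.M 0 0 ν)
    (hBΓ : (∀ ν ∈ S.U, S.L 0 1 ν = 0) ∨
      ∀ ν ∈ S.U, S.L 0 1 ν * S.M 1 0 ν = S.L 0 0 ν * S.M 0 0 ν)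
    (hA : ∃ ν ∈ S.U, S.L 0 0 ν * S.M 0 0 ν ≠ 0) (hΞ : ∃ ν ∈ S.U, S.L 0 0 ν * S.M 0 1 ν ≠ 0)
    (hC : ∃ ν ∈ S.U, S.L 1 0 ν * S.M 0 0 ν ≠ 0)
    (h01 : (∀ ν ∈ S.U, S.L 0 1 ν = 0) ∨
      IndependentOn S.U (fun ν => S.L 0 0 ν * S.M 0 1 ν) fun ν => S.L 0 1 ν * S.M 0 0 ν)
    (h10 : (∀ ν ∈ S.U, S.M 1 0 ν = 0) ∨
      IndependentOn S.U (fun ν => S.L 1 0 ν * S.M 0 0 ν) fun ν => S.L 0 0 ν * S.M 1 0 ν)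
    (t : LaxTerms) : S.System t ↔ S.Admissible t ∧ SineGordonForm t := by
  rw [system_iff]
  refine and_congr_right fun ht => ?_
  simp only [entry_iff, ← forall_and]
  refine forall₂_congr fun l m => ?_
  have hb (l m l' m') : ∀ ν ∈ S.U, t.L 0 1 l m * t.M 1 0 l' m' * (S.L 0 1 ν * S.M 1 0 ν) =
      t.L 0 1 l m * t.M 1 0 l' m' * (S.L 0 0 ν * S.M 0 0 ν) := by
    intro ν hν
    obtain h | h := hBΓ
    · simp only [ht.L_eq_zero h, zero_mul]
    · rw [h ν hν]
  constructor
  · intro H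
    have H' := H
    obtain ⟨ν, hν, hne⟩ := hA
    have e1 : (t.L 0 0 l (m + 1) * t.M 0 1 l m - t.M 0 1 (l + 1) m * t.L 1 1 l m = 0) ∧
        (t.L 0 1 l (m + 1) * t.M 1 1 l m - t.M 0 0 (l + 1) m * t.L 0 1 l m = 0) := by
      have e : ∀ ν ∈ S.U, (t.L 0 0 l (m + 1) * t.M 0 1 l m - t.M 0 1 (l + 1) m * t.L 1 1 l m) *
          (S.L 0 0 ν * S.M 0 1 ν) + (t.L 0 1 l (m + 1) * t.M 1 1 l m -
            t.M 0 0 (l + 1) m * t.L 0 1 l m) * (S.L 0 1 ν * S.M 0 0 ν) = 0 := fun ν hν => by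
        linear_combination (H ν hν).1.2 + t.M 0 1 (l + 1) m * t.L 1 1 l m * S.M 0 1 ν * hD ν hν -
          t.L 0 1 l (m + 1) * t.M 1 1 l m * S.L 0 1 ν * hΔ ν hν
      obtain h | h := h01
      · obtain ⟨ν, hν, hne⟩ := hΞ
        have e' := e ν hν
        simp only [ht.L_eq_zero h, mul_zero, zero_mul, sub_zero, add_zero] at e' ⊢
        exact ⟨(mul_eq_zero.1 e').resolve_right hne, trivial⟩
      · exact h _ _ e
    have e2 : (t.L 1 0 l (m + 1) * t.M 0 0 l m - t.M 1 1 (l + 1) m * t.L 1 0 l m = 0) ∧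
        (t.L 1 1 l (m + 1) * t.M 1 0 l m - t.M 1 0 (l + 1) m * t.L 0 0 l m = 0) := by
      have e : ∀ ν ∈ S.U, (t.L 1 0 l (m + 1) * t.M 0 0 l m - t.M 1 1 (l + 1) m * t.L 1 0 l m) *
          (S.L 1 0 ν * S.M 0 0 ν) + (t.L 1 1 l (m + 1) * t.M 1 0 l m -
            t.M 1 0 (l + 1) m * t.L 0 0 l m) * (S.L 0 0 ν * S.M 1 0 ν) = 0 := fun ν hν => by
        linear_combination (H ν hν).2.1 + t.M 1 1 (l + 1) m * t.L 1 0 l m * S.L 1 0 ν * hΔ ν hν -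
          t.L 1 1 l (m + 1) * t.M 1 0 l m * S.M 1 0 ν * hD ν hν
      obtain h | h := h10
      · obtain ⟨ν, hν, hne⟩ := hC
        have e' := e ν hν
        simp only [ht.M_eq_zero h, mul_zero, zero_mul, sub_zero, add_zero] at e' ⊢
        exact ⟨(mul_eq_zero.1 e').resolve_right hne, trivial⟩
      · exact h _ _ e
    refine ⟨mul_right_cancel₀ hne ?_, sub_eq_zero.1 e1.1, sub_eq_zero.1 e1.2, sub_eq_zero.1 e2.1,
      sub_eq_zero.1 e2.2, mul_right_cancel₀ hne ?_⟩
    · linear_combination (H ν hν).1.1 - hb l (m + 1) l m ν hν +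
        t.M 0 1 (l + 1) m * t.L 1 0 l m * hCΞ ν hν
    · linear_combination (H ν hν).2.2 + hb l m (l + 1) m ν hν -
        t.L 1 0 l (m + 1) * t.M 0 1 l m * hCΞ ν hν -
        (t.L 1 1 l (m + 1) * t.M 1 1 l m - t.M 1 1 (l + 1) m * t.L 1 1 l m) *
          (S.M 1 1 ν * hD ν hν + S.L 0 0 ν * hΔ ν hν)
  · rintro ⟨e1, e2, e3, e4, e5, e6⟩ ν hν
    refine ⟨⟨?_, ?_⟩, ?_, ?_⟩
    · linear_combination S.L 0 0 ν * S.M 0 0 ν * e1 + hb l (m + 1) l m ν hν -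
        t.M 0 1 (l + 1) m * t.L 1 0 l m * hCΞ ν hν
    · linear_combination S.L 0 0 ν * S.M 0 1 ν * e2 + S.L 0 1 ν * S.M 0 0 ν * e3 -
        t.M 0 1 (l + 1) m * t.L 1 1 l m * S.M 0 1 ν * hD ν hν +
        t.L 0 1 l (m + 1) * t.M 1 1 l m * S.L 0 1 ν * hΔ ν hν
    · linear_combination S.L 1 0 ν * S.M 0 0 ν * e4 + S.L 0 0 ν * S.M 1 0 ν * e5 -
        t.M 1 1 (l + 1) m * t.L 1 0 l m * S.L 1 0 ν * hΔ ν hν +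
        t.L 1 1 l (m + 1) * t.M 1 0 l m * S.M 1 0 ν * hD ν hν
    · linear_combination S.L 0 0 ν * S.M 0 0 ν * e6 - hb l m (l + 1) m ν hν +
        t.L 1 0 l (m + 1) * t.M 0 1 l m * hCΞ ν hν +
        (t.L 1 1 l (m + 1) * t.M 1 1 l m - t.M 1 1 (l + 1) m * t.L 1 1 l m) *
          (S.M 1 1 ν * hD ν hν + S.L 0 0 ν * hΔ ν hν)

end LaxSpectrum

theorem sineGordonForm_laxLSG2 (lam mu : ℤ → ℂ) {X : Fin 2 → LatticeFn}
    (hX : ∀ i, Nonvanishing (X i)) : SineGordonForm (laxLSG2 lam mu X) ↔ LSG2 lam mu X := by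
  refine forall₂_congr fun l m => ?_
  have x1 := hX 0 l m
  have x2 := hX 0 (l + 1) m
  have x3 := hX 0 l (m + 1)
  have x4 := hX 0 (l + 1) (m + 1)
  have z1 := hX 1 l m
  have z2 := hX 1 (l + 1) m
  have z3 := hX 1 l (m + 1)
  have z4 := hX 1 (l + 1) (m + 1)
  simp only [laxLSG2, barShift, hatShift, Matrix.of_apply, Matrix.cons_val', Matrix.cons_val_zero,
    Matrix.cons_val_one, Matrix.cons_val_fin_one, Pi.div_apply, Pi.one_apply, one_mul, mul_one,
    true_and]
  constructor
  · rintro ⟨h1, -, -, h2⟩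
    constructor
    · field_simp at h2 ⊢
      linear_combination -h2
    · field_simp at h1 ⊢
      linear_combination h1
  · rintro ⟨h1, h2⟩
    refine ⟨?_, ?_, ?_, ?_⟩
    · field_simp at h2 ⊢
      linear_combination h2
    · field_simp
    · field_simp
    · field_simp at h1 ⊢
      linear_combination -h1

/-- Every solution of the equations in `SineGordonForm` is gauge equivalent to the lattice factors
of the Lax pair of LSG₂. The gauge makes the diagonal factors of `M` and the factor of `C` equal to
`1`. -/
theorem exists_eq_gauge_laxLSG2 {lam mu : ℤ → ℂ} (hmu : ∀ m, mu m ≠ 0) {t : LaxTerms}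
    (ht : SineGordonForm t) (hL : ∀ i j, (i, j) ≠ (0, 1) → Nonvanishing (t.L i j))
    (hM : ∀ i j, Nonvanishing (t.M i j))
    (hB : (Nonvanishing (t.L 0 1) ∧ ∀ l, lam l ≠ 0) ∨ t.L 0 1 = 0 ∧ lam = 0) :
    ∃ X : Fin 2 → LatticeFn, (∀ i, Nonvanishing (X i)) ∧
      ∃ g : Fin 2 → LatticeFn, (∀ i, Nonvanishing (g i)) ∧ t = (laxLSG2 lam mu X).gauge g := by
  have ha := hL 0 0 (by simp)
  have hc := hL 1 0 (by simp)
  have hd := hL 1 1 (by simp)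
  -- A substitute for the quotient of the lattice factor of `B` by `lam`, if both vanish.
  obtain ⟨b, hb, hb1, hb2⟩ : ∃ b : LatticeFn, Nonvanishing b ∧
      (∀ l m, b l (m + 1) * t.M 1 1 l m = t.M 0 0 (l + 1) m * b l m) ∧
      ∀ l m, t.L 0 1 l m = lam l * b l m := by
    obtain ⟨h, hlam⟩ | ⟨h, rfl⟩ := hB
    · refine ⟨fun l m => t.L 0 1 l m / lam l, fun l m => div_ne_zero (h l m) (hlam l),
        fun l m => ?_, fun l m => (mul_div_cancel₀ _ (hlam l)).symm⟩
      have := hlam l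
      field_simp
      exact (ht l m).2.2.1
    · obtain ⟨b, hb, e⟩ := exists_hatShift_eq_mul
        (fun l m => t.M 0 0 (l + 1) m / t.M 1 1 l m) fun l m =>
          div_ne_zero (hM _ _ _ _) (hM _ _ _ _)
      refine ⟨b, hb, fun l m => ?_, fun l m => by simp [h]⟩
      have := hM 1 1 l m
      rw [e]
      field_simp
  obtain ⟨g, hg, eg⟩ := exists_multiplicative_flow (Equiv.swap 0 1) (Equiv.refl _)
    ![b, t.L 1 0] ![t.M 0 0, t.M 1 1] (by simp [Fin.forall_fin_two, hb, hc])
    (by simp [Fin.forall_fin_two, hM]) (fun _ => rfl) (by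
      simp only [Fin.forall_fin_two, Equiv.swap_apply_left, Equiv.swap_apply_right,
        Equiv.refl_apply, Matrix.cons_val_zero, Matrix.cons_val_one]
      exact ⟨hb1, fun l m => (ht l m).2.2.2.1⟩)
  obtain ⟨p, hp, ep⟩ := exists_multiplicative_flow (Equiv.refl (Fin 2)) (Equiv.swap 0 1)
    ![t.L 0 0, t.L 1 1] ![t.M 0 1, fun l m => t.M 1 0 l m / mu m]
    (by simp [Fin.forall_fin_two, ha, hd]) (by
      simp only [Fin.forall_fin_two, Matrix.cons_val_zero, Matrix.cons_val_one]
      exact ⟨hM _ _, fun l m => div_ne_zero (hM _ _ _ _) (hmu m)⟩) (fun _ => rfl) (by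
      simp only [Fin.forall_fin_two, Equiv.refl_apply, Equiv.swap_apply_left,
        Equiv.swap_apply_right, Matrix.cons_val_zero, Matrix.cons_val_one]
      refine ⟨fun l m => (ht l m).2.1, fun l m => ?_⟩
      rw [mul_div_assoc', (ht l m).2.2.2.2.1]
      ring)
  simp only [Fin.forall_fin_two, Equiv.swap_apply_left, Equiv.swap_apply_right, Equiv.refl_apply,
    Matrix.cons_val_zero, Matrix.cons_val_one] at eg ep
  refine ⟨![fun l m => p 1 l m / g 1 l m, fun l m => p 0 l m / g 0 l m], ?_, g, hg, ?_⟩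
  · simp only [Fin.forall_fin_two, Matrix.cons_val_zero, Matrix.cons_val_one]
    exact ⟨fun l m => div_ne_zero (hp _ l m) (hg _ l m),
      fun l m => div_ne_zero (hp _ l m) (hg _ l m)⟩
  obtain ⟨L, M⟩ := t
  simp only [LaxTerms.gauge, LaxTerms.mk.injEq]
  constructor
  · ext i j l m
    have g0 := hg 0 l m
    have g1 := hg 1 l m
    have p0 := hp 0 l m
    have p1 := hp 1 l m
    have g0' := hg 0 (l + 1) m
    have g1' := hg 1 (l + 1) m
    revert i j
    simp only [Fin.forall_fin_two, laxLSG2, barShift, Matrix.of_apply, Matrix.cons_val',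
      Matrix.cons_val_zero, Matrix.cons_val_one, Matrix.cons_val_fin_one, Pi.div_apply,
      Pi.one_apply, mul_one]
    refine ⟨⟨?_, ?_⟩, ?_, ?_⟩
    · field_simp
      exact (ep.1 l m).1.symm
    · field_simp
      rw [(eg.1 l m).1]
      linear_combination g 1 l m * hb2 l m
    · field_simp
      exact (eg.2 l m).1.symm
    · field_simp
      exact (ep.2 l m).1.symm
  · ext i j l m
    have g0 := hg 0 l m
    have g1 := hg 1 l m
    have p0 := hp 0 l m
    have p1 := hp 1 l m
    have g0' := hg 0 l (m + 1)
    have g1' := hg 1 l (m + 1)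
    have := hmu m
    revert i j
    simp only [Fin.forall_fin_two, laxLSG2, hatShift, Matrix.of_apply, Matrix.cons_val',
      Matrix.cons_val_zero, Matrix.cons_val_one, Matrix.cons_val_fin_one, Pi.div_apply,
      Pi.one_apply, mul_one]
    refine ⟨⟨?_, ?_⟩, ?_, ?_⟩
    · field_simp
      exact (eg.1 l m).2.symm
    · field_simp
      exact (ep.1 l m).2.symm
    · field_simp
      rw [(ep.2 l m).2]
      field_simp
    · field_simp
      exact (eg.2 l m).2.symm

theorem sineGordonForm_laxDegenerateLSG {X : Fin 1 → LatticeFn} (hX : ∀ i, Nonvanishing (X i)) :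
    SineGordonForm (laxDegenerateLSG X) ↔ LSG 0 0 X := by
  refine forall₂_congr fun l m => ?_
  have x1 := hX 0 l m
  have x2 := hX 0 (l + 1) m
  have x3 := hX 0 l (m + 1)
  have x4 := hX 0 (l + 1) (m + 1)
  simp only [laxDegenerateLSG, barShift, hatShift, Matrix.of_apply, Matrix.cons_val',
    Matrix.cons_val_zero, Matrix.cons_val_one, Matrix.cons_val_fin_one, Pi.div_apply, Pi.one_apply,
    Pi.zero_apply, one_mul, mul_one, mul_zero, zero_mul, add_zero, zero_add, sub_zero, true_and]
  constructor
  · rintro ⟨h, -⟩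
    field_simp at h
    linear_combination h
  · intro h
    refine ⟨?_, ?_, ?_, ?_⟩
    · field_simp
      linear_combination h
    · field_simp
    · field_simp
    · field_simp
      linear_combination -h

/-- If the lattice factors of `B` and `Γ` vanish, then the solutions of the equations in
`SineGordonForm` are gauge equivalent to the lattice factors of the Lax pair of the degenerate
sine-Gordon equation. In the recursions for the gauge functions and the new variable, the steps in
the two directions commute because of the equality of determinants
`â d̂ α δ = ᾱ δ̄ a d`, which follows from the four equations. -/
theorem exists_eq_gauge_laxDegenerateLSG {t : LaxTerms} (ht : SineGordonForm t)
    (hL : ∀ i j, (i, j) ≠ (0, 1) → Nonvanishing (t.L i j))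
    (hM : ∀ i j, (i, j) ≠ (1, 0) → Nonvanishing (t.M i j)) (hB : t.L 0 1 = 0) (hΓ : t.M 1 0 = 0) :
    ∃ X : Fin 1 → LatticeFn, (∀ i, Nonvanishing (X i)) ∧
      ∃ g : Fin 2 → LatticeFn, (∀ i, Nonvanishing (g i)) ∧ t = (laxDegenerateLSG X).gauge g := by
  have ha := hL 0 0 (by simp)
  have hc := hL 1 0 (by simp)
  have hd := hL 1 1 (by simp)
  have hα := hM 0 0 (by simp)
  have hβ := hM 0 1 (by simp)
  have hδ := hM 1 1 (by simp)
  obtain ⟨L, M⟩ := t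
  simp only [SineGordonForm] at *
  set a := L 0 0
  set c := L 1 0
  set d := L 1 1
  set α := M 0 0
  set β := M 0 1
  set δ := M 1 1
  simp only [hB, hΓ, Pi.zero_apply, mul_zero, zero_mul, add_zero, zero_add, true_and] at ht
  have key (l m) : a l (m + 1) * d l (m + 1) * δ l m * c l m =
      α (l + 1) m * a l m * d l m * c l (m + 1) := by
    obtain ⟨e1, e2, e3, e4⟩ := ht l m
    linear_combination a l (m + 1) * c l m * e4 + d l m * c l (m + 1) * e1 -
      a l (m + 1) * d l m * e3 - c l m * c l (m + 1) * e2
  -- The unknowns of the recursions are the gauge functions `g 0`, `g 1` and `g 0 * X 0`.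
  let F (u v w : ℂˣ) : Equiv.Perm (ℂˣ × ℂˣ × ℂˣ) :=
    { toFun := fun x => (u * x.1, v * x.2.2, w * x.2.1)
      invFun := fun x => (u⁻¹ * x.1, w⁻¹ * x.2.2, v⁻¹ * x.2.1)
      left_inv := fun x => by simp
      right_inv := fun x => by simp }
  let G (u v w : ℂˣ) : Equiv.Perm (ℂˣ × ℂˣ × ℂˣ) :=
    { toFun := fun x => (u * (x.2.1 * x.2.2) / x.1, v * x.2.1, w * x.2.2)
      invFun := fun x => (u * (v⁻¹ * x.2.1 * (w⁻¹ * x.2.2)) / x.1, v⁻¹ * x.2.1, w⁻¹ * x.2.2)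
      left_inv := fun x => by simp
      right_inv := fun x => by simp }
  obtain ⟨s, h1, h2⟩ := exists_lattice_flow
    (fun l m => F (.mk0 (a l m) (ha l m)) (.mk0 (c l m) (hc l m))
      (.mk0 (a l m * d l m / c l m) (div_ne_zero (mul_ne_zero (ha l m) (hd l m)) (hc l m))))
    (fun l m => G (.mk0 (β l m) (hβ l m)) (.mk0 (δ l m) (hδ l m)) (.mk0 (α l m) (hα l m)))
    fun l m x => by
      have a0 := ha l m
      have c0 := hc l m
      have c1 := hc l (m + 1)
      have x0 := x.1.ne_zero
      obtain ⟨e1, e2, e3, e4⟩ := ht l m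
      simp only [F, G, Equiv.coe_fn_mk, Prod.mk.injEq, Units.ext_iff, Units.val_mul, Units.val_mk0,
        Units.val_div_eq_div_val]
      refine ⟨?_, ?_, ?_⟩
      · field_simp
        linear_combination e2
      · linear_combination (x.2.2 : ℂ) * e3
      · field_simp
        linear_combination key l m
  refine ⟨fun _ l m => (s l m).2.2 / (s l m).1, fun _ l m => div_ne_zero (Units.ne_zero _)
    (Units.ne_zero _), ![fun l m => (s l m).1, fun l m => (s l m).2.1], ?_, ?_⟩
  · simp only [Fin.forall_fin_two, Matrix.cons_val_zero, Matrix.cons_val_one]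
    exact ⟨fun l m => Units.ne_zero _, fun l m => Units.ne_zero _⟩
  simp only [LaxTerms.gauge, LaxTerms.mk.injEq]
  constructor
  · ext i j l m
    have g0 := (s l m).1.ne_zero
    have g1 := (s l m).2.1.ne_zero
    have p0 := (s l m).2.2.ne_zero
    have a0 := ha l m
    have c0 := hc l m
    revert i j
    simp only [Fin.forall_fin_two, laxDegenerateLSG, barShift, Matrix.of_apply, Matrix.cons_val',
      Matrix.cons_val_zero, Matrix.cons_val_one, Matrix.cons_val_fin_one, Pi.div_apply,
      Pi.one_apply, mul_one, h1, F, Equiv.coe_fn_mk, Units.val_mul, Units.val_mk0]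
    refine ⟨⟨?_, ?_⟩, ?_, ?_⟩
    · field_simp
      rfl
    · simp [hB]
    · field_simp
      rfl
    · field_simp
      rfl
  · ext i j l m
    have g0 := (s l m).1.ne_zero
    have g1 := (s l m).2.1.ne_zero
    have p0 := (s l m).2.2.ne_zero
    revert i j
    simp only [Fin.forall_fin_two, laxDegenerateLSG, hatShift, Matrix.of_apply, Matrix.cons_val',
      Matrix.cons_val_zero, Matrix.cons_val_one, Matrix.cons_val_fin_one, Pi.div_apply,
      Pi.one_apply, mul_one, h2, G, Equiv.coe_fn_mk, Units.val_mul, Units.val_mk0,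
      Units.val_div_eq_div_val]
    refine ⟨⟨?_, ?_⟩, ?_, ?_⟩
    · have := hβ l m
      field_simp
      rfl
    · field_simp
      rfl
    · simp [hΓ]
    · field_simp
      rfl

/-! ### Spectral conditions for the reductions -/

namespace LaxSpectrum

variable {S : LaxSpectrum}

theorem reducibleTo_LMKdV2 {lam : ℤ → ℂ} (hL : ∀ i j, (i, j) ≠ (1, 1) → S.NonzeroL i j)
    (hM : ∀ i j, S.NonzeroM i j)
    (hD : (ProportionalOn S.U (S.L 1 1) (S.L 0 0) ∧ ∀ l, lam l ≠ 0) ∨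
      (∀ ν ∈ S.U, S.L 1 1 ν = 0) ∧ lam = 0)
    (hΔ : ProportionalOn S.U (S.M 1 1) (S.M 0 0))
    (h01 : ProportionalOn S.U (fun ν => S.L 0 0 ν * S.M 0 1 ν) fun ν => S.L 0 1 ν * S.M 0 0 ν)
    (h11 : ProportionalOn S.U (fun ν => S.L 0 1 ν * S.M 1 0 ν) fun ν => S.L 1 0 ν * S.M 0 1 ν)
    (hi : IndependentOn S.U (fun ν => S.L 0 0 ν * S.M 0 0 ν) fun ν => S.L 0 1 ν * S.M 1 0 ν) :
    S.ReducibleTo (LMKdV2 lam) (laxLMKdV2 lam) := by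
  obtain ⟨kΔ, hkΔ, eΔ⟩ := hΔ
  obtain ⟨p, hp, ep⟩ := h01
  obtain ⟨q, hq, eq⟩ := h11
  have hA := hL 0 0 (by simp)
  have hB := hL 0 1 (by simp)
  have hC := hL 1 0 (by simp)
  have h10 : ∀ ν ∈ S.U, S.L 0 0 ν * S.M 1 0 ν - p * q * (S.L 1 0 ν * S.M 0 0 ν) = 0 := by
    refine S.eq_zero_of_mul_eq_zero (S.analyticM 0 1) (((S.analyticL 0 0).mul
      (S.analyticM 1 0)).sub (analyticOnNhd_const.mul ((S.analyticL 1 0).mul (S.analyticM 0 0))))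
      (hM 0 1) fun ν hν => ?_
    have e1 := ep ν hν
    have e2 := eq ν hν
    change S.M 0 1 ν * (S.L 0 0 ν * S.M 1 0 ν - p * q * (S.L 1 0 ν * S.M 0 0 ν)) = 0
    linear_combination S.M 1 0 ν * e1 + p * S.M 0 0 ν * e2
  obtain ⟨k, hk, hD', hlam⟩ : ∃ k : ℂ, k ≠ 0 ∧ ((∀ ν ∈ S.U, k * S.L 1 1 ν = S.L 0 0 ν) ∨
      ∀ ν ∈ S.U, k * S.L 1 1 ν = 0) ∧
      (S.NonzeroL 1 1 ∧ (∀ l, lam l ≠ 0) ∨ ¬ S.NonzeroL 1 1 ∧ lam = 0) := by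
    obtain ⟨⟨k, hk, e⟩, hlam⟩ | ⟨h, rfl⟩ := hD
    · refine ⟨k⁻¹, inv_ne_zero hk, .inl fun ν hν => by rw [e ν hν, inv_mul_cancel_left₀ hk],
        .inl ⟨?_, hlam⟩⟩
      obtain ⟨ν, hν, hne⟩ := hA
      exact ⟨ν, hν, by rw [e ν hν]; exact mul_ne_zero hk hne⟩
    · exact ⟨1, one_ne_zero, .inr fun ν hν => by rw [h ν hν, mul_zero],
        .inr ⟨fun ⟨ν, hν, hne⟩ => hne (h ν hν), rfl⟩⟩
  let κ : Matrix (Fin 2) (Fin 2) ℂ := !![1, 1; 1, k]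
  let κ' : Matrix (Fin 2) (Fin 2) ℂ := !![1, p⁻¹; (p * q)⁻¹, kΔ⁻¹]
  have hκ : ∀ i j, κ i j ≠ 0 := by simp [κ, Fin.forall_fin_two, hk]
  have hκ' : ∀ i j, κ' i j ≠ 0 := by simp [κ', Fin.forall_fin_two, hp, hq, hkΔ]
  have hS := system_iff_mkdvForm (S := S.rescale κ κ') (by simpa [rescale, κ] using hD')
    (fun ν hν => by simp [rescale, κ', eΔ ν hν, hkΔ])
    (fun ν hν => by
      have := ep ν hν
      simp only [rescale, κ, κ', Matrix.of_apply, Matrix.cons_val', Matrix.cons_val_zero,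
        Matrix.cons_val_one, Matrix.cons_val_fin_one]
      field_simp
      linear_combination this)
    (fun ν hν => by
      have := h10 ν hν
      simp only [rescale, κ, κ', Matrix.of_apply, Matrix.cons_val', Matrix.cons_val_zero,
        Matrix.cons_val_one, Matrix.cons_val_fin_one]
      field_simp
      linear_combination this)
    (fun ν hν => by
      have := eq ν hν
      simp only [rescale, κ, κ', Matrix.of_apply, Matrix.cons_val', Matrix.cons_val_zero,
        Matrix.cons_val_one, Matrix.cons_val_fin_one]
      field_simp
      linear_combination -this)
    (by simpa [rescale, κ, κ'] using
      S.exists_mul_ne_zero (S.analyticL 0 1) (S.analyticM 0 0) hB (hM 0 0))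
    (by simpa [rescale, κ, κ'] using
      S.exists_mul_ne_zero (S.analyticL 1 0) (S.analyticM 0 0) hC (hM 0 0))
    (fun x y e => by
      obtain ⟨h1, h2⟩ := hi x ((p * q)⁻¹ * y) fun ν hν => by
        have := e ν hν
        simp only [rescale, κ, κ', Matrix.of_apply, Matrix.cons_val', Matrix.cons_val_zero,
          Matrix.cons_val_one, Matrix.cons_val_fin_one] at this
        linear_combination this
      exact ⟨h1, by simpa [hp, hq] using h2⟩)
  refine .inl (reducesTo_of_rescale κ κ' hκ hκ' (fun X hX => ?_) fun t ht => ?_)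
  · rw [hS, mkdvForm_lax lam hX, and_iff_right]
    simp only [Admissible, Fin.forall_fin_two, nonzeroL_rescale (hκ _ _),
      nonzeroM_rescale (hκ' _ _),
      hA, hB, hC, hM, iff_true, laxLMKdV2, barShift, hatShift, Matrix.of_apply, Matrix.cons_val',
      Matrix.cons_val_zero, Matrix.cons_val_one, Matrix.cons_val_fin_one, Pi.div_apply,
      Pi.one_apply]
    have hx (i l m) := hX i l m
    obtain ⟨h, hlam⟩ | ⟨h, rfl⟩ := hlam
    · simp [h, hlam, hx]
    · simp [h, hx]
  · obtain ⟨hadm, hf⟩ := (hS t).1 ht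
    refine exists_eq_gauge_laxLMKdV2 hf (fun i j hij l m => (hadm.1 i j l m).2
      ((nonzeroL_rescale (hκ i j)).2 (hL i j hij))) (fun i j l m => (hadm.2 i j l m).2
      ((nonzeroM_rescale (hκ' i j)).2 (hM i j))) ?_
    have hd (l m) := (hadm.1 1 1 l m).trans (nonzeroL_rescale (hκ 1 1))
    obtain ⟨h, hlam⟩ | ⟨h, rfl⟩ := hlam
    · exact .inl ⟨fun l m => (hd l m).2 h, hlam⟩
    · exact .inr ⟨by ext l m; exact not_not.1 fun hne => h ((hd l m).1 hne), rfl⟩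

/-- Normalization by constants of spectral factors for which the system takes the form
`SineGordonForm`. The factors `B` and `Γ` may be zero terms. -/
theorem exists_rescale_sineGordonForm (hL : ∀ i j, (i, j) ≠ (0, 1) → S.NonzeroL i j)
    (hM : ∀ i j, (i, j) ≠ (1, 0) → S.NonzeroM i j)
    (hD : ProportionalOn S.U (S.L 1 1) (S.L 0 0)) (hΔ : ProportionalOn S.U (S.M 1 1) (S.M 0 0))
    (hCΞ : ProportionalOn S.U (fun ν => S.L 1 0 ν * S.M 0 1 ν) fun ν => S.L 0 0 ν * S.M 0 0 ν)
    (hBΓ : (∀ ν ∈ S.U, S.L 0 1 ν = 0) ∨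
      ProportionalOn S.U (fun ν => S.L 0 1 ν * S.M 1 0 ν) fun ν => S.L 0 0 ν * S.M 0 0 ν)
    (h01 : (∀ ν ∈ S.U, S.L 0 1 ν = 0) ∨
      IndependentOn S.U (fun ν => S.L 0 0 ν * S.M 0 1 ν) fun ν => S.L 0 1 ν * S.M 0 0 ν)
    (h10 : (∀ ν ∈ S.U, S.M 1 0 ν = 0) ∨
      IndependentOn S.U (fun ν => S.L 1 0 ν * S.M 0 0 ν) fun ν => S.L 0 0 ν * S.M 1 0 ν) :
    ∃ κ κ' : Matrix (Fin 2) (Fin 2) ℂ, (∀ i j, κ i j ≠ 0) ∧ (∀ i j, κ' i j ≠ 0) ∧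
      ∀ t, (S.rescale κ κ').System t ↔ (S.rescale κ κ').Admissible t ∧ SineGordonForm t := by
  obtain ⟨kD, hkD, eD⟩ := hD
  obtain ⟨kΔ, hkΔ, eΔ⟩ := hΔ
  obtain ⟨p, hp, ep⟩ := hCΞ
  obtain ⟨q, hq, eq⟩ : ∃ q : ℂ, q ≠ 0 ∧ ((∀ ν ∈ S.U, S.L 0 1 ν = 0) ∨
      ∀ ν ∈ S.U, S.L 0 1 ν * S.M 1 0 ν = q * (S.L 0 0 ν * S.M 0 0 ν)) := by
    obtain h | ⟨q, hq, e⟩ := hBΓ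
    exacts [⟨1, one_ne_zero, .inl h⟩, ⟨q, hq, .inr e⟩]
  let κ : Matrix (Fin 2) (Fin 2) ℂ := !![1, 1; 1, kD⁻¹]
  let κ' : Matrix (Fin 2) (Fin 2) ℂ := !![1, p⁻¹; q⁻¹, kΔ⁻¹]
  have hκ : ∀ i j, κ i j ≠ 0 := by simp [κ, Fin.forall_fin_two, hkD]
  have hκ' : ∀ i j, κ' i j ≠ 0 := by simp [κ', Fin.forall_fin_two, hp, hq, hkΔ]
  have hA := hL 0 0 (by simp)
  have hC := hL 1 0 (by simp)
  have hΛ := hM 0 0 (by simp)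
  have hΞ := hM 0 1 (by simp)
  refine ⟨κ, κ', hκ, hκ', system_iff_sineGordonForm (S := S.rescale κ κ')
    (fun ν hν => by simp [rescale, κ, eD ν hν, hkD])
    (fun ν hν => by simp [rescale, κ', eΔ ν hν, hkΔ]) (fun ν hν => ?_) ?_
    (by simpa [rescale, κ, κ'] using
      S.exists_mul_ne_zero (S.analyticL 0 0) (S.analyticM 0 0) hA hΛ)
    (by simpa [rescale, κ, κ', hp] using
      S.exists_mul_ne_zero (S.analyticL 0 0) (S.analyticM 0 1) hA hΞ)
    (by simpa [rescale, κ, κ'] using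
      S.exists_mul_ne_zero (S.analyticL 1 0) (S.analyticM 0 0) hC hΛ) ?_ ?_⟩
  · have := ep ν hν
    simp only [rescale, κ, κ', Matrix.of_apply, Matrix.cons_val', Matrix.cons_val_zero,
      Matrix.cons_val_one, Matrix.cons_val_fin_one]
    field_simp
    linear_combination this
  · refine eq.imp (fun h ν hν => by simp [rescale, h ν hν]) fun h ν hν => ?_
    have := h ν hν
    simp only [rescale, κ, κ', Matrix.of_apply, Matrix.cons_val', Matrix.cons_val_zero,
      Matrix.cons_val_one, Matrix.cons_val_fin_one]
    field_simp
    linear_combination this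
  · refine h01.imp (fun h ν hν => by simp [rescale, h ν hν]) fun h x y e => ?_
    obtain ⟨h1, h2⟩ := h (p⁻¹ * x) y fun ν hν => by
      have := e ν hν
      simp only [rescale, κ, κ', Matrix.of_apply, Matrix.cons_val', Matrix.cons_val_zero,
        Matrix.cons_val_one, Matrix.cons_val_fin_one] at this
      linear_combination this
    exact ⟨by simpa [hp] using h1, h2⟩
  · refine h10.imp (fun h ν hν => by simp [rescale, h ν hν]) fun h x y e => ?_
    obtain ⟨h1, h2⟩ := h x (q⁻¹ * y) fun ν hν => by
      have := e ν hν
      simp only [rescale, κ, κ', Matrix.of_apply, Matrix.cons_val', Matrix.cons_val_zero,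
        Matrix.cons_val_one, Matrix.cons_val_fin_one] at this
      linear_combination this
    exact ⟨h1, by simpa [hq] using h2⟩

theorem reducibleTo_LSG2 {lam mu : ℤ → ℂ} (hmu : ∀ m, mu m ≠ 0)
    (hL : ∀ i j, (i, j) ≠ (0, 1) → S.NonzeroL i j) (hM : ∀ i j, S.NonzeroM i j)
    (hlam : S.NonzeroL 0 1 ∧ (∀ l, lam l ≠ 0) ∨ ¬ S.NonzeroL 0 1 ∧ lam = 0)
    (hD : ProportionalOn S.U (S.L 1 1) (S.L 0 0)) (hΔ : ProportionalOn S.U (S.M 1 1) (S.M 0 0))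
    (hCΞ : ProportionalOn S.U (fun ν => S.L 1 0 ν * S.M 0 1 ν) fun ν => S.L 0 0 ν * S.M 0 0 ν)
    (hBΓ : (∀ ν ∈ S.U, S.L 0 1 ν = 0) ∨
      ProportionalOn S.U (fun ν => S.L 0 1 ν * S.M 1 0 ν) fun ν => S.L 0 0 ν * S.M 0 0 ν)
    (h01 : (∀ ν ∈ S.U, S.L 0 1 ν = 0) ∨
      IndependentOn S.U (fun ν => S.L 0 0 ν * S.M 0 1 ν) fun ν => S.L 0 1 ν * S.M 0 0 ν)
    (h10 : IndependentOn S.U (fun ν => S.L 1 0 ν * S.M 0 0 ν) fun ν => S.L 0 0 ν * S.M 1 0 ν) :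
    S.ReducibleTo (LSG2 lam mu) (laxLSG2 lam mu) := by
  obtain ⟨κ, κ', hκ, hκ', hS⟩ := exists_rescale_sineGordonForm hL (fun i j _ => hM i j) hD hΔ hCΞ
    hBΓ h01 (.inr h10)
  have hA := hL 0 0 (by simp)
  have hC := hL 1 0 (by simp)
  have hD0 := hL 1 1 (by simp)
  refine .inl (reducesTo_of_rescale κ κ' hκ hκ' (fun X hX => ?_) fun t ht => ?_)
  · rw [hS, sineGordonForm_laxLSG2 lam mu hX, and_iff_right]
    simp only [Admissible, Fin.forall_fin_two, nonzeroL_rescale (hκ _ _),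
      nonzeroM_rescale (hκ' _ _),
      hA, hD0, hC, hM, iff_true, laxLSG2, barShift, hatShift, Matrix.of_apply, Matrix.cons_val',
      Matrix.cons_val_zero, Matrix.cons_val_one, Matrix.cons_val_fin_one, Pi.div_apply,
      Pi.one_apply]
    have hx (i l m) := hX i l m
    obtain ⟨h, hlam⟩ | ⟨h, rfl⟩ := hlam
    · simp [h, hlam, hx, hmu]
    · simp [h, hx, hmu]
  · obtain ⟨hadm, hf⟩ := (hS t).1 ht
    refine exists_eq_gauge_laxLSG2 hmu hf (fun i j hij l m => (hadm.1 i j l m).2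
      ((nonzeroL_rescale (hκ i j)).2 (hL i j hij))) (fun i j l m => (hadm.2 i j l m).2
      ((nonzeroM_rescale (hκ' i j)).2 (hM i j))) ?_
    have hb (l m) := (hadm.1 0 1 l m).trans (nonzeroL_rescale (hκ 0 1))
    obtain ⟨h, hlam⟩ | ⟨h, rfl⟩ := hlam
    · exact .inl ⟨fun l m => (hb l m).2 h, hlam⟩
    · exact .inr ⟨by ext l m; exact not_not.1 fun hne => h ((hb l m).1 hne), rfl⟩

theorem reducibleTo_LSG (hL : ∀ i j, (i, j) ≠ (0, 1) → S.NonzeroL i j)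
    (hM : ∀ i j, (i, j) ≠ (1, 0) → S.NonzeroM i j) (hB : ∀ ν ∈ S.U, S.L 0 1 ν = 0)
    (hΓ : ∀ ν ∈ S.U, S.M 1 0 ν = 0)
    (hD : ProportionalOn S.U (S.L 1 1) (S.L 0 0)) (hΔ : ProportionalOn S.U (S.M 1 1) (S.M 0 0))
    (hCΞ : ProportionalOn S.U (fun ν => S.L 1 0 ν * S.M 0 1 ν) fun ν => S.L 0 0 ν * S.M 0 0 ν) :
    S.ReducibleTo (LSG 0 0) laxDegenerateLSG := by
  obtain ⟨κ, κ', hκ, hκ', hS⟩ := exists_rescale_sineGordonForm hL hM hD hΔ hCΞ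
    (.inl hB) (.inl hB) (.inl hΓ)
  have hB' : ¬ S.NonzeroL 0 1 := fun ⟨ν, hν, hne⟩ => hne (hB ν hν)
  have hΓ' : ¬ S.NonzeroM 1 0 := fun ⟨ν, hν, hne⟩ => hne (hΓ ν hν)
  refine .inl (reducesTo_of_rescale κ κ' hκ hκ' (fun X hX => ?_) fun t ht => ?_)
  · rw [hS, sineGordonForm_laxDegenerateLSG hX, and_iff_right]
    simp only [Admissible, Fin.forall_fin_two, nonzeroL_rescale (hκ _ _),
      nonzeroM_rescale (hκ' _ _),
      hL 0 0 (by simp), hL 1 0 (by simp), hL 1 1 (by simp), hM 0 0 (by simp), hM 0 1 (by simp),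
      hM 1 1 (by simp), hB', hΓ', iff_true, iff_false, laxDegenerateLSG, barShift, hatShift,
      Matrix.of_apply, Matrix.cons_val', Matrix.cons_val_zero, Matrix.cons_val_one,
      Matrix.cons_val_fin_one, Pi.div_apply, Pi.one_apply]
    have hx (l m) := hX 0 l m
    simp [hx]
  · obtain ⟨hadm, hf⟩ := (hS t).1 ht
    refine exists_eq_gauge_laxDegenerateLSG hf (fun i j hij l m => (hadm.1 i j l m).2
      ((nonzeroL_rescale (hκ i j)).2 (hL i j hij))) (fun i j hij l m => (hadm.2 i j l m).2
      ((nonzeroM_rescale (hκ' i j)).2 (hM i j hij))) ?_ ?_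
    · ext l m
      exact not_not.1 fun hne => hB' ((nonzeroL_rescale (hκ 0 1)).1 ((hadm.1 0 1 l m).1 hne))
    · ext l m
      exact not_not.1 fun hne => hΓ' ((nonzeroM_rescale (hκ' 1 0)).1 ((hadm.2 1 0 l m).1 hne))

end LaxSpectrum

/-! ### Classification: the possible outcomes -/

namespace LaxSpectrum

variable {S : LaxSpectrum}

/-- The list of possible outcomes of the classification. -/
def Classified (S : LaxSpectrum) : Prop :=
  S.Trivial ∨ S.Underdetermined ∨ S.Overdetermined ∨
    (∀ lam : ℤ → ℂ, (∀ l, lam l ≠ 0) → S.ReducibleTo (LMKdV2 lam) (laxLMKdV2 lam)) ∨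
    (∀ lam mu : ℤ → ℂ, (∀ l, lam l ≠ 0) → (∀ m, mu m ≠ 0) →
      S.ReducibleTo (LSG2 lam mu) (laxLSG2 lam mu)) ∨
    S.ReducibleTo (LMKdV2 0) (laxLMKdV2 0) ∨
    (∀ mu : ℤ → ℂ, (∀ m, mu m ≠ 0) → S.ReducibleTo (LSG2 0 mu) (laxLSG2 0 mu)) ∨
    S.ReducibleTo (LSG 0 0) laxDegenerateLSG

theorem Classified.of_swapIndices (h : S.swapIndices.Classified) : S.Classified := by
  refine h.imp Trivial.of_swapIndices (.imp ?_ (.imp ?_ (.imp ?_ (.imp ?_ (.imp ?_ (.imp ?_ ?_))))))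
  · simp only [Underdetermined, numEquations_swapIndices, numUnknowns_swapIndices,
      numGauge_swapIndices, imp_self]
  · simp only [Overdetermined, numEquations_swapIndices, numUnknowns_swapIndices,
      numGauge_swapIndices]
    exact Or.imp_right fun h t ht => h _ ((system_swapIndices t).2 ht)
  · exact fun h lam hlam => (h lam hlam).of_swapIndices
  · exact fun h lam mu hlam hmu => (h lam mu hlam hmu).of_swapIndices
  · exact ReducibleTo.of_swapIndices
  · exact fun h mu hmu => (h mu hmu).of_swapIndices
  · exact ReducibleTo.of_swapIndices

theorem Classified.of_exchange (h : S.exchange.Classified) : S.Classified := by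
  refine h.imp Trivial.of_exchange (.imp ?_ (.imp ?_ (.imp ?_ (.imp ?_ (.imp ?_ (.imp ?_ ?_))))))
  · simp only [Underdetermined, numEquations_exchange, numUnknowns_exchange,
      numGauge_exchange, imp_self]
  · simp only [Overdetermined, numEquations_exchange, numUnknowns_exchange,
      numGauge_exchange]
    exact Or.imp_right fun h t ht => h _ ((system_exchange t).2 ht)
  · exact fun h lam hlam => (h lam hlam).of_exchange
  · exact fun h lam mu hlam hmu => (h lam mu hlam hmu).of_exchange
  · exact ReducibleTo.of_exchange
  · exact fun h mu hmu => (h mu hmu).of_exchange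
  · exact ReducibleTo.of_exchange

theorem System.entry_eq {t : LaxTerms} (ht : S.System t) (i j : Fin 2) (l m : ℤ) {ν : ℂ}
    (hν : ν ∈ S.U) :
    t.L i 0 l (m + 1) * t.M 0 j l m * (S.L i 0 ν * S.M 0 j ν) +
      t.L i 1 l (m + 1) * t.M 1 j l m * (S.L i 1 ν * S.M 1 j ν) =
    t.M i 0 (l + 1) m * t.L 0 j l m * (S.M i 0 ν * S.L 0 j ν) +
      t.M i 1 (l + 1) m * t.L 1 j l m * (S.M i 1 ν * S.L 1 j ν) := by
  have h := congrFun (congrFun (ht.2 l m ν hν) i) j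
  simp only [laxL, laxM, Matrix.mul_apply, Fin.sum_univ_two, Matrix.of_apply] at h
  linear_combination h

theorem System.entry {t : LaxTerms} (ht : S.System t) (i j : Fin 2) : S.Entry i j t :=
  (entry_iff i j t).2 fun l m _ hν => ht.entry_eq i j l m hν

theorem multiplicativelyLinear_of_entries (h00 : S.HasMonomialForm (S.Entry 0 0))
    (h01 : S.HasMonomialForm (S.Entry 0 1)) (h10 : S.HasMonomialForm (S.Entry 1 0))
    (h11 : S.HasMonomialForm (S.Entry 1 1)) : S.MultiplicativelyLinear :=
  ((h00.and h01).and (h10.and h11)).congr fun t ht => by rw [system_iff, and_iff_right ht]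

/-! ### Lax pairs with an off-diagonal zero term -/

/-- If `B` is a zero term and `C`, `Ξ` are not, then solvability forces all diagonal spectral
factors of either matrix to be proportional. The system is the degenerate sine-Gordon equation if
`Γ` is a zero term as well, and otherwise a degenerate form of LSG₂ or underdetermined. -/
theorem classified_of_B_eq_zero_of_ne {t : LaxTerms} (ht : S.System t)
    (hB : ∀ ν ∈ S.U, S.L 0 1 ν = 0) (hC : S.NonzeroL 1 0) (hΞ : S.NonzeroM 0 1) :
    S.Classified := by
  have hCΞ0 := S.exists_mul_ne_zero (S.analyticL 1 0) (S.analyticM 0 1) hC hΞ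
  have hAΛ : ProportionalOn S.U (fun ν => S.L 1 0 ν * S.M 0 1 ν)
      fun ν => S.L 0 0 ν * S.M 0 0 ν := by
    refine .of_relation (c := t.M 0 1 (0 + 1) 0 * t.L 1 0 0 0)
      (d := t.L 0 0 0 (0 + 1) * t.M 0 0 0 0 - t.M 0 0 (0 + 1) 0 * t.L 0 0 0 0) hCΞ0
      (mul_ne_zero ((ht.1.2 _ _ _ _).2 hΞ) ((ht.1.1 _ _ _ _).2 hC)) fun ν hν => ?_
    have e := ht.entry_eq 0 0 0 0 hν
    rw [hB ν hν] at e
    linear_combination -e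
  have hDΔ : ProportionalOn S.U (fun ν => S.L 1 0 ν * S.M 0 1 ν)
      fun ν => S.L 1 1 ν * S.M 1 1 ν := by
    refine .of_relation (c := t.L 1 0 0 (0 + 1) * t.M 0 1 0 0)
      (d := t.M 1 1 (0 + 1) 0 * t.L 1 1 0 0 - t.L 1 1 0 (0 + 1) * t.M 1 1 0 0) hCΞ0
      (mul_ne_zero ((ht.1.1 _ _ _ _).2 hC) ((ht.1.2 _ _ _ _).2 hΞ)) fun ν hν => ?_
    have e := ht.entry_eq 1 1 0 0 hν
    rw [hB ν hν] at e
    linear_combination e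
  obtain ⟨hA, hΛ⟩ := exists_ne_zero_of_mul (hAΛ.exists_ne_zero hCΞ0)
  obtain ⟨hD, hΔ⟩ := exists_ne_zero_of_mul (hDΔ.exists_ne_zero hCΞ0)
  have hAD : ProportionalOn S.U (S.L 0 0) (S.L 1 1) := by
    refine S.proportionalOn_of_mul_left (S.analyticL 0 0) (S.analyticL 1 1) (S.analyticM 0 1) hΞ
      (.of_relation (c := t.L 0 0 0 (0 + 1) * t.M 0 1 0 0) (d := t.M 0 1 (0 + 1) 0 * t.L 1 1 0 0)
      (S.exists_mul_ne_zero (S.analyticM 0 1) (S.analyticL 0 0) hΞ hA)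
      (mul_ne_zero ((ht.1.1 _ _ _ _).2 hA) ((ht.1.2 _ _ _ _).2 hΞ)) fun ν hν => ?_)
    have e := ht.entry_eq 0 1 0 0 hν
    rw [hB ν hν] at e
    linear_combination e
  have hΛΔ : ProportionalOn S.U (S.M 0 0) (S.M 1 1) :=
    S.proportionalOn_of_mul_left (S.analyticM 0 0) (S.analyticM 1 1) (S.analyticL 0 0) hA
      ((hAΛ.symm.trans hDΔ).trans (hAD.symm.mul (.refl _ _)))
  have hL : ∀ i j, (i, j) ≠ (0, 1) → S.NonzeroL i j := by
    simp only [Fin.forall_fin_two]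
    exact ⟨⟨fun _ => hA, fun h => absurd rfl h⟩, fun _ => hC, fun _ => hD⟩
  obtain hΓ | hΓ := eqOn_zero_or_exists S.U (S.M 1 0)
  · iterate 7 right
    refine reducibleTo_LSG hL ?_ hB hΓ hAD.symm hΛΔ.symm hAΛ
    simp only [Fin.forall_fin_two]
    exact ⟨⟨fun _ => hΛ, fun _ => hΞ⟩, fun h => absurd rfl h, fun _ => hΔ⟩
  · have hM : ∀ i j, S.NonzeroM i j := by
      simp only [Fin.forall_fin_two]
      exact ⟨⟨hΛ, hΞ⟩, hΓ, hΔ⟩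
    have hB' : ¬ S.NonzeroL 0 1 := fun ⟨ν, hν, hne⟩ => hne (hB ν hν)
    by_cases hp : ProportionalOn S.U (fun ν => S.L 1 0 ν * S.M 0 0 ν)
      fun ν => S.L 0 0 ν * S.M 1 0 ν
    · right; left
      obtain ⟨p, -, ep⟩ := hAΛ
      obtain ⟨q, -, eq⟩ := hDΔ
      obtain ⟨r, -, er⟩ := hAD
      obtain ⟨s, -, es⟩ := hΛΔ
      obtain ⟨u, hu, eu⟩ := hp
      have h00 : S.entryRank 0 0 ≤ 1 := entryRank_le_one (fun ν => S.L 0 0 ν * S.M 0 0 ν) <| by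
        simp only [Fin.forall_fin_two]
        exact ⟨⟨⟨1, fun ν _ => by ring⟩, 1, fun ν _ => by ring⟩,
          ⟨0, fun ν hν => by rw [hB ν hν]; ring⟩, p, fun ν hν => by linear_combination ep ν hν⟩
      have h01 : S.entryRank 0 1 ≤ 1 := entryRank_le_one (fun ν => S.L 1 1 ν * S.M 0 1 ν) <| by
        simp only [Fin.forall_fin_two]
        exact ⟨⟨⟨r, fun ν hν => by rw [er ν hν]; ring⟩, 0, fun ν hν => by rw [hB ν hν]; ring⟩,
          ⟨0, fun ν hν => by rw [hB ν hν]; ring⟩, 1, fun ν _ => by ring⟩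
      have h10 : S.entryRank 1 0 ≤ 1 := by
        refine entryRank_le_one (fun ν => S.L 1 1 ν * S.M 1 0 ν) ?_
        simp only [Fin.forall_fin_two]
        refine ⟨⟨⟨u * r, fun ν hν => by linear_combination eu ν hν + u * S.M 1 0 ν * er ν hν⟩,
          r, fun ν hν => by rw [er ν hν]; ring⟩, ⟨1, fun ν _ => by ring⟩, s⁻¹ * (u * r),
          fun ν hν => ?_⟩
        have hs : s ≠ 0 := by
          rintro rfl
          obtain ⟨ν, hν, hne⟩ := hΛ
          exact hne (by rw [es ν hν, zero_mul])
        field_simp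
        linear_combination eu ν hν + u * S.M 1 0 ν * er ν hν - S.L 1 0 ν * es ν hν
      have h11 : S.entryRank 1 1 ≤ 1 := by
        refine entryRank_le_one (fun ν => S.L 1 1 ν * S.M 1 1 ν) ?_
        simp only [Fin.forall_fin_two]
        exact ⟨⟨⟨q, eq⟩, 0, fun ν hν => by rw [hB ν hν]; ring⟩, ⟨1, fun ν _ => by ring⟩,
          1, fun ν _ => by ring⟩
      have hN : S.numUnknowns = 7 := by
        rw [numUnknowns_eq]
        simp [hM, hL, hB']
      have := S.numGauge_le
      rw [Underdetermined, numEquations_eq]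
      lia
    · iterate 6 right
      left
      exact fun mu hmu => reducibleTo_LSG2 hmu hL hM (.inr ⟨hB', rfl⟩) hAD.symm hΛΔ.symm hAΛ
        (.inl hB) (.inl hB) (independentOn_of_not_proportionalOn
          (S.exists_mul_ne_zero (S.analyticL 1 0) (S.analyticM 0 0) hC hΛ)
          (S.exists_mul_ne_zero (S.analyticL 0 0) (S.analyticM 1 0) hA hΓ) hp)

/-- If both matrices are lower triangular without zero terms on the diagonal, then the diagonal
lattice factors can be removed by a gauge transformation. -/
theorem additivelyLinear_of_lowerTriangular (hB : ∀ ν ∈ S.U, S.L 0 1 ν = 0)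
    (hΞ : ∀ ν ∈ S.U, S.M 0 1 ν = 0) (hA : S.NonzeroL 0 0) (hD : S.NonzeroL 1 1)
    (hΛ : S.NonzeroM 0 0) (hΔ : S.NonzeroM 1 1) : S.AdditivelyLinear := by
  refine ⟨fun t ht => ?_, ⟨⟨⟨{x | ∀ l m, ∀ ν ∈ S.U,
      x.1 1 0 l (m + 1) * (S.L 1 0 ν * S.M 0 0 ν) + x.2 1 0 l m * (S.L 1 1 ν * S.M 1 0 ν) =
      x.2 1 0 (l + 1) m * (S.M 1 0 ν * S.L 0 0 ν) + x.1 1 0 l m * (S.M 1 1 ν * S.L 1 0 ν)},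
      ?_⟩, ?_⟩, ?_⟩, fun t hadm hu => ?_⟩
  · have ha (l m) : t.L 0 0 l m ≠ 0 := (ht.1.1 _ _ _ _).2 hA
    have hd (l m) : t.L 1 1 l m ≠ 0 := (ht.1.1 _ _ _ _).2 hD
    have hα (l m) : t.M 0 0 l m ≠ 0 := (ht.1.2 _ _ _ _).2 hΛ
    have hδ (l m) : t.M 1 1 l m ≠ 0 := (ht.1.2 _ _ _ _).2 hΔ
    have e0 (l m) : t.L 0 0 l (m + 1) * t.M 0 0 l m = t.M 0 0 (l + 1) m * t.L 0 0 l m := by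
      obtain ⟨ν, hν, hne⟩ := S.exists_mul_ne_zero (S.analyticL 0 0) (S.analyticM 0 0) hA hΛ
      have e := ht.entry_eq 0 0 l m hν
      rw [hB ν hν, hΞ ν hν] at e
      exact mul_right_cancel₀ hne (by linear_combination e)
    have e1 (l m) : t.L 1 1 l (m + 1) * t.M 1 1 l m = t.M 1 1 (l + 1) m * t.L 1 1 l m := by
      obtain ⟨ν, hν, hne⟩ := S.exists_mul_ne_zero (S.analyticL 1 1) (S.analyticM 1 1) hD hΔ
      have e := ht.entry_eq 1 1 l m hν
      rw [hB ν hν, hΞ ν hν] at e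
      exact mul_right_cancel₀ hne (by linear_combination e)
    obtain ⟨g, hg, eg⟩ := exists_multiplicative_flow (Equiv.refl (Fin 2)) (Equiv.refl _)
      ![fun l m => (t.L 0 0 l m)⁻¹, fun l m => (t.L 1 1 l m)⁻¹]
      ![fun l m => (t.M 0 0 l m)⁻¹, fun l m => (t.M 1 1 l m)⁻¹]
      (by simp [Fin.forall_fin_two, Nonvanishing, ha, hd])
      (by simp [Fin.forall_fin_two, Nonvanishing, hα, hδ]) (fun _ => rfl) (by
        simp only [Fin.forall_fin_two, Equiv.refl_apply, Matrix.cons_val_zero, Matrix.cons_val_one,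
          ← mul_inv, e0, e1, implies_true, and_self])
    simp only [Fin.forall_fin_two, Equiv.refl_apply, Matrix.cons_val_zero,
      Matrix.cons_val_one] at eg
    refine ⟨g, hg, ?_⟩
    simp only [LaxTerms.UnitDiagonal, Fin.forall_fin_two, LaxTerms.gauge, Matrix.of_apply, eg]
    refine ⟨fun l m => ?_, fun l m => ?_⟩
    · have := hg 0 l m
      have := ha l m
      have := hα l m
      constructor <;> field_simp
    · have := hg 1 l m
      have := hd l m
      have := hδ l m
      constructor <;> field_simp
  · intro x y hx hy l m ν hν
    have h1 := hx l m ν hν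
    have h2 := hy l m ν hν
    simp only [Prod.fst_add, Prod.snd_add, Matrix.add_apply, Pi.add_apply]
    linear_combination h1 + h2
  · intro l m ν _
    simp
  · intro c x hx l m ν hν
    have h1 := hx l m ν hν
    simp only [Prod.smul_fst, Prod.smul_snd, Matrix.smul_apply, Pi.smul_apply, smul_eq_mul]
    linear_combination c * h1
  · change S.System t ↔ ∀ l m, ∀ ν ∈ S.U, _
    simp only [system_iff, and_iff_right hadm, entry_iff, ← forall_and]
    refine forall₂_congr fun l m => forall₂_congr fun ν hν => ?_
    have hu0 (l m) := hu 0 l m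
    have hu1 (l m) := hu 1 l m
    simp [hB ν hν, hΞ ν hν, hu0, hu1, LaxTerms.offDiagonal, mul_comm (S.M 0 0 ν),
      mul_comm (S.M 1 1 ν)]

theorem underdetermined_of_lowerTriangular (hB : ∀ ν ∈ S.U, S.L 0 1 ν = 0)
    (hΞ : ∀ ν ∈ S.U, S.M 0 1 ν = 0)
    (hz : (∀ ν ∈ S.U, S.L 0 0 ν * S.M 0 0 ν = 0) ∨ ∀ ν ∈ S.U, S.L 1 1 ν * S.M 1 1 ν = 0)
    (h10 : S.entryRank 1 0 ≤ 1) (hN : S.numUnknowns = 5) : S.Underdetermined := by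
  have h01 : S.entryRank 0 1 = 0 := entryRank_eq_zero <| by
    simp +contextual [Fin.forall_fin_two, hB, hΞ]
  have h00 : S.entryRank 0 0 ≤ 1 := entryRank_le_one (fun ν => S.L 0 0 ν * S.M 0 0 ν) <| by
    simp only [Fin.forall_fin_two]
    exact ⟨⟨⟨1, fun ν _ => by ring⟩, 1, fun ν _ => by ring⟩,
      ⟨0, fun ν hν => by rw [hB ν hν]; ring⟩, 0, fun ν hν => by rw [hΞ ν hν]; ring⟩
  have h11 : S.entryRank 1 1 ≤ 1 := entryRank_le_one (fun ν => S.L 1 1 ν * S.M 1 1 ν) <| by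
    simp only [Fin.forall_fin_two]
    exact ⟨⟨⟨0, fun ν hν => by rw [hΞ ν hν]; ring⟩, 0, fun ν hν => by rw [hB ν hν]; ring⟩,
      ⟨1, fun ν _ => by ring⟩, 1, fun ν _ => by ring⟩
  have hz' : S.entryRank 0 0 = 0 ∨ S.entryRank 1 1 = 0 := by
    refine hz.imp (fun h => entryRank_eq_zero ?_) fun h => entryRank_eq_zero ?_
    · simp only [Fin.forall_fin_two]
      exact ⟨⟨h, fun ν hν => by rw [mul_comm, h ν hν]⟩, fun ν hν => by rw [hB ν hν, zero_mul],
        fun ν hν => by rw [hΞ ν hν, zero_mul]⟩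
    · simp only [Fin.forall_fin_two]
      exact ⟨⟨fun ν hν => by rw [hΞ ν hν, mul_zero], fun ν hν => by rw [hB ν hν, mul_zero]⟩, h,
        fun ν hν => by rw [mul_comm, h ν hν]⟩
  have := S.numGauge_le
  rw [Underdetermined, numEquations_eq]
  lia

open Classical in
/-- If both matrices are lower triangular, then only entry `(1, 0)` can have more than two terms.
The system is additively linear if no diagonal term is zero; otherwise that entry has at most three
terms, and the system is multiplicatively linear or underdetermined. -/
theorem classified_of_lowerTriangular {t : LaxTerms} (ht : S.System t)
    (hB : ∀ ν ∈ S.U, S.L 0 1 ν = 0) (hΞ : ∀ ν ∈ S.U, S.M 0 1 ν = 0) : S.Classified := by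
  have h00 : S.HasMonomialForm (S.Entry 0 0) := .entry_of_two_terms (true, 0) (false, 0) (by simp)
    (termSpec_eq_zero (by simp +contextual [Fin.forall_fin_two, hB, hΞ])) ht.1 (ht.entry 0 0)
  have h01 : S.HasMonomialForm (S.Entry 0 1) := .entry_of_two_terms (true, 0) (false, 0) (by simp)
    (termSpec_eq_zero (by simp +contextual [Fin.forall_fin_two, hB, hΞ])) ht.1 (ht.entry 0 1)
  have h11 : S.HasMonomialForm (S.Entry 1 1) := .entry_of_two_terms (true, 1) (false, 1) (by simp)
    (termSpec_eq_zero (by simp +contextual [Fin.forall_fin_two, hB, hΞ])) ht.1 (ht.entry 1 1)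
  have hB' : ¬ S.NonzeroL 0 1 := fun ⟨ν, hν, hne⟩ => hne (hB ν hν)
  have hΞ' : ¬ S.NonzeroM 0 1 := fun ⟨ν, hν, hne⟩ => hne (hΞ ν hν)
  -- If a diagonal term is zero, then entry `(1, 0)` has at most three terms.
  have three (u v w x : Bool × Fin 2) (huv : u ≠ v) (huw : u ≠ w) (hvw : v ≠ w)
      (huvw : ∀ y, y ≠ u → y ≠ v → y ≠ w → y = x) (hx : ∀ ν ∈ S.U, S.termSpec 1 0 x ν = 0)
      (hz : (∀ ν ∈ S.U, S.L 0 0 ν * S.M 0 0 ν = 0) ∨ ∀ ν ∈ S.U, S.L 1 1 ν * S.M 1 1 ν = 0)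
      (hN : (∃ ν ∈ S.U, S.termSpec 1 0 u ν ≠ 0) → (∃ ν ∈ S.U, S.termSpec 1 0 v ν ≠ 0) →
        (∃ ν ∈ S.U, S.termSpec 1 0 w ν ≠ 0) → S.numUnknowns = 5) : S.Classified := by
    obtain h | ⟨hw, hu, hv⟩ := HasMonomialForm.entry_of_three_terms u v w huv huw hvw
      (fun y h1 h2 h3 => huvw y h1 h2 h3 ▸ hx) ht.1 (ht.entry 1 0)
    · exact .inl (.inl (multiplicativelyLinear_of_entries h00 h01 h h11))
    · refine .inr (.inl (underdetermined_of_lowerTriangular hB hΞ hz ?_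
        (hN (hu.symm.exists_ne_zero hw) (hv.symm.exists_ne_zero hw) hw)))
      have key (y : Bool × Fin 2) :
          ∃ c : ℂ, ∀ ν ∈ S.U, S.termSpec 1 0 y ν = c * S.termSpec 1 0 w ν := by
        by_cases h1 : y = u
        · obtain ⟨k, -, e⟩ := hu
          exact ⟨k, h1 ▸ e⟩
        by_cases h2 : y = v
        · obtain ⟨k, -, e⟩ := hv
          exact ⟨k, h2 ▸ e⟩
        by_cases h3 : y = w
        · exact ⟨1, fun ν _ => by rw [h3, one_mul]⟩
        · exact ⟨0, fun ν hν => by rw [huvw y h1 h2 h3, hx ν hν, zero_mul]⟩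
      exact entryRank_le_one (S.termSpec 1 0 w) fun k => ⟨key (true, k), key (false, k)⟩
  obtain hC | hC := eqOn_zero_or_exists S.U (S.L 1 0)
  · exact .inl (.inl (multiplicativelyLinear_of_entries h00 h01 (.entry_of_two_terms (true, 1)
      (false, 0) (by simp) (termSpec_eq_zero (by simp +contextual [Fin.forall_fin_two, hC]))
      ht.1 (ht.entry 1 0)) h11))
  obtain hΓ | hΓ := eqOn_zero_or_exists S.U (S.M 1 0)
  · exact .inl (.inl (multiplicativelyLinear_of_entries h00 h01 (.entry_of_two_terms (true, 0)
      (false, 1) (by simp) (termSpec_eq_zero (by simp +contextual [Fin.forall_fin_two, hΓ]))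
      ht.1 (ht.entry 1 0)) h11))
  have zero_not {f : ℂ → ℂ} (hf : ∀ ν ∈ S.U, f ν = 0) : ¬ ∃ ν ∈ S.U, f ν ≠ 0 :=
    fun ⟨ν, hν, hne⟩ => hne (hf ν hν)
  have count {a b c d : Prop} (hA : S.NonzeroL 0 0 ↔ a) (hD : S.NonzeroL 1 1 ↔ b)
      (hΛ : S.NonzeroM 0 0 ↔ c) (hΔ : S.NonzeroM 1 1 ↔ d) : S.numUnknowns =
        (if a then 1 else 0) + 1 + (if b then 1 else 0) + (if c then 1 else 0) + 1 +
        (if d then 1 else 0) := by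
    simp only [numUnknowns_eq, hA, hB', hD, hΛ, hΞ', hΔ, show S.NonzeroL 1 0 from hC,
      show S.NonzeroM 1 0 from hΓ, if_true, if_false, add_zero]
  obtain hA | hA := eqOn_zero_or_exists S.U (S.L 0 0)
  · refine three (true, 0) (true, 1) (false, 1) (false, 0) (by simp) (by simp) (by simp) (by decide)
      (fun ν hν => by simp [termSpec, hA ν hν]) (.inl fun ν hν => by simp [hA ν hν])
      fun h1 h2 h3 => ?_
    rw [count (iff_false_intro (zero_not hA)) (iff_true_intro (exists_ne_zero_of_mul h2).1)
      (iff_true_intro (exists_ne_zero_of_mul h1).2) (iff_true_intro (exists_ne_zero_of_mul h3).1)]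
    simp
  obtain hD | hD := eqOn_zero_or_exists S.U (S.L 1 1)
  · refine three (true, 0) (false, 0) (false, 1) (true, 1) (by simp) (by simp) (by simp) (by decide)
      (fun ν hν => by simp [termSpec, hD ν hν]) (.inr fun ν hν => by simp [hD ν hν])
      fun h1 h2 h3 => ?_
    rw [count (iff_true_intro hA) (iff_false_intro (zero_not hD))
      (iff_true_intro (exists_ne_zero_of_mul h1).2) (iff_true_intro (exists_ne_zero_of_mul h3).1)]
    simp
  obtain hΛ | hΛ := eqOn_zero_or_exists S.U (S.M 0 0)
  · refine three (true, 1) (false, 0) (false, 1) (true, 0) (by simp) (by simp) (by simp) (by decide)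
      (fun ν hν => by simp [termSpec, hΛ ν hν]) (.inl fun ν hν => by simp [hΛ ν hν])
      fun h1 h2 h3 => ?_
    rw [count (iff_true_intro hA) (iff_true_intro hD)
      (iff_false_intro (zero_not hΛ)) (iff_true_intro (exists_ne_zero_of_mul h3).1)]
    simp
  obtain hΔ | hΔ := eqOn_zero_or_exists S.U (S.M 1 1)
  · refine three (true, 0) (true, 1) (false, 0) (false, 1) (by simp) (by simp) (by simp) (by decide)
      (fun ν hν => by simp [termSpec, hΔ ν hν]) (.inr fun ν hν => by simp [hΔ ν hν])
      fun h1 h2 h3 => ?_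
    rw [count (iff_true_intro hA) (iff_true_intro hD)
      (iff_true_intro hΛ) (iff_false_intro (zero_not hΔ))]
    simp
  exact .inl (.inr (additivelyLinear_of_lowerTriangular hB hΞ hA hD hΛ hΔ))

theorem classified_of_B_eq_zero {t : LaxTerms} (ht : S.System t) (hB : ∀ ν ∈ S.U, S.L 0 1 ν = 0) :
    S.Classified := by
  obtain hΞ | hΞ := eqOn_zero_or_exists S.U (S.M 0 1)
  · exact classified_of_lowerTriangular ht hB hΞ
  obtain hC | hC := eqOn_zero_or_exists S.U (S.L 1 0)
  · refine .inl (.inl (multiplicativelyLinear_of_entries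
      (.entry_of_two_terms (true, 0) (false, 0) (by simp) (termSpec_eq_zero ?_) ht.1
        (ht.entry 0 0))
      (.entry_of_two_terms (true, 0) (false, 1) (by simp) (termSpec_eq_zero ?_) ht.1
        (ht.entry 0 1))
      (.entry_of_two_terms (true, 1) (false, 0) (by simp) (termSpec_eq_zero ?_) ht.1
        (ht.entry 1 0))
      (.entry_of_two_terms (true, 1) (false, 1) (by simp) (termSpec_eq_zero ?_) ht.1
        (ht.entry 1 1)))) <;>
    simp +contextual [Fin.forall_fin_two, hB, hC]
  · exact classified_of_B_eq_zero_of_ne ht hB hC hΞ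

/-! ### Lax pairs with diagonal zero terms only -/

/-- If `A` or `Λ` is a zero term and `D` or `Δ` is one, then every entry of the compatibility
condition has at most two terms. -/
theorem classified_of_diagonal_products_eq_zero {t : LaxTerms} (ht : S.System t)
    (hAΛ : (∀ ν ∈ S.U, S.L 0 0 ν = 0) ∨ ∀ ν ∈ S.U, S.M 0 0 ν = 0)
    (hDΔ : (∀ ν ∈ S.U, S.L 1 1 ν = 0) ∨ ∀ ν ∈ S.U, S.M 1 1 ν = 0) : S.Classified := by
  have main (u v u' v' : Bool × Fin 2) (huv : u ≠ v) (huv' : u' ≠ v')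
      (h : ∀ w, w ≠ u → w ≠ v → ∀ ν ∈ S.U, S.termSpec 0 1 w ν = 0)
      (h' : ∀ w, w ≠ u' → w ≠ v' → ∀ ν ∈ S.U, S.termSpec 1 0 w ν = 0) : S.Classified := by
    refine .inl (.inl (multiplicativelyLinear_of_entries
      (.entry_of_two_terms (true, 1) (false, 1) (by simp) (termSpec_eq_zero ?_) ht.1
        (ht.entry 0 0))
      (.entry_of_two_terms u v huv h ht.1 (ht.entry 0 1))
      (.entry_of_two_terms u' v' huv' h' ht.1 (ht.entry 1 0))
      (.entry_of_two_terms (true, 0) (false, 0) (by simp) (termSpec_eq_zero ?_) ht.1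
        (ht.entry 1 1))))
    · obtain hz | hz := hAΛ <;> simp +contextual [Fin.forall_fin_two, hz]
    · obtain hz | hz := hDΔ <;> simp +contextual [Fin.forall_fin_two, hz]
  obtain hA | hΛ := hAΛ <;> obtain hD | hΔ := hDΔ
  · refine main (true, 1) (false, 0) (true, 0) (false, 1) (by simp) (by simp)
      (termSpec_eq_zero ?_) (termSpec_eq_zero ?_) <;>
    simp +contextual [Fin.forall_fin_two, hA, hD]
  · refine main (false, 0) (false, 1) (true, 0) (true, 1) (by simp) (by simp)
      (termSpec_eq_zero ?_) (termSpec_eq_zero ?_) <;>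
    simp +contextual [Fin.forall_fin_two, hA, hΔ]
  · refine main (true, 0) (true, 1) (false, 0) (false, 1) (by simp) (by simp)
      (termSpec_eq_zero ?_) (termSpec_eq_zero ?_) <;>
    simp +contextual [Fin.forall_fin_two, hΛ, hD]
  · refine main (true, 0) (false, 1) (true, 1) (false, 0) (by simp) (by simp)
      (termSpec_eq_zero ?_) (termSpec_eq_zero ?_) <;>
    simp +contextual [Fin.forall_fin_two, hΛ, hΔ]

/-- If `D` and `Δ` are zero terms, but `A`, `C`, `Λ`, `Ξ` are not, then the other three entries of
the compatibility condition imply that the two terms with the product `AΛ` in entry `(0, 0)` cancel,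
so that all equations have two terms only. -/
theorem multiplicativelyLinear_of_D_Δ_eq_zero {t : LaxTerms} (ht : S.System t)
    (hA : S.NonzeroL 0 0) (hC : S.NonzeroL 1 0) (hD : ∀ ν ∈ S.U, S.L 1 1 ν = 0)
    (hΛ : S.NonzeroM 0 0) (hΞ : S.NonzeroM 0 1) (hΔ : ∀ ν ∈ S.U, S.M 1 1 ν = 0) :
    S.MultiplicativelyLinear := by
  have h01 : S.HasMonomialForm (S.Entry 0 1) := .entry_of_two_terms (true, 0) (false, 0) (by simp)
    (termSpec_eq_zero (by simp +contextual [Fin.forall_fin_two, hD, hΔ])) ht.1 (ht.entry 0 1)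
  have h10 : S.HasMonomialForm (S.Entry 1 0) := .entry_of_two_terms (true, 0) (false, 0) (by simp)
    (termSpec_eq_zero (by simp +contextual [Fin.forall_fin_two, hD, hΔ])) ht.1 (ht.entry 1 0)
  have h11 : S.HasMonomialForm (S.Entry 1 1) := .entry_of_two_terms (true, 0) (false, 0) (by simp)
    (termSpec_eq_zero (by simp +contextual [Fin.forall_fin_two, hD, hΔ])) ht.1 (ht.entry 1 1)
  have hAΛ0 := S.exists_mul_ne_zero (S.analyticL 0 0) (S.analyticM 0 0) hA hΛ
  have cancel {t : LaxTerms} (ht : S.System t) (l m : ℤ) :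
      t.L 0 0 l (m + 1) * t.M 0 0 l m = 1 * (t.M 0 0 (l + 1) m * t.L 0 0 l m) := by
    obtain ⟨ν, hν, hne⟩ := S.exists_mul_ne_zero ((S.analyticL 1 0).mul (S.analyticM 0 1))
      ((S.analyticL 0 0).mul (S.analyticM 0 0))
      (S.exists_mul_ne_zero (S.analyticL 1 0) (S.analyticM 0 1) hC hΞ) hAΛ0
    change S.L 1 0 ν * S.M 0 1 ν * (S.L 0 0 ν * S.M 0 0 ν) ≠ 0 at hne
    have e1 := ht.entry_eq 0 1 l m hν
    have e2 := ht.entry_eq 1 0 l m hν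
    have e3 := ht.entry_eq 1 1 l m hν
    simp only [hD ν hν, hΔ ν hν, mul_zero, zero_mul, add_zero] at e1 e2 e3
    have hc : t.L 1 0 l (m + 1) * t.M 0 1 l m ≠ 0 :=
      mul_ne_zero ((ht.1.1 _ _ _ _).2 hC) ((ht.1.2 _ _ _ _).2 hΞ)
    refine mul_right_cancel₀ (mul_ne_zero hc hne) ?_
    linear_combination t.L 1 0 l (m + 1) * t.M 0 0 l m * S.L 1 0 ν * S.M 0 0 ν * e1 +
      t.M 0 0 (l + 1) m * t.L 0 1 l m * S.M 0 0 ν * S.L 0 1 ν * e2 -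
      t.M 0 0 (l + 1) m * t.L 0 0 l m * S.M 0 0 ν * S.L 0 0 ν * e3
  -- Entry `(0, 0)` without the terms that cancel.
  have h00 : S.HasMonomialForm fun t => ∀ l m, ∀ ν ∈ S.U,
      S.monomial t (S.termExp 0 0 (true, 1)) l m * S.termSpec 0 0 (true, 1) ν +
        -1 * (S.monomial t (S.termExp 0 0 (false, 1)) l m * S.termSpec 0 0 (false, 1) ν) = 0 := by
    refine .of_two_terms _ _ (by simp) (fun hf => factor_ne_zero ht.1 hf 0 0)
      (fun hf => factor_ne_zero ht.1 hf 0 0) fun ν hν => ?_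
    have e := ht.entry_eq 0 0 0 0 hν
    simp only [LaxTerms.factor, termSpec]
    linear_combination e - S.L 0 0 ν * S.M 0 0 ν * cancel ht 0 0
  refine ((((HasMonomialForm.of_eq (S.termExp 0 0 (true, 0)) (S.termExp 0 0 (false, 0))
    one_ne_zero).and h00).and h01).and (h10.and h11)).congr fun t hadm => ?_
  simp only [monomial_termExp, LaxTerms.factor, termSpec]
  constructor
  · intro ht
    refine ⟨⟨⟨cancel ht, fun l m ν hν => ?_⟩, ht.entry 0 1⟩, ht.entry 1 0, ht.entry 1 1⟩
    linear_combination ht.entry_eq 0 0 l m hν - S.L 0 0 ν * S.M 0 0 ν * cancel ht l m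
  · rintro ⟨⟨⟨h1, h2⟩, h3⟩, h4, h5⟩
    refine (system_iff t).2 ⟨hadm, ⟨(entry_iff _ _ _).2 fun l m ν hν => ?_, h3⟩, h4, h5⟩
    linear_combination h2 l m ν hν + S.L 0 0 ν * S.M 0 0 ν * h1 l m

/-- If `D` is the only zero term, then the system is degenerate LMKdV₂ unless the numbers of
equations and unknowns do not match. -/
theorem classified_of_D_eq_zero {t : LaxTerms} (ht : S.System t)
    (hL : ∀ i j, (i, j) ≠ (1, 1) → S.NonzeroL i j) (hM : ∀ i j, S.NonzeroM i j)
    (hD : ∀ ν ∈ S.U, S.L 1 1 ν = 0) : S.Classified := by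
  have hA := hL 0 0 (by simp)
  have hB := hL 0 1 (by simp)
  have hC := hL 1 0 (by simp)
  have hD' : ¬ S.NonzeroL 1 1 := fun ⟨ν, hν, hne⟩ => hne (hD ν hν)
  have hBΓ0 := S.exists_mul_ne_zero (S.analyticL 0 1) (S.analyticM 1 0) hB (hM 1 0)
  have hAΛ0 := S.exists_mul_ne_zero (S.analyticL 0 0) (S.analyticM 0 0) hA (hM 0 0)
  have hAΞ0 := S.exists_mul_ne_zero (S.analyticL 0 0) (S.analyticM 0 1) hA (hM 0 1)
  have hΛB0 := S.exists_mul_ne_zero (S.analyticM 0 0) (S.analyticL 0 1) (hM 0 0) hB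
  have hΓA0 := S.exists_mul_ne_zero (S.analyticM 1 0) (S.analyticL 0 0) (hM 1 0) hA
  have hCΛ0 := S.exists_mul_ne_zero (S.analyticL 1 0) (S.analyticM 0 0) hC (hM 0 0)
  have hN : S.numUnknowns = 7 := by
    rw [numUnknowns_eq]
    simp [hA, hB, hC, hM, hD']
  have hG : S.numGauge = 2 := numGauge_eq_two fun i => ⟨0, .inr (.inr (.inl (hM i 0)))⟩
  have h11 : ProportionalOn S.U (fun ν => S.L 0 1 ν * S.M 1 0 ν) fun ν =>
      S.L 1 0 ν * S.M 0 1 ν := by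
    refine .of_relation (c := t.M 1 0 (0 + 1) 0 * t.L 0 1 0 0)
      (d := t.L 1 0 0 (0 + 1) * t.M 0 1 0 0) hBΓ0
      (mul_ne_zero ((ht.1.2 _ _ _ _).2 (hM 1 0)) ((ht.1.1 _ _ _ _).2 hB)) fun ν hν => ?_
    have e := ht.entry_eq 1 1 0 0 hν
    rw [hD ν hν] at e
    linear_combination -e
  by_cases hp : ProportionalOn S.U (fun ν => S.L 0 0 ν * S.M 0 1 ν) (fun ν =>
    S.M 0 0 ν * S.L 0 1 ν) ∧ ProportionalOn S.U (S.M 1 1) (S.M 0 0)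
  · obtain ⟨h01, hΔΛ⟩ := hp
    by_cases hq : ProportionalOn S.U (fun ν => S.L 0 0 ν * S.M 0 0 ν) fun ν =>
      S.L 0 1 ν * S.M 1 0 ν
    · right; left
      obtain ⟨p, hp, ep⟩ := h01
      obtain ⟨q, hq, eq⟩ := hq
      obtain ⟨r, hr, er⟩ := h11
      obtain ⟨s, hs, es⟩ := hΔΛ
      have hAΓ : ∀ ν ∈ S.U, S.M 1 0 ν * S.L 0 0 ν - p * r * (S.L 1 0 ν * S.M 0 0 ν) = 0 := by
        refine S.eq_zero_of_mul_eq_zero (S.analyticM 0 1) (((S.analyticM 1 0).mul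
          (S.analyticL 0 0)).sub (analyticOnNhd_const.mul ((S.analyticL 1 0).mul
          (S.analyticM 0 0)))) (hM 0 1) fun ν hν => ?_
        linear_combination S.M 1 0 ν * ep ν hν + p * S.M 0 0 ν * er ν hν
      have h00 : S.entryRank 0 0 ≤ 1 := by
        refine entryRank_le_one (fun ν => S.L 0 1 ν * S.M 1 0 ν) ?_
        simp only [Fin.forall_fin_two]
        refine ⟨⟨⟨q, eq⟩, q, fun ν hν => by linear_combination eq ν hν⟩,
          ⟨1, fun ν _ => by ring⟩, r⁻¹, fun ν hν => ?_⟩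
        field_simp
        linear_combination -er ν hν
      have h01 : S.entryRank 0 1 ≤ 1 := by
        refine entryRank_le_one (fun ν => S.M 0 0 ν * S.L 0 1 ν) ?_
        simp only [Fin.forall_fin_two]
        exact ⟨⟨⟨p, ep⟩, 1, fun ν _ => by ring⟩,
          ⟨s, fun ν hν => by linear_combination S.L 0 1 ν * es ν hν⟩,
          0, fun ν hν => by rw [hD ν hν]; ring⟩
      have h10 : S.entryRank 1 0 ≤ 1 := by
        refine entryRank_le_one (fun ν => S.L 1 0 ν * S.M 0 0 ν) ?_
        simp only [Fin.forall_fin_two]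
        exact ⟨⟨⟨1, fun ν _ => by ring⟩, p * r, fun ν hν => by linear_combination hAΓ ν hν⟩,
          ⟨0, fun ν hν => by rw [hD ν hν]; ring⟩,
          s, fun ν hν => by linear_combination S.L 1 0 ν * es ν hν⟩
      have h11 : S.entryRank 1 1 ≤ 1 := by
        refine entryRank_le_one (fun ν => S.L 1 0 ν * S.M 0 1 ν) ?_
        simp only [Fin.forall_fin_two]
        exact ⟨⟨⟨1, fun ν _ => by ring⟩, r, fun ν hν => by linear_combination er ν hν⟩,
          ⟨0, fun ν hν => by rw [hD ν hν]; ring⟩, 0, fun ν hν => by rw [hD ν hν]; ring⟩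
      rw [Underdetermined, numEquations_eq]
      lia
    · iterate 5 right
      left
      refine reducibleTo_LMKdV2 hL hM (.inr ⟨hD, rfl⟩) hΔΛ ?_ h11
        (independentOn_of_not_proportionalOn hAΛ0 hBΓ0 hq)
      simpa only [mul_comm (S.M 0 0 _)] using h01
  · right; right; left; left
    have h00 : 1 ≤ S.entryRank 0 0 := one_le_entryRank (mul_LM_mem_products 0 0 0) hAΛ0
    have h11' : 1 ≤ S.entryRank 1 1 :=
      one_le_entryRank (f := fun ν => S.M 1 0 ν * S.L 0 1 ν) (mul_ML_mem_products 1 0 1)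
        (by simpa only [mul_comm] using hBΓ0)
    have h : 2 ≤ S.entryRank 0 1 ∧ 2 ≤ S.entryRank 1 0 := by
      rw [not_and_or] at hp
      obtain hp | hp := hp
      · refine ⟨two_le_entryRank_of_not_proportionalOn (mul_LM_mem_products 0 0 1)
          (mul_ML_mem_products 0 0 1) hAΞ0 hΛB0 hp,
          two_le_entryRank_of_not_proportionalOn (mul_ML_mem_products 1 0 0)
          (mul_LM_mem_products 1 0 0) hΓA0 hCΛ0 fun h => hp ?_⟩
        obtain ⟨q, hq, eq⟩ := h
        obtain ⟨r, hr, er⟩ := h11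
        refine S.proportionalOn_of_mul_left ((S.analyticL 0 0).mul (S.analyticM 0 1))
          ((S.analyticM 0 0).mul (S.analyticL 0 1)) (S.analyticM 1 0) (hM 1 0)
          ⟨q / r, div_ne_zero hq hr, fun ν hν => ?_⟩
        field_simp
        linear_combination r * S.M 0 1 ν * eq ν hν - q * S.M 0 0 ν * er ν hν
      · have h (f : ℂ → ℂ) (hf : AnalyticOnNhd ℂ f S.U) (hf0 : ∃ ν ∈ S.U, f ν ≠ 0) :
            ¬ ProportionalOn S.U (fun ν => f ν * S.M 1 1 ν) fun ν => f ν * S.M 0 0 ν := fun h =>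
          hp (S.proportionalOn_of_mul_left (S.analyticM 1 1) (S.analyticM 0 0) hf hf0 h)
        refine ⟨two_le_entryRank_of_not_proportionalOn (mul_LM_mem_products 0 1 1)
          (g := fun ν => S.L 0 1 ν * S.M 0 0 ν)
          (by simpa only [mul_comm] using mul_ML_mem_products (S := S) 0 0 1)
          (S.exists_mul_ne_zero (S.analyticL 0 1) (S.analyticM 1 1) hB (hM 1 1))
          (by simpa only [mul_comm] using hΛB0) (h _ (S.analyticL 0 1) hB),
          two_le_entryRank_of_not_proportionalOn (f := fun ν => S.L 1 0 ν * S.M 1 1 ν)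
          (by simpa only [mul_comm] using mul_ML_mem_products (S := S) 1 1 0)
          (mul_LM_mem_products 1 0 0)
          (S.exists_mul_ne_zero (S.analyticL 1 0) (S.analyticM 1 1) hC (hM 1 1)) hCΛ0
          (h _ (S.analyticL 1 0) hC)⟩
    rw [numEquations_eq]
    lia

end LaxSpectrum

/-! ### Lax pairs without zero terms -/

namespace LaxSpectrum

variable {S : LaxSpectrum}

/-- A binary quadratic form over `ℂ` that vanishes at a pair of independent analytic functions is
zero, because it splits into linear factors. -/
theorem quadratic_eq_zero {f g : ℂ → ℂ} (hf : AnalyticOnNhd ℂ f S.U) (hg : AnalyticOnNhd ℂ g S.U)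
    (hfg : IndependentOn S.U f g) (hg0 : ∃ ν ∈ S.U, g ν ≠ 0) {x y z : ℂ}
    (h : ∀ ν ∈ S.U, x * f ν ^ 2 + y * (f ν * g ν) + z * g ν ^ 2 = 0) : x = 0 ∧ y = 0 ∧ z = 0 := by
  obtain rfl | hx := eq_or_ne x 0
  · refine ⟨rfl, hfg y z (S.eq_zero_of_mul_eq_zero (g := fun ν => y * f ν + z * g ν) hg
      ((analyticOnNhd_const.mul hf).add (analyticOnNhd_const.mul hg)) hg0 fun ν hν => ?_)⟩
    linear_combination h ν hν
  · exfalso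
    obtain ⟨s, hs⟩ := IsAlgClosed.exists_pow_nat_eq (y ^ 2 - 4 * x * z) two_pos
    have an (w : ℂ) : AnalyticOnNhd ℂ (fun ν => 2 * x * f ν + w * g ν) S.U :=
      (analyticOnNhd_const.mul hf).add (analyticOnNhd_const.mul hg)
    have ne (w : ℂ) : ∃ ν ∈ S.U, 2 * x * f ν + w * g ν ≠ 0 := by
      by_contra! H
      exact hx (by simpa using (hfg (2 * x) w H).1)
    obtain ⟨ν, hν, hne⟩ := S.exists_mul_ne_zero (an (y - s)) (an (y + s)) (ne _) (ne _)
    exact hne (by linear_combination 4 * x * h ν hν - g ν ^ 2 * hs)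

/-- If `f A` and `f D` are combinations of `g Λ` and `g Δ`, and `A Λ` is a multiple of `D Δ`, then
`f A` is a multiple of `g Δ` and `f D` one of `g Λ`: elimination of `f`, `A` and `D` leaves a
quadratic relation between `Λ` and `Δ`, whose coefficients must vanish. -/
theorem proportionalOn_of_relations {f g A D Λ Δ : ℂ → ℂ} (hg : AnalyticOnNhd ℂ g S.U)
    (hΛ : AnalyticOnNhd ℂ Λ S.U) (hΔ : AnalyticOnNhd ℂ Δ S.U) (hg0 : ∃ ν ∈ S.U, g ν ≠ 0)
    (hΔ0 : ∃ ν ∈ S.U, Δ ν ≠ 0) (hi : IndependentOn S.U Λ Δ)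
    (hfA : ∃ ν ∈ S.U, f ν * A ν ≠ 0) (hfD : ∃ ν ∈ S.U, f ν * D ν ≠ 0)
    (h : ProportionalOn S.U (fun ν => A ν * Λ ν) fun ν => D ν * Δ ν)
    (h1 : ∃ p q : ℂ, ∀ ν ∈ S.U, f ν * A ν = p * (g ν * Λ ν) + q * (g ν * Δ ν))
    (h2 : ∃ p q : ℂ, ∀ ν ∈ S.U, f ν * D ν = p * (g ν * Λ ν) + q * (g ν * Δ ν)) :
    ProportionalOn S.U (fun ν => f ν * A ν) (fun ν => g ν * Δ ν) ∧
      ProportionalOn S.U (fun ν => f ν * D ν) (fun ν => g ν * Λ ν) := by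
  obtain ⟨k, hk, ek⟩ := h
  obtain ⟨p, q, e1⟩ := h1
  obtain ⟨p', q', e2⟩ := h2
  obtain ⟨rfl, -, hq'⟩ := quadratic_eq_zero hΛ hΔ hi hΔ0 (x := p) (y := q - k * p')
    (z := -(k * q')) (S.eq_zero_of_mul_eq_zero (g := fun ν =>
      p * Λ ν ^ 2 + (q - k * p') * (Λ ν * Δ ν) + -(k * q') * Δ ν ^ 2) hg
      (((analyticOnNhd_const.mul (hΛ.pow 2)).add (analyticOnNhd_const.mul (hΛ.mul hΔ))).add
        (analyticOnNhd_const.mul (hΔ.pow 2))) hg0 fun ν hν => by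
      linear_combination f ν * ek ν hν - Λ ν * e1 ν hν + k * Δ ν * e2 ν hν)
  obtain rfl : q' = 0 := by simpa [hk] using hq'
  exact ⟨.of_relation (c := 1) hfA one_ne_zero fun ν hν => by linear_combination e1 ν hν,
    .of_relation (c := 1) hfD one_ne_zero fun ν hν => by linear_combination e2 ν hν⟩

/-- If `M` is, up to constants, a multiple of the adjugate of `L` in its spectral dependence, then
the equations of the diagonal entries can be expressed by the determinant of `L` at a single
point of the spectral domain, and become multiplicatively linear. -/
theorem multiplicativelyLinear_of_adjugate
    (hL : ∀ i j, S.NonzeroL i j) (hM : ∀ i j, S.NonzeroM i j)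
    (hΛΔ : IndependentOn S.U (S.M 0 0) (S.M 1 1))
    (hΞA : ProportionalOn S.U (fun ν => S.M 0 1 ν * S.L 0 0 ν) fun ν => S.L 0 1 ν * S.M 1 1 ν)
    (hΞD : ProportionalOn S.U (fun ν => S.M 0 1 ν * S.L 1 1 ν) fun ν => S.L 0 1 ν * S.M 0 0 ν)
    (hΓA : ProportionalOn S.U (fun ν => S.M 1 0 ν * S.L 0 0 ν) fun ν => S.L 1 0 ν * S.M 1 1 ν)
    (hΓD : ProportionalOn S.U (fun ν => S.M 1 0 ν * S.L 1 1 ν) fun ν => S.L 1 0 ν * S.M 0 0 ν)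
    (hBΓ : ProportionalOn S.U (fun ν => S.L 0 1 ν * S.M 1 0 ν) fun ν => S.L 0 0 ν * S.M 0 0 ν)
    (hCΞ : ProportionalOn S.U (fun ν => S.L 1 0 ν * S.M 0 1 ν) fun ν => S.L 0 0 ν * S.M 0 0 ν)
    (hDΔ : ProportionalOn S.U (fun ν => S.L 1 1 ν * S.M 1 1 ν) fun ν => S.L 0 0 ν * S.M 0 0 ν) :
    S.MultiplicativelyLinear := by
  obtain ⟨p, hp, ep⟩ := hΞA
  obtain ⟨q, hq, eq⟩ := hΞD
  obtain ⟨r, hr, er⟩ := hΓA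
  obtain ⟨s, hs, es⟩ := hΓD
  obtain ⟨u, -, eu⟩ := hBΓ
  obtain ⟨v, -, ev⟩ := hCΞ
  obtain ⟨w, -, ew⟩ := hDΔ
  obtain ⟨ν₀, hν₀, hne⟩ := S.exists_mul_ne_zero ((S.analyticL 0 0).mul (S.analyticM 0 0))
    ((S.analyticL 1 1).mul (S.analyticM 1 1))
    (S.exists_mul_ne_zero (S.analyticL 0 0) (S.analyticM 0 0) (hL 0 0) (hM 0 0))
    (S.exists_mul_ne_zero (S.analyticL 1 1) (S.analyticM 1 1) (hL 1 1) (hM 1 1))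
  have hA0 : S.L 0 0 ν₀ ≠ 0 := left_ne_zero_of_mul (left_ne_zero_of_mul hne)
  have hΛ0 : S.M 0 0 ν₀ ≠ 0 := right_ne_zero_of_mul (left_ne_zero_of_mul hne)
  have hD0 : S.L 1 1 ν₀ ≠ 0 := left_ne_zero_of_mul (right_ne_zero_of_mul hne)
  have hΔ0 : S.M 1 1 ν₀ ≠ 0 := right_ne_zero_of_mul (right_ne_zero_of_mul hne)
  -- The diagonal entries amount to a single equation each, which may be read off at `ν₀`.
  -- A combination of the spectral products of the diagonal entries vanishes identically if it
  -- vanishes at `ν₀`.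
  have spread (x₁ x₂ x₃ x₄ : ℂ) (h : x₁ * (S.L 0 0 ν₀ * S.M 0 0 ν₀) +
      x₂ * (S.L 0 1 ν₀ * S.M 1 0 ν₀) + x₃ * (S.L 1 0 ν₀ * S.M 0 1 ν₀) +
      x₄ * (S.L 1 1 ν₀ * S.M 1 1 ν₀) = 0) : ∀ ν ∈ S.U, x₁ * (S.L 0 0 ν * S.M 0 0 ν) +
      x₂ * (S.L 0 1 ν * S.M 1 0 ν) + x₃ * (S.L 1 0 ν * S.M 0 1 ν) +
      x₄ * (S.L 1 1 ν * S.M 1 1 ν) = 0 := by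
    have hx : x₁ + x₂ * u + x₃ * v + x₄ * w = 0 := by
      refine (mul_eq_zero.1 ?_).resolve_right (mul_ne_zero hA0 hΛ0)
      linear_combination h - x₂ * eu ν₀ hν₀ - x₃ * ev ν₀ hν₀ - x₄ * ew ν₀ hν₀
    intro ν hν
    linear_combination x₂ * eu ν hν + x₃ * ev ν hν + x₄ * ew ν hν +
      S.L 0 0 ν * S.M 0 0 ν * hx
  have det (t : LaxTerms) (l m : ℤ) : S.value t (.detL ⟨ν₀, hν₀⟩) l m =
      t.L 0 0 l m * S.L 0 0 ν₀ * (t.L 1 1 l m * S.L 1 1 ν₀) -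
        t.L 0 1 l m * S.L 0 1 ν₀ * (t.L 1 0 l m * S.L 1 0 ν₀) := by
    simp [value, Matrix.det_fin_two, laxL]
  refine ((((HasMonomialForm.of_eq (S.termExp 0 1 (true, 1)) (S.termExp 0 1 (true, 0))
    (neg_ne_zero.2 hp)).and (HasMonomialForm.of_eq (S.termExp 0 1 (false, 0))
    (S.termExp 0 1 (false, 1)) (neg_ne_zero.2 hq))).and
    ((HasMonomialForm.of_eq (S.termExp 1 0 (true, 0)) (S.termExp 1 0 (true, 1))
    (neg_ne_zero.2 hs)).and (HasMonomialForm.of_eq (S.termExp 1 0 (false, 1))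
    (S.termExp 1 0 (false, 0)) (neg_ne_zero.2 hr)))).and
    ((HasMonomialForm.of_eq
    (pairExp (.entryM 0 0, 0, 0) (.detL ⟨ν₀, hν₀⟩, 0, 1) + Finsupp.single (.entryL 1 1, 0, 0) 1)
    (pairExp (.entryM 0 0, 1, 0) (.detL ⟨ν₀, hν₀⟩, 0, 0) + Finsupp.single (.entryL 1 1, 0, 1) 1)
    one_ne_zero).and (HasMonomialForm.of_eq
    (pairExp (.entryM 1 1, 0, 0) (.detL ⟨ν₀, hν₀⟩, 0, 1) + Finsupp.single (.entryL 0 0, 0, 0) 1)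
    (pairExp (.entryM 1 1, 1, 0) (.detL ⟨ν₀, hν₀⟩, 0, 0) + Finsupp.single (.entryL 0 0, 0, 1) 1)
    one_ne_zero))).congr fun t hadm => ?_
  rw [system_iff, and_iff_right hadm]
  simp only [monomial_termExp, monomial_add, monomial_pairExp, monomial_single, entry_iff,
    ← forall_and, LaxTerms.factor, det]
  simp only [value, add_zero, one_mul]
  refine forall₂_congr fun l m => ?_
  have ha := (hadm.1 0 0 l m).2 (hL 0 0)
  have ha' := (hadm.1 0 0 l (m + 1)).2 (hL 0 0)
  have hd := (hadm.1 1 1 l m).2 (hL 1 1)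
  have hd' := (hadm.1 1 1 l (m + 1)).2 (hL 1 1)
  have cancel {f : ℂ → ℂ} (hf : AnalyticOnNhd ℂ f S.U) (hf0 : ∃ ν ∈ S.U, f ν ≠ 0) (x y : ℂ)
      (h : ∀ ν ∈ S.U, f ν * (x * S.M 0 0 ν + y * S.M 1 1 ν) = 0) : x = 0 ∧ y = 0 :=
    hΛΔ x y (S.eq_zero_of_mul_eq_zero hf ((analyticOnNhd_const.mul (S.analyticM 0 0)).add
      (analyticOnNhd_const.mul (S.analyticM 1 1))) hf0 h)
  have p0 := ep ν₀ hν₀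
  have q0 := eq ν₀ hν₀
  have r0 := er ν₀ hν₀
  have s0 := es ν₀ hν₀
  constructor
  · intro H
    have h01 := cancel (S.analyticL 0 1) (hL 0 1)
      (t.M 0 0 (l + 1) m * t.L 0 1 l m + q * (t.M 0 1 (l + 1) m * t.L 1 1 l m))
      (-(p * (t.L 0 0 l (m + 1) * t.M 0 1 l m) + t.L 0 1 l (m + 1) * t.M 1 1 l m)) fun ν hν => by
        linear_combination -(H ν hν).1.2 + t.L 0 0 l (m + 1) * t.M 0 1 l m * ep ν hν -
          t.M 0 1 (l + 1) m * t.L 1 1 l m * eq ν hν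
    have h10 := cancel (S.analyticL 1 0) (hL 1 0)
      (t.L 1 0 l (m + 1) * t.M 0 0 l m + s * (t.L 1 1 l (m + 1) * t.M 1 0 l m))
      (-(r * (t.M 1 0 (l + 1) m * t.L 0 0 l m) + t.M 1 1 (l + 1) m * t.L 1 0 l m)) fun ν hν => by
        linear_combination (H ν hν).2.1 - t.L 1 1 l (m + 1) * t.M 1 0 l m * es ν hν +
          t.M 1 0 (l + 1) m * t.L 0 0 l m * er ν hν
    obtain ⟨⟨h00, -⟩, -, h11⟩ := H ν₀ hν₀
    obtain ⟨h1, h2⟩ := h01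
    obtain ⟨h3, h4⟩ := h10
    refine ⟨⟨⟨by linear_combination -h2, by linear_combination h1⟩, by linear_combination h3,
      by linear_combination -h4⟩, ?_, ?_⟩
    · refine mul_right_cancel₀ hΛ0 ?_
      linear_combination t.L 1 1 l m * t.L 1 1 l (m + 1) * S.L 1 1 ν₀ * h00 -
        t.L 1 1 l m * t.L 0 1 l (m + 1) * S.L 0 1 ν₀ *
          (S.L 1 0 ν₀ * S.M 0 0 ν₀ * h3 + t.L 1 1 l (m + 1) * t.M 1 0 l m * s0) +
        t.L 1 1 l (m + 1) * t.L 1 0 l m * S.L 1 0 ν₀ *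
          (S.L 0 1 ν₀ * S.M 0 0 ν₀ * h1 + t.M 0 1 (l + 1) m * t.L 1 1 l m * q0)
    · refine mul_right_cancel₀ hΔ0 ?_
      linear_combination t.L 0 0 l m * t.L 0 0 l (m + 1) * S.L 0 0 ν₀ * h11 -
        t.L 0 0 l m * t.L 1 0 l (m + 1) * S.L 1 0 ν₀ *
          (t.L 0 0 l (m + 1) * t.M 0 1 l m * p0 - S.L 0 1 ν₀ * S.M 1 1 ν₀ * h2) +
        t.L 0 0 l (m + 1) * t.L 0 1 l m * S.L 0 1 ν₀ *
          (t.M 1 0 (l + 1) m * t.L 0 0 l m * r0 - S.L 1 0 ν₀ * S.M 1 1 ν₀ * h4)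
  · rintro ⟨⟨⟨h1, h2⟩, h3, h4⟩, h5, h6⟩ ν hν
    refine ⟨⟨?_, ?_⟩, ?_, ?_⟩
    · have h00 := spread (t.L 0 0 l (m + 1) * t.M 0 0 l m - t.M 0 0 (l + 1) m * t.L 0 0 l m)
        (t.L 0 1 l (m + 1) * t.M 1 0 l m) (-(t.M 0 1 (l + 1) m * t.L 1 0 l m)) 0 (by
          refine (mul_eq_zero.1 ?_).resolve_left (mul_ne_zero (mul_ne_zero hd hd') hD0)
          linear_combination S.M 0 0 ν₀ * h5 + t.L 1 1 l m * t.L 0 1 l (m + 1) * S.L 0 1 ν₀ *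
              (S.L 1 0 ν₀ * S.M 0 0 ν₀ * h3 + t.L 1 1 l (m + 1) * t.M 1 0 l m * s0) -
            t.L 1 1 l (m + 1) * t.L 1 0 l m * S.L 1 0 ν₀ *
              (S.L 0 1 ν₀ * S.M 0 0 ν₀ * h2 + t.M 0 1 (l + 1) m * t.L 1 1 l m * q0))
      linear_combination h00 ν hν
    · linear_combination S.L 0 1 ν * S.M 1 1 ν * h1 - S.L 0 1 ν * S.M 0 0 ν * h2 +
        t.L 0 0 l (m + 1) * t.M 0 1 l m * ep ν hν - t.M 0 1 (l + 1) m * t.L 1 1 l m * eq ν hν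
    · linear_combination S.L 1 0 ν * S.M 0 0 ν * h3 - S.L 1 0 ν * S.M 1 1 ν * h4 +
        t.L 1 1 l (m + 1) * t.M 1 0 l m * es ν hν - t.M 1 0 (l + 1) m * t.L 0 0 l m * er ν hν
    · have h11 := spread 0 (-(t.M 1 0 (l + 1) m * t.L 0 1 l m)) (t.L 1 0 l (m + 1) * t.M 0 1 l m)
        (t.L 1 1 l (m + 1) * t.M 1 1 l m - t.M 1 1 (l + 1) m * t.L 1 1 l m) (by
          refine (mul_eq_zero.1 ?_).resolve_left (mul_ne_zero (mul_ne_zero ha ha') hA0)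
          linear_combination S.M 1 1 ν₀ * h6 + t.L 0 0 l m * t.L 1 0 l (m + 1) * S.L 1 0 ν₀ *
              (t.L 0 0 l (m + 1) * t.M 0 1 l m * p0 + S.L 0 1 ν₀ * S.M 1 1 ν₀ * h1) -
            t.L 0 0 l (m + 1) * t.L 0 1 l m * S.L 0 1 ν₀ *
              (t.M 1 0 (l + 1) m * t.L 0 0 l m * r0 + S.L 1 0 ν₀ * S.M 1 1 ν₀ * h4))
      linear_combination h11 ν hν

theorem numUnknowns_sub_numGauge_of_forall_ne
    (hL : ∀ i j, S.NonzeroL i j) (hM : ∀ i j, S.NonzeroM i j) :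
    S.numUnknowns - S.numGauge = 6 := by
  rw [numGauge_eq_two fun i => ⟨0, .inl (hL i 0)⟩, numUnknowns_eq]
  simp [hL, hM]

theorem overdetermined_of_seven_le (hL : ∀ i j, S.NonzeroL i j) (hM : ∀ i j, S.NonzeroM i j)
    (h : 7 ≤ S.numEquations) : S.Overdetermined :=
  .inl (by rw [numUnknowns_sub_numGauge_of_forall_ne hL hM]; lia)

theorem one_le_entryRank_of_forall_ne (hL : ∀ i j, S.NonzeroL i j) (hM : ∀ i j, S.NonzeroM i j)
    (i j : Fin 2) : 1 ≤ S.entryRank i j :=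
  one_le_entryRank (mul_LM_mem_products i 0 j)
    (S.exists_mul_ne_zero (S.analyticL i 0) (S.analyticM 0 j) (hL i 0) (hM 0 j))

theorem underdetermined_of_proportionalOn
    (hL : ∀ i j, S.NonzeroL i j) (hM : ∀ i j, S.NonzeroM i j)
    (hD : ProportionalOn S.U (S.L 1 1) (S.L 0 0)) (hΔ : ProportionalOn S.U (S.M 1 1) (S.M 0 0))
    (hBΓ : ProportionalOn S.U (fun ν => S.L 0 1 ν * S.M 1 0 ν) fun ν => S.L 0 0 ν * S.M 0 0 ν)
    (hCΞ : ProportionalOn S.U (fun ν => S.L 1 0 ν * S.M 0 1 ν) fun ν => S.L 0 0 ν * S.M 0 0 ν)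
    (h01 : ProportionalOn S.U (fun ν => S.L 0 0 ν * S.M 0 1 ν) fun ν => S.L 0 1 ν * S.M 0 0 ν)
    (h10 : ProportionalOn S.U (fun ν => S.L 1 0 ν * S.M 0 0 ν) fun ν => S.L 0 0 ν * S.M 1 0 ν) :
    S.Underdetermined := by
  obtain ⟨d, -, ed⟩ := hD
  obtain ⟨δ, -, eδ⟩ := hΔ
  obtain ⟨p, -, ep⟩ := hBΓ
  obtain ⟨q, -, eq⟩ := hCΞ
  obtain ⟨r, -, er⟩ := h01
  obtain ⟨s, -, es⟩ := h10
  have e00 : S.entryRank 0 0 ≤ 1 := by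
    refine entryRank_le_one (fun ν => S.L 0 0 ν * S.M 0 0 ν) (Fin.forall_fin_two.2
      ⟨⟨⟨1, fun ν hν => ?_⟩, 1, fun ν hν => ?_⟩, ⟨p, ep⟩, q, fun ν hν => ?_⟩)
    · ring
    · ring
    · linear_combination eq ν hν
  have e11 : S.entryRank 1 1 ≤ 1 := by
    refine entryRank_le_one (fun ν => S.L 0 0 ν * S.M 0 0 ν) (Fin.forall_fin_two.2
      ⟨⟨⟨q, eq⟩, p, fun ν hν => ?_⟩, ⟨d * δ, fun ν hν => ?_⟩, d * δ, fun ν hν => ?_⟩)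
    · linear_combination ep ν hν
    · rw [ed ν hν, eδ ν hν]; ring
    · rw [ed ν hν, eδ ν hν]; ring
  have e01 : S.entryRank 0 1 ≤ 1 := by
    refine entryRank_le_one (fun ν => S.L 0 1 ν * S.M 0 0 ν) (Fin.forall_fin_two.2
      ⟨⟨⟨r, er⟩, 1, fun ν hν => ?_⟩, ⟨δ, fun ν hν => ?_⟩, d * r, fun ν hν => ?_⟩)
    · ring
    · rw [eδ ν hν]; ring
    · linear_combination S.M 0 1 ν * ed ν hν + d * er ν hν
  have e10 : S.entryRank 1 0 ≤ 1 := by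
    refine entryRank_le_one (fun ν => S.L 0 0 ν * S.M 1 0 ν) (Fin.forall_fin_two.2
      ⟨⟨⟨s, es⟩, 1, fun ν hν => ?_⟩, ⟨d, fun ν hν => ?_⟩, δ * s, fun ν hν => ?_⟩)
    · ring
    · rw [ed ν hν]; ring
    · linear_combination S.L 1 0 ν * eδ ν hν + δ * es ν hν
  rw [Underdetermined, numUnknowns_sub_numGauge_of_forall_ne hL hM, numEquations_eq]
  lia

/-- Without zero terms and with proportional diagonal spectral factors in either matrix, the
generic possibilities are LMKdV₂ and LSG₂. -/
theorem classified_of_diagonal_proportionalOn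
    (hL : ∀ i j, S.NonzeroL i j) (hM : ∀ i j, S.NonzeroM i j)
    (hD : ProportionalOn S.U (S.L 1 1) (S.L 0 0))
    (hΔ : ProportionalOn S.U (S.M 1 1) (S.M 0 0)) : S.Classified := by
  have LM (i j i' j') : AnalyticOnNhd ℂ (fun ν => S.L i j ν * S.M i' j' ν) S.U :=
    (S.analyticL i j).mul (S.analyticM i' j')
  have LM0 (i j i' j') : ∃ ν ∈ S.U, S.L i j ν * S.M i' j' ν ≠ 0 :=
    S.exists_mul_ne_zero (S.analyticL i j) (S.analyticM i' j') (hL i j) (hM i' j')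
  have le := one_le_entryRank_of_forall_ne hL hM
  by_cases h : ProportionalOn S.U (fun ν => S.L 0 1 ν * S.M 1 0 ν)
      (fun ν => S.L 0 0 ν * S.M 0 0 ν) ∧
      ProportionalOn S.U (fun ν => S.L 1 0 ν * S.M 0 1 ν) (fun ν => S.L 0 0 ν * S.M 0 0 ν)
  · obtain ⟨hBΓ, hCΞ⟩ := h
    obtain ⟨p, hp, ep⟩ := hBΓ.symm
    obtain ⟨q, hq, eq⟩ := hCΞ
    by_cases h01 : ProportionalOn S.U (fun ν => S.L 0 0 ν * S.M 0 1 ν)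
        fun ν => S.L 0 1 ν * S.M 0 0 ν
    · refine .inr (.inl (underdetermined_of_proportionalOn hL hM hD hΔ hBΓ ⟨q, hq, eq⟩ h01 ?_))
      obtain ⟨r, hr, er⟩ := h01.symm
      exact S.proportionalOn_of_mul_left (LM _ _ _ _) (LM _ _ _ _) (S.analyticL 0 1) (hL 0 1)
        ⟨r * q * p, mul_ne_zero (mul_ne_zero hr hq) hp, fun ν hν => by
          linear_combination S.L 1 0 ν * er ν hν + r * S.L 0 0 ν * eq ν hν +
            r * q * S.L 0 0 ν * ep ν hν⟩
    · refine .inr (.inr (.inr (.inr (.inl fun lam mu hlam hmu => reducibleTo_LSG2 hmu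
        (fun i j _ => hL i j) hM (.inl ⟨hL 0 1, hlam⟩) hD hΔ ⟨q, hq, eq⟩ (.inr hBΓ)
        (.inr (independentOn_of_not_proportionalOn (LM0 ..) (LM0 ..) h01))
        (independentOn_of_not_proportionalOn (LM0 ..) (LM0 ..) fun h10 => h01 ?_)))))
      obtain ⟨s, hs, es⟩ := h10.symm
      exact S.proportionalOn_of_mul_left (LM _ _ _ _) (LM _ _ _ _) (S.analyticL 1 0) (hL 1 0)
        ⟨q * p * s, mul_ne_zero (mul_ne_zero hq hp) hs, fun ν hν => by
          linear_combination S.L 0 0 ν * eq ν hν + q * S.L 0 0 ν * ep ν hν +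
            q * p * S.L 0 1 ν * es ν hν⟩
  by_cases h' : ProportionalOn S.U (fun ν => S.L 0 0 ν * S.M 0 1 ν)
      (fun ν => S.L 0 1 ν * S.M 0 0 ν) ∧
      ProportionalOn S.U (fun ν => S.L 1 0 ν * S.M 0 0 ν) (fun ν => S.L 0 0 ν * S.M 1 0 ν)
  · obtain ⟨h01, h10⟩ := h'
    have h11 : ProportionalOn S.U (fun ν => S.L 0 1 ν * S.M 1 0 ν)
        fun ν => S.L 1 0 ν * S.M 0 1 ν := by
      obtain ⟨r, hr, er⟩ := h01.symm
      obtain ⟨s, hs, es⟩ := h10.symm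
      exact S.proportionalOn_of_mul_left (LM _ _ _ _) (LM _ _ _ _) (S.analyticL 0 0) (hL 0 0)
        ⟨s * r, mul_ne_zero hs hr, fun ν hν => by
          linear_combination S.L 0 1 ν * es ν hν + s * S.L 1 0 ν * er ν hν⟩
    exact .inr (.inr (.inr (.inl fun lam hlam => reducibleTo_LMKdV2 (fun i j _ => hL i j) hM
      (.inl ⟨hD, hlam⟩) hΔ h01 h11 (independentOn_of_not_proportionalOn (LM0 ..) (LM0 ..)
        fun hi => h ⟨hi.symm, h11.symm.trans hi.symm⟩))))
  refine .inr (.inr (.inl (overdetermined_of_seven_le hL hM ?_)))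
  have hDΔ := hD.mul hΔ
  have e0011 : 2 ≤ S.entryRank 0 0 ∧ 2 ≤ S.entryRank 1 1 := by
    obtain h | h := not_and_or.1 h
    · refine ⟨two_le_entryRank_of_not_proportionalOn (mul_LM_mem_products 0 1 0)
        (mul_LM_mem_products 0 0 0) (LM0 ..) (LM0 ..) h,
        two_le_entryRank_of_not_proportionalOn (f := fun ν => S.M 1 0 ν * S.L 0 1 ν)
          (mul_ML_mem_products 1 0 1)
        (mul_LM_mem_products 1 1 1) ?_ (LM0 ..) fun h2 => h ?_⟩
      · simpa only [mul_comm] using LM0 0 1 1 0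
      · simpa only [mul_comm] using h2.trans hDΔ
    · refine ⟨two_le_entryRank_of_not_proportionalOn (f := fun ν => S.M 0 1 ν * S.L 1 0 ν)
        (mul_ML_mem_products 0 1 0)
        (mul_LM_mem_products 0 0 0) ?_ (LM0 ..) fun h2 => h ?_,
        two_le_entryRank_of_not_proportionalOn (mul_LM_mem_products 1 0 1)
          (mul_LM_mem_products 1 1 1) (LM0 ..) (LM0 ..) fun h2 => h (h2.trans hDΔ)⟩
      · simpa only [mul_comm] using LM0 1 0 0 1
      · simpa only [mul_comm] using h2
  have e0110 : 3 ≤ S.entryRank 0 1 + S.entryRank 1 0 := by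
    obtain h | h := not_and_or.1 h'
    · have := two_le_entryRank_of_not_proportionalOn (g := fun ν => S.M 0 0 ν * S.L 0 1 ν)
        (mul_LM_mem_products 0 0 1)
        (mul_ML_mem_products 0 0 1) (LM0 ..) (by simpa only [mul_comm] using LM0 0 1 0 0)
        fun h2 => h (by simpa only [mul_comm] using h2)
      have := le 1 0
      lia
    · have := two_le_entryRank_of_not_proportionalOn (g := fun ν => S.M 1 0 ν * S.L 0 0 ν)
        (mul_LM_mem_products 1 0 0)
        (mul_ML_mem_products 1 0 0) (LM0 ..) (by simpa only [mul_comm] using LM0 0 0 1 0)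
        fun h2 => h (by simpa only [mul_comm] using h2)
      have := le 0 1
      lia
  rw [numEquations_eq]
  lia

/-- Without zero terms and with diagonal spectral factors that are not proportional in one of the
matrices, the off-diagonal entries alone give four equations. The system then has too many equations
or is multiplicatively linear. -/
theorem classified_of_diagonal_not_proportionalOn
    (hL : ∀ i j, S.NonzeroL i j) (hM : ∀ i j, S.NonzeroM i j)
    (h : ¬ (ProportionalOn S.U (S.L 1 1) (S.L 0 0) ∧ ProportionalOn S.U (S.M 1 1) (S.M 0 0))) :
    S.Classified := by
  have LM0 (i j i' j') : ∃ ν ∈ S.U, S.L i j ν * S.M i' j' ν ≠ 0 :=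
    S.exists_mul_ne_zero (S.analyticL i j) (S.analyticM i' j') (hL i j) (hM i' j')
  have ML0 (i j i' j') : ∃ ν ∈ S.U, S.M i j ν * S.L i' j' ν ≠ 0 :=
    S.exists_mul_ne_zero (S.analyticM i j) (S.analyticL i' j') (hM i j) (hL i' j')
  have le := one_le_entryRank_of_forall_ne hL hM
  -- Entry `(i, j)` with `i ≠ j` contains two products with a common off-diagonal factor of either
  -- matrix, the other factors being the diagonal ones of the other matrix.
  have off (i j : Fin 2) (hij : i ≠ j) : 2 ≤ S.entryRank i j := by
    obtain h | h := not_and_or.1 h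
    · refine two_le_entryRank_of_not_proportionalOn (mul_LM_mem_products i i j)
        (mul_ML_mem_products i j j) (LM0 ..) (ML0 ..) fun h2 => h ?_
      have h3 : ProportionalOn S.U (S.L i i) (S.L j j) :=
        S.proportionalOn_of_mul_left (S.analyticL i i) (S.analyticL j j) (S.analyticM i j) (hM i j)
          (by simpa only [mul_comm] using h2)
      fin_cases i <;> fin_cases j
      exacts [absurd rfl hij, h3.symm, h3, absurd rfl hij]
    · refine two_le_entryRank_of_not_proportionalOn (mul_LM_mem_products i j j)
        (mul_ML_mem_products i i j) (LM0 ..) (ML0 ..) fun h2 => h ?_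
      have h3 : ProportionalOn S.U (S.M j j) (S.M i i) :=
        S.proportionalOn_of_mul_left (S.analyticM j j) (S.analyticM i i) (S.analyticL i j) (hL i j)
          (by simpa only [mul_comm] using h2)
      fin_cases i <;> fin_cases j
      exacts [absurd rfl hij, h3, h3.symm, absurd rfl hij]
  have h01 := off 0 1 (by simp)
  have h10 := off 1 0 (by simp)
  have l00 := le 0 0
  have l11 := le 1 1
  by_cases hE : 7 ≤ S.numEquations
  · exact .inr (.inr (.inl (overdetermined_of_seven_le hL hM hE)))
  rw [numEquations_eq] at hE
  have hBΓ : ProportionalOn S.U (fun ν => S.L 0 1 ν * S.M 1 0 ν)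
      fun ν => S.L 0 0 ν * S.M 0 0 ν := by
    by_contra hn
    have := two_le_entryRank_of_not_proportionalOn (mul_LM_mem_products 0 1 0)
      (mul_LM_mem_products 0 0 0) (LM0 ..) (LM0 ..) hn
    lia
  have hCΞ : ProportionalOn S.U (fun ν => S.L 1 0 ν * S.M 0 1 ν)
      fun ν => S.L 0 0 ν * S.M 0 0 ν := by
    by_contra hn
    have := two_le_entryRank_of_not_proportionalOn (f := fun ν => S.M 0 1 ν * S.L 1 0 ν)
      (mul_ML_mem_products 0 1 0) (mul_LM_mem_products 0 0 0) (ML0 ..) (LM0 ..)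
      fun h2 => hn (by simpa only [mul_comm] using h2)
    lia
  have hDΔ : ProportionalOn S.U (fun ν => S.L 1 1 ν * S.M 1 1 ν)
      fun ν => S.L 0 0 ν * S.M 0 0 ν := by
    refine .trans (.symm ?_) hCΞ
    by_contra hn
    have := two_le_entryRank_of_not_proportionalOn (mul_LM_mem_products 1 0 1)
      (mul_LM_mem_products 1 1 1) (LM0 ..) (LM0 ..) hn
    lia
  have hΛΔ : ¬ ProportionalOn S.U (S.M 0 0) (S.M 1 1) := fun hp => by
    refine h ⟨S.proportionalOn_of_mul_left (S.analyticL 1 1) (S.analyticL 0 0) (S.analyticM 1 1)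
      (hM 1 1) (.trans (g := fun ν => S.M 0 0 ν * S.L 0 0 ν) (by simpa only [mul_comm] using hDΔ)
      (hp.mul (.refl _ _))), hp.symm⟩
  have hB : IndependentOn S.U (fun ν => S.M 0 0 ν * S.L 0 1 ν) fun ν => S.L 0 1 ν * S.M 1 1 ν :=
    independentOn_of_not_proportionalOn (ML0 ..) (LM0 ..) fun hp =>
      hΛΔ (S.proportionalOn_of_mul_left (S.analyticM 0 0) (S.analyticM 1 1) (S.analyticL 0 1)
        (hL 0 1) (by simpa only [mul_comm] using hp))
  have hC : IndependentOn S.U (fun ν => S.L 1 0 ν * S.M 0 0 ν) fun ν => S.M 1 1 ν * S.L 1 0 ν :=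
    independentOn_of_not_proportionalOn (LM0 ..) (ML0 ..) fun hp =>
      hΛΔ (S.proportionalOn_of_mul_left (S.analyticM 0 0) (S.analyticM 1 1) (S.analyticL 1 0)
        (hL 1 0) (by simpa only [mul_comm] using hp))
  have hi := independentOn_of_not_proportionalOn (hM 0 0) (hM 1 1) hΛΔ
  obtain ⟨p, q, e⟩ := exists_relation_of_entryRank_le_two
    (h := fun ν => S.L 0 0 ν * S.M 0 1 ν) (by lia) (mul_ML_mem_products 0 0 1)
    (mul_LM_mem_products 0 1 1) (mul_LM_mem_products 0 0 1) hB
  obtain ⟨p', q', e'⟩ := exists_relation_of_entryRank_le_two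
    (h := fun ν => S.M 0 1 ν * S.L 1 1 ν) (by lia) (mul_ML_mem_products 0 0 1)
    (mul_LM_mem_products 0 1 1) (mul_ML_mem_products 0 1 1) hB
  obtain ⟨hΞA, hΞD⟩ := proportionalOn_of_relations (S.analyticL 0 1) (S.analyticM 0 0)
    (S.analyticM 1 1) (hL 0 1) (hM 1 1) hi (ML0 0 1 0 0) (ML0 0 1 1 1) hDΔ.symm
    ⟨p, q, fun ν hν => by linear_combination e ν hν⟩
    ⟨p', q', fun ν hν => by linear_combination e' ν hν⟩
  obtain ⟨p, q, e⟩ := exists_relation_of_entryRank_le_two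
    (h := fun ν => S.M 1 0 ν * S.L 0 0 ν) (by lia) (mul_LM_mem_products 1 0 0)
    (mul_ML_mem_products 1 1 0) (mul_ML_mem_products 1 0 0) hC
  obtain ⟨p', q', e'⟩ := exists_relation_of_entryRank_le_two
    (h := fun ν => S.L 1 1 ν * S.M 1 0 ν) (by lia) (mul_LM_mem_products 1 0 0)
    (mul_ML_mem_products 1 1 0) (mul_LM_mem_products 1 1 0) hC
  obtain ⟨hΓA, hΓD⟩ := proportionalOn_of_relations (S.analyticL 1 0) (S.analyticM 0 0)
    (S.analyticM 1 1) (hL 1 0) (hM 1 1) hi (ML0 1 0 0 0) (ML0 1 0 1 1) hDΔ.symm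
    ⟨p, q, fun ν hν => by linear_combination e ν hν⟩
    ⟨p', q', fun ν hν => by linear_combination e' ν hν⟩
  exact .inl (.inl (multiplicativelyLinear_of_adjugate hL hM hi hΞA hΞD hΓA hΓD hBΓ hCΞ hDΔ))

/-! ### The classification -/

/-- The cases in which no off-diagonal term is zero, but `D` or `Δ` is. -/
theorem classified_of_D_or_Δ_eq_zero {t : LaxTerms} (ht : S.System t) (hB : S.NonzeroL 0 1)
    (hC : S.NonzeroL 1 0) (hΞ : S.NonzeroM 0 1) (hΓ : S.NonzeroM 1 0)
    (hDΔ : (∀ ν ∈ S.U, S.L 1 1 ν = 0) ∨ ∀ ν ∈ S.U, S.M 1 1 ν = 0) : S.Classified := by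
  obtain hA | hA := eqOn_zero_or_exists S.U (S.L 0 0)
  · exact classified_of_diagonal_products_eq_zero ht (.inl hA) hDΔ
  obtain hΛ | hΛ := eqOn_zero_or_exists S.U (S.M 0 0)
  · exact classified_of_diagonal_products_eq_zero ht (.inr hΛ) hDΔ
  have three {N : Matrix (Fin 2) (Fin 2) (ℂ → ℂ)} (h00 : ∃ ν ∈ S.U, N 0 0 ν ≠ 0)
      (h01 : ∃ ν ∈ S.U, N 0 1 ν ≠ 0) (h10 : ∃ ν ∈ S.U, N 1 0 ν ≠ 0) :
      ∀ i j, (i, j) ≠ (1, 1) → ∃ ν ∈ S.U, N i j ν ≠ 0 := by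
    simp [Fin.forall_fin_two, h00, h01, h10]
  have four {N : Matrix (Fin 2) (Fin 2) (ℂ → ℂ)} (h00 : ∃ ν ∈ S.U, N 0 0 ν ≠ 0)
      (h01 : ∃ ν ∈ S.U, N 0 1 ν ≠ 0) (h10 : ∃ ν ∈ S.U, N 1 0 ν ≠ 0)
      (h11 : ∃ ν ∈ S.U, N 1 1 ν ≠ 0) : ∀ i j, ∃ ν ∈ S.U, N i j ν ≠ 0 := by
    simp [Fin.forall_fin_two, h00, h01, h10, h11]
  obtain hD | hD := eqOn_zero_or_exists S.U (S.L 1 1)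
  · obtain hΔ | hΔ := eqOn_zero_or_exists S.U (S.M 1 1)
    · exact .inl (.inl (multiplicativelyLinear_of_D_Δ_eq_zero ht hA hC hD hΛ hΞ hΔ))
    · exact classified_of_D_eq_zero ht (three hA hB hC) (four hΛ hΞ hΓ hΔ) hD
  · exact .of_exchange (classified_of_D_eq_zero (S := S.exchange) ((system_exchange t).2 ht)
      (three hΛ hΞ hΓ) (four hA hB hC hD) (hDΔ.resolve_left fun h =>
        let ⟨ν, hν, hne⟩ := hD; hne (h ν hν)))

theorem classified (S : LaxSpectrum) : S.Classified := by
  by_cases h : ∃ t, S.System t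
  swap
  · exact .inr (.inr (.inl (.inr (not_exists.1 h))))
  obtain ⟨t, ht⟩ := h
  have ht' := (system_swapIndices t).2 ht
  obtain hB | hB := eqOn_zero_or_exists S.U (S.L 0 1)
  · exact classified_of_B_eq_zero ht hB
  obtain hC | hC := eqOn_zero_or_exists S.U (S.L 1 0)
  · exact .of_swapIndices (classified_of_B_eq_zero ht' hC)
  obtain hΞ | hΞ := eqOn_zero_or_exists S.U (S.M 0 1)
  · exact .of_exchange (classified_of_B_eq_zero ((system_exchange t).2 ht) hΞ)
  obtain hΓ | hΓ := eqOn_zero_or_exists S.U (S.M 1 0)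
  · exact .of_swapIndices (.of_exchange (classified_of_B_eq_zero
      ((system_exchange t.swapIndices).2 ht') hΓ))
  obtain hD | hD := eqOn_zero_or_exists S.U (S.L 1 1)
  · exact classified_of_D_or_Δ_eq_zero ht hB hC hΞ hΓ (.inl hD)
  obtain hΔ | hΔ := eqOn_zero_or_exists S.U (S.M 1 1)
  · exact classified_of_D_or_Δ_eq_zero ht hB hC hΞ hΓ (.inr hΔ)
  obtain hA | hA := eqOn_zero_or_exists S.U (S.L 0 0)
  · exact .of_swapIndices (classified_of_D_or_Δ_eq_zero ht' hC hB hΓ hΞ (.inl hA))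
  obtain hΛ | hΛ := eqOn_zero_or_exists S.U (S.M 0 0)
  · exact .of_swapIndices (classified_of_D_or_Δ_eq_zero ht' hC hB hΓ hΞ (.inr hΛ))
  have hL : ∀ i j, S.NonzeroL i j :=
    Fin.forall_fin_two.2 ⟨Fin.forall_fin_two.2 ⟨hA, hB⟩, Fin.forall_fin_two.2 ⟨hC, hD⟩⟩
  have hM : ∀ i j, S.NonzeroM i j :=
    Fin.forall_fin_two.2 ⟨Fin.forall_fin_two.2 ⟨hΛ, hΞ⟩, Fin.forall_fin_two.2 ⟨hΓ, hΔ⟩⟩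
  by_cases h : ProportionalOn S.U (S.L 1 1) (S.L 0 0) ∧ ProportionalOn S.U (S.M 1 1) (S.M 0 0)
  · exact classified_of_diagonal_proportionalOn hL hM h.1 h.2
  · exact classified_of_diagonal_not_proportionalOn hL hM h

end LaxSpectrum

theorem theorem1 (S : LaxSpectrum) :
    S.Trivial ∨ S.Underdetermined ∨ S.Overdetermined ∨
    (∀ lam : ℤ → ℂ, (∀ l, lam l ≠ 0) → S.ReducibleTo (LMKdV2 lam) (laxLMKdV2 lam)) ∨
    (∀ lam mu : ℤ → ℂ, (∀ l, lam l ≠ 0) → (∀ m, mu m ≠ 0) →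
      S.ReducibleTo (LSG2 lam mu) (laxLSG2 lam mu)) ∨
    S.ReducibleTo (LMKdV2 0) (laxLMKdV2 0) ∨
    (∀ mu : ℤ → ℂ, (∀ m, mu m ≠ 0) → S.ReducibleTo (LSG2 0 mu) (laxLSG2 0 mu)) ∨
    S.ReducibleTo (LSG 0 0) laxDegenerateLSG :=
  S.classified
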